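/- Let $TG$ be the triangular grid in $\mathbb C\cong\mathbb R^2$: its vertices are the integer combinations of $1$ and $e^{\pi i/3}$, and straight edges join the vertices at distance $1$. For $R>0$ let $\mathfrak B_R$ be the union of all closed hexagonal faces of the dual hexagonal grid $TG^*$ (each centered at a vertex of $TG$) that intersect the ball $B(0,R)$. A system consists of the following data. $D\subset\mathbb R^2$ is a bounded domain (nonempty, open, connected) whose boundary $\partial D$ is a subgraph of $TG$. $V_D$, $V_\partial$ and $V=V_D\cup V_\partial$ are the sets of vertices of $TG$ in $D$, in $\partial D$ and in $\overline D$. $h_\partial:V_\partial\to\mathbb R$ is a function. $V_+,V_-\subset V_D$ are nonempty disjoint sets such that every vertex of $V_+$ has a neighbor in $V_-\cup V_\partial$ and every vertex of $V_-$ has a neighbor in $V_+\cup V_\partial$. Set $U=V_\partial\cup V_+\cup V_-$. The DGFF $h$ in $D$ with boundary values $h_\partial$ is the random function on $V$ that agrees with $h_\partial$ on $V_\partial$ and whose density with respect to Lebesgue measure on $\mathbb R^{V_D}$ is proportional to $\exp\bigl(-\frac12\sum_{\{u,v\}}(h(u)-h(v))^2\bigr)$, the sum being over the edges of $TG$ with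 both endpoints in $V$. Let $\mathcal K$ be the event that $h>0$ on $V_+$ and $h<0$ on $V_-$, and let $h_{\mathcal K}$ be $h$ conditioned on $\mathcal K$. **Proposition (Heights interface continuity).** For every $\bar\Lambda>0$ and every $\epsilon>0$ there is some $R=R(\epsilon,\bar\Lambda)>1/\epsilon$ such that the following holds. Let $(D,h_\partial,V_+,V_-)$ and $(\hat D,\hat h_\partial,\hat V_+,\hat V_-)$ be two systems with $\|h_\partial\|_\infty\le\bar\Lambda$ and $\|\hat h_\partial\|_\infty\le\bar\Lambda$. Suppose that they are the same within $\mathfrak B_R$; that is, $D\cap\mathfrak B_R=\hat D\cap\mathfrak B_R$, $h_\partial|_{\mathfrak B_R}=\hat h_\partial|_{\mathfrak B_R}$, $V_+\cap\mathfrak B_R=\hat V_+\cap\mathfrak B_R$ and $V_-\cap\mathfrak B_R=\hat V_-\cap\mathfrak B_R$. Suppose further that $0\in U$. Then there is a coupling of $h_{\mathcal K}$ and $h_{\hat{\mathcal K}}$ such that for every vertex $v\in\mathfrak B_{1/\epsilon}$ of $TG$ at which both fields are defined, i.e. $v\in\overline D\cap\overline{\hat D}$ (within $\mathfrak B_{1/\epsilon}$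 this is the same as $v\in\overline D$), $$\mathbf E\bigl[|h_{\mathcal K}(v)-h_{\hat{\mathcal K}}(v)|\bigr]<\epsilon .$$ -/

import Mathlib

open MeasureTheory ProbabilityTheory

noncomputable section

/-! ## The triangular grid -/

/-- Vertices of the triangular grid `TG`, in the coordinates `(a, b) ↦ a + b e^{πi/3}`. -/
abbrev TGVertex : Type := ℤ × ℤ

/-- The point `a + b e^{πi/3}` of the complex plane at which the vertex `(a, b)` sits. -/
def TGpos (v : TGVertex) : ℂ :=
  (v.1 : ℂ) + (v.2 : ℂ) * Complex.exp ((Real.pi : ℂ) * Complex.I / 3)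

/-- The triangular grid: two vertices are joined when they are at distance `1`. -/
def TG : SimpleGraph TGVertex where
  Adj v w := ‖TGpos v - TGpos w‖ = 1
  symm := ⟨fun v w h => by rw [norm_sub_rev]; exact h⟩
  loopless := ⟨fun v h => by simp at h⟩

/-- The subset of the plane drawn by a subgraph of `TG`: its vertices and its (closed,
straight) edges. -/
def TGcarrier (H : TG.Subgraph) : Set ℂ :=
  TGpos '' H.verts ∪ {z | ∃ v w, H.Adj v w ∧ z ∈ segment ℝ (TGpos v) (TGpos w)}

/-- The closed face, centered at the vertex `v`, of the hexagonal grid dual to `TG`; it is the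
closed Voronoi cell of `v`, a regular hexagon whose corners are the centers of the six triangles
of `TG` that contain `v`. -/
def TGhexagon (v : TGVertex) : Set ℂ :=
  {z | ∀ w : TGVertex, dist z (TGpos v) ≤ dist z (TGpos w)}

/-- The set `𝔅_R`: the union of all hexagons of the dual grid that intersect the ball
`B(0, R)`. -/
def hexBall (R : ℝ) : Set ℂ :=
  {z | ∃ v : TGVertex, (TGhexagon v ∩ Metric.ball 0 R).Nonempty ∧ z ∈ TGhexagon v}

/-- A bounded domain (nonempty, open, connected) in the plane whose boundary is a subgraph
of `TG`. -/
structure IsTGRegion (D : Set ℂ) : Prop where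
  isOpen : IsOpen D
  isConnected : IsConnected D
  isBounded : Bornology.IsBounded D
  frontier_eq : ∃ H : TG.Subgraph, frontier D = TGcarrier H

theorem TGvertices_finite {D : Set ℂ} (hD : Bornology.IsBounded D) :
    {v : TGVertex | TGpos v ∈ closure D}.Finite := by
  obtain ⟨M, hM⟩ := hD.closure.exists_norm_le
  have hcos : (Complex.exp ((Real.pi : ℂ) * Complex.I / 3)).re = 1 / 2 := by
    have : (Real.pi : ℂ) * Complex.I / 3 = ((Real.pi / 3 : ℝ) : ℂ) * Complex.I := by
      push_cast; ring
    rw [this, Complex.exp_ofReal_mul_I_re, Real.cos_pi_div_three]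
  have hsin : (Complex.exp ((Real.pi : ℂ) * Complex.I / 3)).im = √3 / 2 := by
    have : (Real.pi : ℂ) * Complex.I / 3 = ((Real.pi / 3 : ℝ) : ℂ) * Complex.I := by
      push_cast; ring
    rw [this, Complex.exp_ofReal_mul_I_im, Real.sin_pi_div_three]
  have h3 : (1 : ℝ) ≤ √3 := by
    rw [Real.one_le_sqrt]; norm_num
  refine ((Set.finite_Icc (-⌈2 * M⌉) ⌈2 * M⌉).prod
    (Set.finite_Icc (-⌈2 * M⌉) ⌈2 * M⌉)).subset ?_
  rintro ⟨a, b⟩ hv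
  have hn : ‖TGpos (a, b)‖ ≤ M := hM _ hv
  have hre := (Complex.abs_re_le_norm _).trans hn
  have him := (Complex.abs_im_le_norm _).trans hn
  simp only [TGpos, Complex.add_re, Complex.add_im, Complex.mul_re, Complex.mul_im,
    Complex.intCast_re, Complex.intCast_im, hcos, hsin, zero_mul, sub_zero, add_zero,
    zero_add] at hre him
  have hb : |(b : ℝ)| ≤ 2 * M := by
    rw [abs_mul, abs_of_nonneg (by positivity : (0 : ℝ) ≤ √3 / 2)] at him
    nlinarith [abs_nonneg (b : ℝ)]
  have ha : |(a : ℝ)| ≤ 2 * M := by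
    rw [abs_le] at hre hb ⊢
    constructor <;> linarith
  rw [abs_le] at ha hb
  have hc := Int.le_ceil (2 * M)
  simp only [Set.mem_prod, Set.mem_Icc]
  refine ⟨⟨?_, ?_⟩, ⟨?_, ?_⟩⟩ <;>
  · rify
    linarith

/-! ## The discrete Gaussian free field on a finite graph -/

section DGFF

variable {V : Type*} [Fintype V]

open Classical in
/-- `‖∇h‖²`, the sum of `(h v - h u)²` over the undirected edges `{u, v}` of `G`
(the double sum below meets every edge twice). -/
def gradNormSq (G : SimpleGraph V) (h : V → ℝ) : ℝ :=
  (1 / 2) * ∑ v, ∑ u, if G.Adj v u then (h v - h u) ^ 2 else 0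

open Classical in
/-- The function on `V` that equals `b` on the boundary set `B` and `g` off `B`. -/
def glueBoundary (B : Set V) (b : B → ℝ) (g : (Bᶜ : Set V) → ℝ) (v : V) : ℝ :=
  if hv : v ∈ B then b ⟨v, hv⟩ else g ⟨v, hv⟩

open Classical in
/-- The measure on functions `h : V → ℝ` that agree with `b` on `B`, with density
`exp (-‖∇h‖² / 2)` with respect to Lebesgue measure on `ℝ^{V ∖ B}`. -/
def dgffUnnormalized (G : SimpleGraph V) (B : Set V) (b : B → ℝ) : Measure (V → ℝ) :=
  Measure.map (glueBoundary B b)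
    ((volume : Measure ((Bᶜ : Set V) → ℝ)).withDensity fun g =>
      ENNReal.ofReal (Real.exp (-(gradNormSq G (glueBoundary B b g) / 2))))

/-- The law of the DGFF on the finite graph `G` with boundary values `b` on `B`: the probability
measure with density proportional to `exp (-‖∇h‖² / 2)`. -/
def dgff (G : SimpleGraph V) (B : Set V) (b : B → ℝ) : Measure (V → ℝ) :=
  (dgffUnnormalized G B b Set.univ)⁻¹ • dgffUnnormalized G B b

end DGFF

/-! ## A DGFF conditioned on signs -/

/-- The data `(D, h_∂, V_+, V_-)` of a DGFF with sign constraints. -/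
structure SignedSystem where
  /-- the domain -/
  D : Set ℂ
  isTGRegion : IsTGRegion D
  /-- the boundary values, a function on the vertices in `∂D` -/
  bval : {v : TGVertex | TGpos v ∈ frontier D} → ℝ
  /-- the vertices at which the field is conditioned to be positive -/
  Vplus : Set TGVertex
  /-- the vertices at which the field is conditioned to be negative -/
  Vminus : Set TGVertex
  plus_subset : ∀ v ∈ Vplus, TGpos v ∈ D
  minus_subset : ∀ v ∈ Vminus, TGpos v ∈ D
  plus_nonempty : Vplus.Nonempty
  minus_nonempty : Vminus.Nonempty
  disjoint : Disjoint Vplus Vminus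
  plus_neighbor : ∀ v ∈ Vplus, ∃ w, TG.Adj v w ∧ (w ∈ Vminus ∨ TGpos w ∈ frontier D)
  minus_neighbor : ∀ v ∈ Vminus, ∃ w, TG.Adj v w ∧ (w ∈ Vplus ∨ TGpos w ∈ frontier D)

namespace SignedSystem

variable (S : SignedSystem)

/-- `V_∂`, the vertices of `TG` in `∂D`. -/
def Vbdry : Set TGVertex := {v | TGpos v ∈ frontier S.D}

/-- `V`, the vertices of `TG` in the closure of `D`. -/
def V : Set TGVertex := {v | TGpos v ∈ closure S.D}

/-- `U = V_∂ ∪ V_+ ∪ V_-`. -/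
def U : Set TGVertex := S.Vbdry ∪ S.Vplus ∪ S.Vminus

instance : Fintype S.V :=
  (TGvertices_finite S.isTGRegion.isBounded).fintype

/-- The boundary vertices, as a subset of the vertex set `V` of the finite graph. -/
def bdry : Set S.V := {v | (v : TGVertex) ∈ S.Vbdry}

/-- The law of the DGFF in `D` with boundary values `h_∂`: the DGFF on the subgraph of `TG`
induced by `V`. -/
def freeLaw : Measure (S.V → ℝ) :=
  dgff (TG.induce S.V) S.bdry fun v => S.bval ⟨((v : S.V) : TGVertex), v.2⟩

/-- The event that `h > 0` on `V_+` and `h < 0` on `V_-`. -/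
def signEvent : Set (S.V → ℝ) :=
  {h | (∀ v : S.V, (v : TGVertex) ∈ S.Vplus → 0 < h v) ∧
    ∀ v : S.V, (v : TGVertex) ∈ S.Vminus → h v < 0}

/-- The law of the DGFF in `D` with boundary values `h_∂`, conditioned on the sign event. -/
def condLaw : Measure (S.V → ℝ) := ProbabilityTheory.cond S.freeLaw S.signEvent

/-- `‖h_∂‖_∞ ≤ L`. -/
def BoundaryBoundedBy (L : ℝ) : Prop := ∀ v, |S.bval v| ≤ L

/-- The two systems are the same within `B`: they have the same domain, boundary values and
sign constraints there. -/
structure AgreeOn (S T : SignedSystem) (B : Set ℂ) : Prop where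
  domain : S.D ∩ B = T.D ∩ B
  bval : ∀ (v : TGVertex) (hS : v ∈ S.Vbdry) (hT : v ∈ T.Vbdry), TGpos v ∈ B →
    S.bval ⟨v, hS⟩ = T.bval ⟨v, hT⟩
  plus : ∀ v : TGVertex, TGpos v ∈ B → (v ∈ S.Vplus ↔ v ∈ T.Vplus)
  minus : ∀ v : TGVertex, TGpos v ∈ B → (v ∈ S.Vminus ↔ v ∈ T.Vminus)

end SignedSystem

/-- `P` is a coupling of the probability measures `μ` and `ν`. -/
structure IsCouplingOf {α β : Type*} [MeasurableSpace α] [MeasurableSpace β]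
    (P : Measure (α × β)) (μ : Measure α) (ν : Measure β) : Prop where
  isProbabilityMeasure : IsProbabilityMeasure P
  map_fst : P.map Prod.fst = μ
  map_snd : P.map Prod.snd = ν

end

/-! ## Geometry of the triangular grid -/

/-! Fix a coupling and let `D v` be the expected distance of the two fields at `v` (`fieldDist`).
Given its neighbors, with mean `m`, the field at an inner vertex is a Gaussian of mean `m` and
variance `1/6`, restricted to the line or to a half-line. If both fields are redrawn at `v` from the
same uniform variable through their quantile functions, the expected distance at `v` becomes exactly
`|m - m'| - |gap m - gap m'|`, where the monotone function `gap m` is `m` minus the mean of the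
restricted Gaussian (`integral_abs_siteQuantile_sub`). A coupling that nearly minimizes the sum of
`D` over a large ball cannot be improved in this way. Hence `D` plus the expected gap distance is at
most the average of `D` over the neighbors, up to a small error (`exists_nearly_optimal_coupling`):
`D` is almost subharmonic.

Such a function need not be small, but in two dimensions slow growth forces it to be almost harmonic
near the origin. The second moments of the conditioned field are bounded on the boundary and at the
signed vertices (`integral_pinned_sq_le`). Elsewhere they exceed that bound by at most a multiple of
the effective resistance to the vertex `0` of `U`, which is logarithmic
(`sub_sq_le_log_mul_TGenergy`). So `D` is of order at most `√(log N)` in the ball of radius `N`. The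
negative part of the Laplacian of a logarithmic cutoff has total mass of order `1 / log N`.
Summation by parts against this cutoff (`logCutoff_mul_TGlap_le`) therefore bounds the Laplacian of
`D` near the origin by a multiple of `1 / √(log N)` (`exists_coupling_TGlap_le`).

At the origin there are two cases. A boundary vertex has `D 0 = 0`. At a signed vertex the gap is
strictly increasing, so an almost vanishing Laplacian leaves only a small expected gap distance.
With the second moment bound, this makes the distance of the neighbor means, and hence `D 0`, small
(`exists_fieldDist_le_of_mem_U`). A Harnack chain carries the smallness from the origin to the whole
window (`le_pow_mul_of_TGlap_le`). -/

theorem TGpos_re (v : TGVertex) : (TGpos v).re = v.1 + v.2 / 2 := by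
  have hcos : (Complex.exp ((Real.pi : ℂ) * Complex.I / 3)).re = 1 / 2 := by
    have : (Real.pi : ℂ) * Complex.I / 3 = ((Real.pi / 3 : ℝ) : ℂ) * Complex.I := by
      push_cast; ring
    rw [this, Complex.exp_ofReal_mul_I_re, Real.cos_pi_div_three]
  simp only [TGpos, Complex.add_re, Complex.mul_re, Complex.intCast_re, Complex.intCast_im, hcos]
  ring

theorem TGpos_im (v : TGVertex) : (TGpos v).im = v.2 * (√3 / 2) := by
  have hsin : (Complex.exp ((Real.pi : ℂ) * Complex.I / 3)).im = √3 / 2 := by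
    have : (Real.pi : ℂ) * Complex.I / 3 = ((Real.pi / 3 : ℝ) : ℂ) * Complex.I := by
      push_cast; ring
    rw [this, Complex.exp_ofReal_mul_I_im, Real.sin_pi_div_three]
  simp only [TGpos, Complex.add_im, Complex.mul_im, Complex.intCast_re, Complex.intCast_im, hsin]
  ring

/-- The squared distance of a grid vertex from the origin. -/
def TGnormSq (v : TGVertex) : ℤ := v.1 ^ 2 + v.1 * v.2 + v.2 ^ 2

theorem norm_TGpos_sq (v : TGVertex) : ‖TGpos v‖ ^ 2 = TGnormSq v := by
  rw [← Complex.normSq_eq_norm_sq, Complex.normSq_apply, TGpos_re, TGpos_im, TGnormSq]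
  have h3 : √3 * √3 = (3 : ℝ) := Real.mul_self_sqrt (by norm_num)
  push_cast
  linear_combination ((v.2 : ℝ) ^ 2 / 4) * h3

theorem TGpos_sub (v w : TGVertex) : TGpos v - TGpos w = TGpos (v - w) := by
  simp only [TGpos, Prod.fst_sub, Prod.snd_sub]; push_cast; ring

theorem TGpos_add (v w : TGVertex) : TGpos (v + w) = TGpos v + TGpos w := by
  simp only [TGpos, Prod.fst_add, Prod.snd_add]; push_cast; ring

theorem TGnormSq_nonneg (v : TGVertex) : 0 ≤ TGnormSq v := by
  unfold TGnormSq; nlinarith [sq_nonneg (v.1 + v.2), sq_nonneg v.1, sq_nonneg v.2]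

/-- The six unit vectors of the triangular grid. -/
def TGdirs : Finset TGVertex := {(1, 0), (-1, 0), (0, 1), (0, -1), (1, -1), (-1, 1)}

theorem mem_TGdirs_iff (d : TGVertex) : d ∈ TGdirs ↔ TGnormSq d = 1 := by
  constructor
  · revert d; decide
  · rcases d with ⟨a, b⟩
    intro h
    simp only [TGnormSq] at h
    -- Four times the form is `3a² + (a + 2b)²`, so `3a² ≤ 4`; the same holds for `b`.
    have ha : a ≤ 1 := by nlinarith [sq_nonneg (a + 2 * b)]
    have ha' : -1 ≤ a := by nlinarith [sq_nonneg (a + 2 * b)]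
    have hb : b ≤ 1 := by nlinarith [sq_nonneg (b + 2 * a)]
    have hb' : -1 ≤ b := by nlinarith [sq_nonneg (b + 2 * a)]
    interval_cases a <;> interval_cases b <;> simp_all [TGdirs]

theorem TG_adj_iff (v w : TGVertex) : TG.Adj v w ↔ w - v ∈ TGdirs := by
  rw [mem_TGdirs_iff]
  change ‖TGpos v - TGpos w‖ = 1 ↔ _
  rw [norm_sub_rev, TGpos_sub]
  have h := norm_TGpos_sq (w - v)
  constructor
  · intro h1
    rw [h1] at h
    exact_mod_cast (by linarith : ((TGnormSq (w - v) : ℤ) : ℝ) = 1)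
  · intro h1
    rw [h1] at h
    have : (‖TGpos (w - v)‖ - 1) * (‖TGpos (w - v)‖ + 1) = 0 := by
      push_cast at h; linear_combination h
    rcases mul_eq_zero.1 this with h2 | h2
    · linarith
    · linarith [norm_nonneg (TGpos (w - v))]

theorem TG_adj_add (v : TGVertex) {d : TGVertex} (hd : d ∈ TGdirs) : TG.Adj v (v + d) := by
  rw [TG_adj_iff]; simpa using hd

theorem one_le_TGnormSq {v : TGVertex} (hv : v ≠ 0) : 1 ≤ TGnormSq v := by
  rcases v with ⟨a, b⟩
  rcases (TGnormSq_nonneg (a, b)).lt_or_eq with h | h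
  · exact h
  · exfalso; apply hv
    simp only [TGnormSq] at h
    have hb : b = 0 := by
      have : b ^ 2 ≤ 0 := by nlinarith [sq_nonneg (b + 2 * a)]
      exact pow_eq_zero_iff (two_ne_zero) |>.1 (le_antisymm this (sq_nonneg b))
    have ha : a = 0 := by
      subst hb
      exact pow_eq_zero_iff (two_ne_zero) |>.1 (by linarith)
    simp [ha, hb]

theorem one_le_dist_TGpos {v w : TGVertex} (h : v ≠ w) : 1 ≤ dist (TGpos v) (TGpos w) := by
  rw [dist_eq_norm, TGpos_sub]
  have h1 := one_le_TGnormSq (sub_ne_zero.2 h)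
  have h2 := norm_TGpos_sq (v - w)
  have h3 : (1 : ℝ) ≤ TGnormSq (v - w) := by exact_mod_cast h1
  nlinarith [norm_nonneg (TGpos (v - w))]

theorem TGpos_zero : TGpos 0 = 0 := by simp [TGpos]

/-- The norm of a vertex in real lattice coordinates determines the coordinates. -/
theorem TG_coord_eq {a b a' b' : ℝ}
    (h : (a : ℂ) + b * Complex.exp ((Real.pi : ℂ) * Complex.I / 3) =
      a' + b' * Complex.exp ((Real.pi : ℂ) * Complex.I / 3)) : a = a' ∧ b = b' := by
  have hre : (Complex.exp ((Real.pi : ℂ) * Complex.I / 3)).re = 1 / 2 := by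
    simpa [TGpos] using TGpos_re (0, 1)
  have him : (Complex.exp ((Real.pi : ℂ) * Complex.I / 3)).im = √3 / 2 := by
    simpa [TGpos] using TGpos_im (0, 1)
  have h1 := congrArg Complex.re h
  have h2 := congrArg Complex.im h
  simp only [Complex.add_re, Complex.add_im, Complex.mul_re, Complex.mul_im, Complex.ofReal_re,
    Complex.ofReal_im, hre, him, zero_mul, sub_zero, zero_add, add_zero] at h1 h2
  have hs : √3 / 2 ≠ 0 := by positivity
  have hb : b = b' := mul_right_cancel₀ hs h2
  exact ⟨by rw [hb] at h1; linarith, hb⟩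

theorem int_eq_of_abs_sub_lt {m n : ℤ} {x : ℝ} (h : (m : ℝ) - n = x) (h1 : -1 < x) (h2 : x < 1) :
    m = n := by
  have a1 : (-1 : ℝ) < ((m - n : ℤ) : ℝ) := by push_cast; linarith
  have a2 : ((m - n : ℤ) : ℝ) < 1 := by push_cast; linarith
  have b1 : -1 < m - n := by exact_mod_cast a1
  have b2 : m - n < 1 := by exact_mod_cast a2
  omega

/-- Two edges of the grid that share an interior point of the first have the same endpoints. -/
theorem TG_edge_cross {v d x e : TGVertex} (hd : d ∈ TGdirs) (he : e ∈ TGdirs) {s t : ℝ}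
    (ht0 : 0 < t) (ht1 : t < 1) (hs0 : 0 ≤ s) (hs1 : s ≤ 1)
    (h1 : (v.1 : ℝ) + t * d.1 = x.1 + s * e.1) (h2 : (v.2 : ℝ) + t * d.2 = x.2 + s * e.2) :
    v = x ∨ v = x + e := by
  -- Two grid directions have determinant `±1` or are parallel. In the first case the cross product
  -- with `e` would make `t` an integer strictly between `0` and `1`. In the second the coordinates
  -- of the difference of endpoints are integers in `(-1, 1)`.
  have hdet : ((v.1 - x.1) * e.2 - (v.2 - x.2) * e.1 : ℝ) = t * (d.2 * e.1 - d.1 * e.2) := by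
    linear_combination (e.2 : ℝ) * h1 - (e.1 : ℝ) * h2
  have hcases : ∀ d ∈ TGdirs, ∀ e ∈ TGdirs, d.2 * e.1 - d.1 * e.2 = 1 ∨
      d.2 * e.1 - d.1 * e.2 = -1 ∨ e = d ∨ e = -d := by decide
  have hint : ∀ k : ℤ, (k : ℝ) ≠ t := by
    intro k hk
    rw [← hk] at ht0 ht1
    have h0 : 0 < k := by exact_mod_cast ht0
    have h1 : k < 1 := by exact_mod_cast ht1
    omega
  rcases hcases d hd e he with h | h | h | h
  · have h' : (d.2 * e.1 - d.1 * e.2 : ℝ) = 1 := by exact_mod_cast h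
    exact absurd (by push_cast; rw [hdet, h', mul_one])
      (hint ((v.1 - x.1) * e.2 - (v.2 - x.2) * e.1))
  · have h' : (d.2 * e.1 - d.1 * e.2 : ℝ) = -1 := by exact_mod_cast h
    exact absurd (by push_cast; rw [hdet, h']; ring)
      (hint (-((v.1 - x.1) * e.2 - (v.2 - x.2) * e.1)))
  · left
    subst h
    have key : ∀ d ∈ TGdirs, (d.1 = 0 ∨ d.1 = 1 ∨ d.1 = -1) ∧ (d.2 = 0 ∨ d.2 = 1 ∨ d.2 = -1) := by
      decide
    obtain ⟨k1, k2⟩ := key e hd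
    refine Prod.ext (int_eq_of_abs_sub_lt (x := (s - t) * e.1) (by linarith) ?_ ?_)
      (int_eq_of_abs_sub_lt (x := (s - t) * e.2) (by linarith) ?_ ?_)
    · rcases k1 with k | k | k <;> rw [k] <;> push_cast <;> linarith
    · rcases k1 with k | k | k <;> rw [k] <;> push_cast <;> linarith
    · rcases k2 with k | k | k <;> rw [k] <;> push_cast <;> linarith
    · rcases k2 with k | k | k <;> rw [k] <;> push_cast <;> linarith
  · right
    subst h
    have key : ∀ d ∈ TGdirs, (d.1 = 0 ∨ d.1 = 1 ∨ d.1 = -1) ∧ (d.2 = 0 ∨ d.2 = 1 ∨ d.2 = -1) := by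
      decide
    obtain ⟨k1, k2⟩ := key d hd
    simp only [Prod.fst_neg, Prod.snd_neg, Int.cast_neg] at h1 h2
    refine Prod.ext (int_eq_of_abs_sub_lt (x := (1 - s - t) * d.1) ?_ ?_ ?_)
      (int_eq_of_abs_sub_lt (x := (1 - s - t) * d.2) ?_ ?_ ?_)
    · simp only [Prod.fst_add, Prod.fst_neg]; push_cast; linarith
    · rcases k1 with k | k | k <;> rw [k] <;> push_cast <;> linarith
    · rcases k1 with k | k | k <;> rw [k] <;> push_cast <;> linarith
    · simp only [Prod.snd_add, Prod.snd_neg]; push_cast; linarith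
    · rcases k2 with k | k | k <;> rw [k] <;> push_cast <;> linarith
    · rcases k2 with k | k | k <;> rw [k] <;> push_cast <;> linarith

/-- A full neighborhood is needed, not just membership: agreement of the domains on the hexagons
must transfer to their closures and boundaries at the vertex. -/
theorem mem_hexBall_nhds {v : TGVertex} {R : ℝ} (hv : ‖TGpos v‖ < R) :
    hexBall R ∈ nhds (TGpos v) := by
  have hsub : Metric.ball (TGpos v) (1 / 2) ⊆ TGhexagon v := by
    intro z hz w
    rw [Metric.mem_ball] at hz
    by_cases h : v = w
    · rw [h]
    · have h1 := one_le_dist_TGpos h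
      have h2 := dist_triangle_left (TGpos v) (TGpos w) z
      linarith
  refine Filter.mem_of_superset (Metric.ball_mem_nhds _ (by norm_num : (0 : ℝ) < 1 / 2)) ?_
  intro z hz
  refine ⟨v, ⟨TGpos v, hsub (Metric.mem_ball_self (by norm_num)), ?_⟩, hsub hz⟩
  simpa using hv

theorem norm_TGpos_lt_of_mem_hexBall {v : TGVertex} {r : ℝ} (hv : TGpos v ∈ hexBall r) :
    ‖TGpos v‖ < 2 * r := by
  obtain ⟨w, ⟨z, hz, hzr⟩, hw⟩ := hv
  have hvw : v = w := by
    by_contra h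
    have h1 := one_le_dist_TGpos h
    have h2 := hw v
    rw [dist_self] at h2
    linarith
  subst hvw
  -- A point of the hexagon of `v` is no farther from `v` than from the origin, so `‖v‖` is at most
  -- twice its norm.
  have h1 := hz 0
  rw [TGpos_zero, dist_zero_right] at h1
  rw [Metric.mem_ball, dist_zero_right] at hzr
  rw [dist_comm, dist_eq_norm] at h1
  have := norm_add_le (TGpos v - z) z
  rw [sub_add_cancel] at this
  linarith

/-- A boundary point in the open edge from `v` would lie on a boundary edge ending at `v`, or be a
vertex, and neither is possible for `v` in the open domain. Consequently every inner vertex has all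
six neighbors in the finite graph, which makes the conditional law at a site uniform over the grid.
-/
theorem IsTGRegion.neighbor_mem_closure {D : Set ℂ} (hD : IsTGRegion D) {v d : TGVertex}
    (hv : TGpos v ∈ D) (hd : d ∈ TGdirs) : TGpos (v + d) ∈ closure D := by
  obtain ⟨H, hH⟩ := hD.frontier_eq
  set γ : ℝ → ℂ := fun t => TGpos v + t * TGpos d with hγ
  have hcont : Continuous γ := by fun_prop
  have hvf : TGpos v ∉ frontier D := fun h => by
    rw [hD.isOpen.frontier_eq] at h; exact h.2 hv
  have hfr : ∀ t ∈ Set.Ico (0 : ℝ) 1, γ t ∉ frontier D := by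
    rintro t ⟨ht0, ht1⟩ hmem
    rcases ht0.eq_or_lt with rfl | ht0
    · exact hvf (by simpa [hγ] using hmem)
    rw [hH] at hmem hvf
    have hγc : γ t = ((v.1 + t * d.1 : ℝ) : ℂ) +
        ((v.2 + t * d.2 : ℝ) : ℂ) * Complex.exp ((Real.pi : ℂ) * Complex.I / 3) := by
      simp only [hγ, TGpos]; push_cast; ring
    rcases hmem with ⟨x, hx, hxe⟩ | ⟨x, y, hxy, hz⟩
    · have hxe' : ((x.1 : ℝ) : ℂ) + ((x.2 : ℝ) : ℂ) *
          Complex.exp ((Real.pi : ℂ) * Complex.I / 3) = γ t := by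
        rw [← hxe, TGpos]; push_cast; rfl
      obtain ⟨h1, h2⟩ := TG_coord_eq (hxe'.trans hγc)
      rcases TG_edge_cross (v := v) (x := x) hd hd ht0 ht1 le_rfl zero_le_one
        (by linarith) (by linarith) with h | h
      · exact hvf (Or.inl ⟨x, hx, by rw [h]⟩)
      · have hint : ∀ k : ℤ, (k : ℝ) ≠ t := by
          intro k hk
          rw [← hk] at ht0 ht1
          have h0 : 0 < k := by exact_mod_cast ht0
          have h1 : k < 1 := by exact_mod_cast ht1
          omega
        rw [h] at h1 h2
        simp only [Prod.fst_add, Prod.snd_add] at h1 h2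
        push_cast at h1 h2
        have key : ∀ d ∈ TGdirs, d.1 = 1 ∨ d.1 = -1 ∨ d.2 = 1 ∨ d.2 = -1 := by decide
        rcases key d hd with k | k | k | k <;> simp only [k] at h1 h2 <;> push_cast at h1 h2 <;>
          linarith
    · have hadj : y - x ∈ TGdirs := (TG_adj_iff x y).1 (H.adj_sub hxy)
      have hvseg : v = x ∨ v = y := by
        rw [segment_eq_image'] at hz
        obtain ⟨s, ⟨hs0, hs1⟩, hs⟩ := hz
        have hs' : (((x.1 : ℝ) + s * ((y - x).1 : ℤ) : ℝ) : ℂ) +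
            (((x.2 : ℝ) + s * ((y - x).2 : ℤ) : ℝ) : ℂ) *
            Complex.exp ((Real.pi : ℂ) * Complex.I / 3) = γ t := by
          rw [← hs]; simp only [TGpos_sub, Complex.real_smul]
          simp only [TGpos, Prod.fst_sub, Prod.snd_sub]; push_cast; ring
        obtain ⟨h1, h2⟩ := TG_coord_eq (hs'.trans hγc)
        have := TG_edge_cross hd hadj ht0 ht1 hs0 hs1 h1.symm h2.symm
        simpa using this
      apply hvf
      refine Or.inr ⟨x, y, hxy, ?_⟩
      rcases hvseg with rfl | rfl
      · exact left_mem_segment _ _ _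
      · exact right_mem_segment _ _ _
  -- The half-open edge is connected, starts in `D` and avoids the boundary, so it stays in `D`.
  have hpre : IsPreconnected (γ '' Set.Ico 0 1) := isPreconnected_Ico.image _ hcont.continuousOn
  have hsub : γ '' Set.Ico 0 1 ⊆ D := by
    by_contra hnot
    obtain ⟨z, hz, hzD⟩ := Set.not_subset.1 hnot
    have hcl : ∀ p ∈ γ '' Set.Ico 0 1, p ∈ D ∨ p ∈ (closure D)ᶜ := by
      rintro p ⟨t, ht, rfl⟩
      by_contra! h
      exact hfr t ht (by
        rw [hD.isOpen.frontier_eq]; exact ⟨not_not.1 h.2, h.1⟩)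
    obtain ⟨p, -, hp⟩ := hpre D (closure D)ᶜ hD.isOpen isClosed_closure.isOpen_compl
      (fun p hp => hcl p hp) ⟨TGpos v, ⟨0, by simp, by simp [hγ]⟩, hv⟩
      ⟨z, hz, (hcl z hz).resolve_left hzD⟩
    exact hp.2 (subset_closure hp.1)
  have h1 : TGpos (v + d) = γ 1 := by simp [hγ, TGpos_add]
  rw [h1]
  have h2 : (1 : ℝ) ∈ closure (Set.Ico (0 : ℝ) 1) := by
    rw [closure_Ico zero_ne_one]; simp
  exact closure_mono hsub (image_closure_subset_closure_image hcont ⟨1, h2, rfl⟩)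

/-! ## Quantile functions -/

/-- The uniform law on the unit interval. -/
noncomputable def unifLaw : Measure ℝ := volume.restrict (Set.Ioo 0 1)

instance : IsProbabilityMeasure unifLaw :=
  ⟨by simp [unifLaw]⟩

open Classical in
/-- The quantile function of a law on the line. -/
noncomputable def quantile (ν : Measure ℝ) (u : ℝ) : ℝ :=
  if u ∈ Set.Ioo (0 : ℝ) 1 then sInf {x | u ≤ cdf ν x} else 0

theorem quantile_le_iff (ν : Measure ℝ) {u : ℝ} (hu : u ∈ Set.Ioo (0 : ℝ) 1) (x : ℝ) :
    quantile ν u ≤ x ↔ u ≤ cdf ν x := by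
  have hbdd : BddBelow {x | u ≤ cdf ν x} := by
    obtain ⟨a, ha⟩ := ((tendsto_cdf_atBot ν).eventually_lt_const hu.1).exists
    refine ⟨a, fun y hy => ?_⟩
    by_contra! h
    exact absurd (hy.trans (monotone_cdf ν h.le)) (not_le.2 ha)
  have hne : {x | u ≤ cdf ν x}.Nonempty := by
    obtain ⟨a, ha⟩ := ((tendsto_cdf_atTop ν).eventually_const_lt hu.2).exists
    exact ⟨a, ha.le⟩
  rw [quantile, if_pos hu]
  constructor
  · intro h
    refine le_trans ?_ (monotone_cdf ν h)
    set a := sInf {x | u ≤ cdf ν x}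
    have ht : Filter.Tendsto (cdf ν) (nhdsWithin a (Set.Ioi a)) (nhds (cdf ν a)) :=
      ((cdf ν).right_continuous a).mono_left (nhdsWithin_mono _ Set.Ioi_subset_Ici_self)
    refine ge_of_tendsto ht ?_
    filter_upwards [self_mem_nhdsWithin] with y hy
    obtain ⟨z, hz, hzy⟩ := exists_lt_of_csInf_lt hne hy
    exact le_trans hz (monotone_cdf ν hzy.le)
  · intro h
    exact csInf_le hbdd h

theorem quantile_mono_of_cdf_le {ν ν' : Measure ℝ} (h : ∀ x, cdf ν' x ≤ cdf ν x) (u : ℝ) :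
    quantile ν u ≤ quantile ν' u := by
  by_cases hu : u ∈ Set.Ioo (0 : ℝ) 1
  · rw [quantile_le_iff ν hu]
    exact ((quantile_le_iff ν' hu _).1 le_rfl).trans (h _)
  · simp [quantile, hu]

/-- Joint measurability is required because resampling feeds a random parameter, the mean of the
neighbors, into the quantile function. -/
theorem measurable_quantile_family {α : Type*} [MeasurableSpace α] {ν : α → Measure ℝ}
    (h : ∀ x, Measurable fun a => cdf (ν a) x) :
    Measurable fun p : α × ℝ => quantile (ν p.1) p.2 := by
  have hS : MeasurableSet {p : α × ℝ | p.2 ∈ Set.Ioo (0 : ℝ) 1} := measurable_snd measurableSet_Ioo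
  refine measurable_of_Iic fun x => ?_
  have : (fun p : α × ℝ => quantile (ν p.1) p.2) ⁻¹' Set.Iic x =
      ({p : α × ℝ | p.2 ∈ Set.Ioo (0 : ℝ) 1} ∩ {p | p.2 ≤ cdf (ν p.1) x}) ∪
      ({p : α × ℝ | p.2 ∈ Set.Ioo (0 : ℝ) 1}ᶜ ∩ {_p | 0 ≤ x}) := by
    ext p
    by_cases hp : p.2 ∈ Set.Ioo (0 : ℝ) 1
    · have := quantile_le_iff (ν p.1) hp x
      simp only [Set.mem_preimage, Set.mem_Iic, this, Set.mem_union, Set.mem_inter_iff,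
        Set.mem_ofPred_eq, hp, true_and, Set.mem_compl_iff, not_true, false_and, or_false]
    · simp only [Set.mem_preimage, Set.mem_Iic, quantile, hp, if_false, Set.mem_union,
        Set.mem_inter_iff, Set.mem_ofPred_eq, false_and, Set.mem_compl_iff, not_false_iff,
        true_and, false_or]
  rw [this]
  refine (hS.inter (measurableSet_le measurable_snd ((h x).comp measurable_fst))).union
    (hS.compl.inter (MeasurableSet.const _))

theorem measurable_quantile (ν : Measure ℝ) : Measurable (quantile ν) :=
  (measurable_quantile_family (α := Unit) (ν := fun _ => ν) fun _ => measurable_const).comp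
    (measurable_const (a := ()) |>.prodMk measurable_id)

theorem map_quantile (ν : Measure ℝ) [IsProbabilityMeasure ν] :
    unifLaw.map (quantile ν) = ν := by
  have := Measure.isProbabilityMeasure_map (μ := unifLaw) (measurable_quantile ν).aemeasurable
  refine Measure.ext_of_Iic _ _ fun x => ?_
  rw [Measure.map_apply (measurable_quantile ν) measurableSet_Iic, ← ofReal_cdf ν x, unifLaw,
    Measure.restrict_apply (measurable_quantile ν measurableSet_Iic)]
  have h1 : quantile ν ⁻¹' Set.Iic x ∩ Set.Ioo 0 1 = Set.Iic (cdf ν x) ∩ Set.Ioo 0 1 := by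
    ext u
    refine and_congr_left fun hu => ?_
    exact quantile_le_iff ν hu x
  rw [h1]
  have h0 := cdf_nonneg ν x
  have h1 := cdf_le_one ν x
  rcases h1.eq_or_lt with h1 | h1
  · rw [h1, Set.inter_eq_right.2 (fun u hu => hu.2.le)]; simp
  · have : Set.Iic (cdf ν x) ∩ Set.Ioo 0 1 = Set.Ioc 0 (cdf ν x) := by
      ext u; simp only [Set.mem_inter_iff, Set.mem_Iic, Set.mem_Ioo, Set.mem_Ioc]
      constructor
      · rintro ⟨a, b, c⟩; exact ⟨b, a⟩
      · rintro ⟨a, b⟩; exact ⟨b, a, by linarith⟩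
    rw [this, Real.volume_Ioc, sub_zero]

/-! ## The law of a Gaussian site given its neighbors -/

/-- The density, up to a constant, of a centered Gaussian of variance `1/6` shifted by `m`. -/
noncomputable def siteWeight (m t : ℝ) : ℝ := Real.exp (-(3 * t ^ 2) + 6 * m * t)

theorem siteWeight_pos (m t : ℝ) : 0 < siteWeight m t := Real.exp_pos _

@[fun_prop]
theorem continuous_siteWeight : Continuous fun p : ℝ × ℝ => siteWeight p.1 p.2 := by
  unfold siteWeight; fun_prop

theorem continuous_siteWeight_right (m : ℝ) : Continuous (siteWeight m) := by
  unfold siteWeight; fun_prop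

theorem integrable_sq_mul_siteWeight (m : ℝ) : Integrable fun t => t ^ 2 * siteWeight m t := by
  -- The bound `t² ≤ exp (t²)` leaves the exponent `-2t² + 6mt = 9m²/2 - 2(t - 3m/2)²`.
  have h := ((integrable_exp_neg_mul_sq (b := 2) (by norm_num)).comp_sub_right
    (3 * m / 2)).const_mul (Real.exp (9 * m ^ 2 / 2))
  refine h.mono' (by
    have := continuous_siteWeight_right m
    exact (by fun_prop : Continuous fun t => t ^ 2 * siteWeight m t).aestronglyMeasurable) ?_
  filter_upwards with t
  rw [Real.norm_of_nonneg (mul_nonneg (sq_nonneg t) (siteWeight_pos m t).le), ← Real.exp_add]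
  calc t ^ 2 * siteWeight m t ≤ Real.exp (t ^ 2) * siteWeight m t := by
        gcongr
        · exact (siteWeight_pos m t).le
        · linarith [Real.add_one_le_exp (t ^ 2)]
    _ = _ := by
        rw [siteWeight, ← Real.exp_add]; congr 1; ring

theorem integrable_siteWeight (m : ℝ) : Integrable (siteWeight m) := by
  have h := ((integrable_exp_neg_mul_sq (b := 3) (by norm_num)).comp_sub_right m).const_mul
    (Real.exp (3 * m ^ 2))
  convert h using 2 with t
  rw [siteWeight, ← Real.exp_add]; congr 1; ring

theorem integrable_id_mul_siteWeight (m : ℝ) : Integrable fun t => t * siteWeight m t := by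
  refine ((integrable_siteWeight m).add (integrable_sq_mul_siteWeight m)).mono' (by
    have := continuous_siteWeight_right m
    exact (by fun_prop : Continuous fun t => t * siteWeight m t).aestronglyMeasurable) ?_
  filter_upwards with t
  rw [norm_mul, Real.norm_of_nonneg (siteWeight_pos m t).le, Pi.add_apply]
  have h := siteWeight_pos m t
  have : |t| ≤ 1 + t ^ 2 := by rw [abs_le]; constructor <;> nlinarith
  rw [Real.norm_eq_abs]
  nlinarith

/-- The possible ranges of the field at a vertex: the line and the two half-lines. -/
def IsSiteRange (I : Set ℝ) : Prop := I = Set.univ ∨ I = Set.Ioi 0 ∨ I = Set.Iio 0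

theorem IsSiteRange.measurableSet {I : Set ℝ} (hI : IsSiteRange I) : MeasurableSet I := by
  rcases hI with rfl | rfl | rfl
  · exact MeasurableSet.univ
  · exact measurableSet_Ioi
  · exact measurableSet_Iio

theorem IsSiteRange.volume_ne_zero {I : Set ℝ} (hI : IsSiteRange I) : volume I ≠ 0 := by
  rcases hI with rfl | rfl | rfl <;> simp

/-- The total mass of the weight on `I`. -/
noncomputable def sitePart (I : Set ℝ) (m : ℝ) : ℝ := ∫ t in I, siteWeight m t

theorem setIntegral_siteWeight_nonneg (I : Set ℝ) (m : ℝ) : 0 ≤ ∫ t in I, siteWeight m t :=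
  integral_nonneg fun t => (siteWeight_pos m t).le

theorem sitePart_pos {I : Set ℝ} (hI : IsSiteRange I) (m : ℝ) : 0 < sitePart I m := by
  rw [sitePart, setIntegral_pos_iff_support_of_nonneg_ae]
  · have : Function.support (siteWeight m) = Set.univ := by
      ext t; simp [(siteWeight_pos m t).ne']
    rw [this, Set.univ_inter]
    exact pos_iff_ne_zero.2 hI.volume_ne_zero
  · filter_upwards with t using (siteWeight_pos m t).le
  · exact (integrable_siteWeight m).integrableOn

/-- The law of the field at a vertex with range `I`, when the mean of the neighbors is `m`. -/
noncomputable def siteLaw (I : Set ℝ) (m : ℝ) : Measure ℝ :=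
  (volume.restrict I).withDensity fun t => ENNReal.ofReal (siteWeight m t / sitePart I m)

theorem measurable_siteDensity (I : Set ℝ) (m : ℝ) :
    Measurable fun t => ENNReal.ofReal (siteWeight m t / sitePart I m) :=
  ((continuous_siteWeight_right m).measurable.div_const _).ennreal_ofReal

theorem siteLaw_apply {I : Set ℝ} (hI : IsSiteRange I) (m : ℝ) {A : Set ℝ}
    (hA : MeasurableSet A) :
    siteLaw I m A = ENNReal.ofReal ((∫ t in A ∩ I, siteWeight m t) / sitePart I m) := by
  rw [siteLaw, withDensity_apply _ hA, Measure.restrict_restrict hA,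
    ← ofReal_integral_eq_lintegral_ofReal, integral_div]
  · exact ((integrable_siteWeight m).div_const _).integrableOn
  · filter_upwards with t using div_nonneg (siteWeight_pos m t).le (sitePart_pos hI m).le

theorem isProbabilityMeasure_siteLaw {I : Set ℝ} (hI : IsSiteRange I) (m : ℝ) :
    IsProbabilityMeasure (siteLaw I m) :=
  ⟨by rw [siteLaw_apply hI m MeasurableSet.univ, Set.univ_inter, ← sitePart,
    div_self (sitePart_pos hI m).ne', ENNReal.ofReal_one]⟩

theorem integral_siteLaw {I : Set ℝ} (hI : IsSiteRange I) (m : ℝ) (g : ℝ → ℝ) :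
    ∫ t, g t ∂siteLaw I m = (∫ t in I, g t * siteWeight m t) / sitePart I m := by
  rw [siteLaw, integral_withDensity_eq_integral_toReal_smul (measurable_siteDensity I m)
    (by filter_upwards with t using ENNReal.ofReal_lt_top), ← integral_div]
  refine integral_congr_ae ?_
  filter_upwards with t
  rw [ENNReal.toReal_ofReal (div_nonneg (siteWeight_pos m t).le (sitePart_pos hI m).le),
    smul_eq_mul]
  ring

theorem integrable_siteLaw {I : Set ℝ} (hI : IsSiteRange I) (m : ℝ) {g : ℝ → ℝ}
    (hg : Integrable fun t => g t * siteWeight m t) : Integrable g (siteLaw I m) := by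
  rw [siteLaw, integrable_withDensity_iff_integrable_smul' (measurable_siteDensity I m)
    (by filter_upwards with t using ENNReal.ofReal_lt_top)]
  refine ((hg.div_const (sitePart I m)).integrableOn (s := I)).congr ?_
  filter_upwards with t
  rw [ENNReal.toReal_ofReal (div_nonneg (siteWeight_pos m t).le (sitePart_pos hI m).le),
    smul_eq_mul]
  ring

theorem cdf_siteLaw {I : Set ℝ} (hI : IsSiteRange I) (m x : ℝ) :
    cdf (siteLaw I m) x = (∫ t in Set.Iic x ∩ I, siteWeight m t) / sitePart I m := by
  have := isProbabilityMeasure_siteLaw hI m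
  rw [cdf_eq_real, measureReal_def, siteLaw_apply hI m measurableSet_Iic, ENNReal.toReal_ofReal]
  exact div_nonneg (setIntegral_siteWeight_nonneg _ _) (sitePart_pos hI m).le

theorem measurable_setIntegral_siteWeight (A : Set ℝ) :
    Measurable fun m => ∫ t in A, siteWeight m t :=
  (continuous_siteWeight.stronglyMeasurable.integral_prod_right'
    (ν := volume.restrict A)).measurable

/-- Monotone likelihood ratio: the quotient of the weights for `m'` and `m` is `exp (6 (m' - m) t)`,
increasing in `t`. Comparing it with its value at `x` on both sides of `x` gives stochastic
monotonicity in the mean, on any range. -/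
theorem cdf_siteLaw_antitone {I : Set ℝ} (hI : IsSiteRange I) {m m' : ℝ} (h : m ≤ m') (x : ℝ) :
    cdf (siteLaw I m') x ≤ cdf (siteLaw I m) x := by
  rw [cdf_siteLaw hI, cdf_siteLaw hI, div_le_div_iff₀ (sitePart_pos hI _) (sitePart_pos hI _)]
  have hsplit : ∀ m, sitePart I m =
      (∫ t in Set.Iic x ∩ I, siteWeight m t) + ∫ t in Set.Ioi x ∩ I, siteWeight m t := by
    intro m
    have := integral_inter_add_sdiff (s := I) (t := Set.Iic x) (μ := volume) measurableSet_Iic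
      (integrable_siteWeight m).integrableOn
    rw [sitePart, ← this, Set.inter_comm I, Set.sdiff_eq, Set.compl_Iic, Set.inter_comm I]
  rw [hsplit m, hsplit m']
  set c := Real.exp (6 * (m' - m) * x)
  have hw : ∀ t, siteWeight m' t = Real.exp (6 * (m' - m) * t) * siteWeight m t := by
    intro t; rw [siteWeight, siteWeight, ← Real.exp_add]; congr 1; ring
  have h1 : ∫ t in Set.Iic x ∩ I, siteWeight m' t ≤ c * ∫ t in Set.Iic x ∩ I, siteWeight m t := by
    rw [← integral_const_mul]
    refine setIntegral_mono_on (integrable_siteWeight _).integrableOn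
      ((integrable_siteWeight _).const_mul _).integrableOn
      (measurableSet_Iic.inter hI.measurableSet) fun t ht => ?_
    rw [hw]
    refine mul_le_mul_of_nonneg_right (Real.exp_le_exp.2 ?_) (siteWeight_pos m t).le
    have : t ≤ x := ht.1
    nlinarith
  have h2 : c * ∫ t in Set.Ioi x ∩ I, siteWeight m t ≤ ∫ t in Set.Ioi x ∩ I, siteWeight m' t := by
    rw [← integral_const_mul]
    refine setIntegral_mono_on ((integrable_siteWeight _).const_mul _).integrableOn
      (integrable_siteWeight _).integrableOn
      (measurableSet_Ioi.inter hI.measurableSet) fun t ht => ?_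
    rw [hw]
    refine mul_le_mul_of_nonneg_right (Real.exp_le_exp.2 ?_) (siteWeight_pos m t).le
    have : x < t := ht.1
    nlinarith
  have a1 := setIntegral_siteWeight_nonneg (Set.Iic x ∩ I) m
  have a2 := setIntegral_siteWeight_nonneg (Set.Ioi x ∩ I) m
  have k1 := mul_le_mul_of_nonneg_right h1 a2
  have k2 := mul_le_mul_of_nonneg_right h2 a1
  linarith

/-- The quantile function of the law at a site. -/
noncomputable def siteQuantile (I : Set ℝ) (m u : ℝ) : ℝ := quantile (siteLaw I m) u

theorem measurable_siteQuantile {I : Set ℝ} (hI : IsSiteRange I) :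
    Measurable fun p : ℝ × ℝ => siteQuantile I p.1 p.2 := by
  refine measurable_quantile_family fun x => ?_
  simp_rw [cdf_siteLaw hI]
  exact (measurable_setIntegral_siteWeight _).div (measurable_setIntegral_siteWeight _)

theorem measurable_siteQuantile_right (I : Set ℝ) (m : ℝ) : Measurable (siteQuantile I m) :=
  measurable_quantile _

theorem map_siteQuantile {I : Set ℝ} (hI : IsSiteRange I) (m : ℝ) :
    unifLaw.map (siteQuantile I m) = siteLaw I m := by
  have := isProbabilityMeasure_siteLaw hI m
  exact map_quantile _

theorem siteQuantile_mono {I : Set ℝ} (hI : IsSiteRange I) (u : ℝ) :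
    Monotone fun m => siteQuantile I m u :=
  fun _ _ h => quantile_mono_of_cdf_le (cdf_siteLaw_antitone hI h) u

theorem integral_siteQuantile {I : Set ℝ} (hI : IsSiteRange I) (m : ℝ) {g : ℝ → ℝ}
    (hg : Measurable g) :
    ∫ u, g (siteQuantile I m u) ∂unifLaw = (∫ t in I, g t * siteWeight m t) / sitePart I m := by
  rw [← integral_siteLaw hI, ← map_siteQuantile hI,
    integral_map (measurable_siteQuantile_right I m).aemeasurable hg.aestronglyMeasurable]

theorem integrable_siteQuantile {I : Set ℝ} (hI : IsSiteRange I) (m : ℝ) :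
    Integrable (siteQuantile I m) unifLaw := by
  have h := integrable_siteLaw hI m (g := fun t => t) (integrable_id_mul_siteWeight m)
  rw [← map_siteQuantile hI, integrable_map_measure measurable_id'.aestronglyMeasurable
    (measurable_siteQuantile_right I m).aemeasurable] at h
  exact h

/-- The mean of the law at a site. -/
noncomputable def siteMean (I : Set ℝ) (m : ℝ) : ℝ := ∫ u, siteQuantile I m u ∂unifLaw

/-! ### Moments of the law at a site and its gap to the mean of the neighbors -/

theorem hasDerivAt_siteWeight (m t : ℝ) :
    HasDerivAt (siteWeight m) (6 * m * siteWeight m t - 6 * (t * siteWeight m t)) t := by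
  have h : HasDerivAt (fun t : ℝ => -(3 * t ^ 2) + 6 * m * t) (-(3 * (2 * t)) + 6 * m) t := by
    have h1 := ((hasDerivAt_pow 2 t).const_mul 3).neg.add ((hasDerivAt_id t).const_mul (6 * m))
    refine h1.congr_deriv ?_
    norm_num
  refine h.exp.congr_deriv ?_
  simp only [siteWeight]; ring

/-- The value of the weight at the end of the range, with the sign of the outer normal. -/
noncomputable def siteFlux (I : Set ℝ) : ℝ :=
  open Classical in if I = Set.Ioi 0 then 1 else if I = Set.Iio 0 then -1 else 0

theorem Iio_ne_Ioi_zero : (Set.Iio (0 : ℝ)) ≠ Set.Ioi 0 := fun h => by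
  have : (1 : ℝ) ∈ Set.Iio (0 : ℝ) := h ▸ (by simp : (1 : ℝ) ∈ Set.Ioi (0 : ℝ))
  norm_num at this

@[simp] theorem siteFlux_univ : siteFlux Set.univ = 0 := by
  have h1 : (Set.univ : Set ℝ) ≠ Set.Ioi 0 := fun h => by
    have : (0 : ℝ) ∈ Set.Ioi (0 : ℝ) := h ▸ Set.mem_univ _
    simp at this
  have h2 : (Set.univ : Set ℝ) ≠ Set.Iio 0 := fun h => by
    have : (0 : ℝ) ∈ Set.Iio (0 : ℝ) := h ▸ Set.mem_univ _
    simp at this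
  rw [siteFlux, if_neg h1, if_neg h2]

@[simp] theorem siteFlux_Ioi : siteFlux (Set.Ioi 0) = 1 := by simp [siteFlux]

@[simp] theorem siteFlux_Iio : siteFlux (Set.Iio 0) = -1 := by
  rw [siteFlux, if_neg Iio_ne_Ioi_zero, if_pos rfl]

/-- An integrable function with integrable derivative vanishes at infinity, so only the endpoint `0`
of a half-line contributes. -/
theorem setIntegral_deriv {I : Set ℝ} (hI : IsSiteRange I) {f f' : ℝ → ℝ}
    (hd : ∀ t, HasDerivAt f (f' t) t) (hf' : Integrable f') (hf : Integrable f) :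
    ∫ t in I, f' t = - siteFlux I * f 0 := by
  rcases hI with rfl | rfl | rfl
  · simp [integral_eq_zero_of_hasDerivAt_of_integrable hd hf' hf]
  · rw [integral_Ioi_of_hasDerivAt_of_tendsto' (fun t _ => hd t) hf'.integrableOn
      (tendsto_zero_of_hasDerivAt_of_integrableOn_Ioi (a := 0) (fun t _ => hd t) hf'.integrableOn
        hf.integrableOn)]
    simp
  · rw [← integral_Iic_eq_integral_Iio, integral_Iic_of_hasDerivAt_of_tendsto' (fun t _ => hd t)
      hf'.integrableOn
      (tendsto_zero_of_hasDerivAt_of_integrableOn_Iic (a := 0) (fun t _ => hd t) hf'.integrableOn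
        hf.integrableOn)]
    simp

theorem siteWeight_zero (m : ℝ) : siteWeight m 0 = 1 := by simp [siteWeight]

theorem siteMean_eq {I : Set ℝ} (hI : IsSiteRange I) (m : ℝ) :
    siteMean I m = m + siteFlux I / (6 * sitePart I m) := by
  have h := setIntegral_deriv hI (hasDerivAt_siteWeight m)
    (((integrable_siteWeight m).const_mul (6 * m)).sub
      ((integrable_id_mul_siteWeight m).const_mul 6)) (integrable_siteWeight m)
  rw [integral_sub ((integrable_siteWeight m).const_mul (6 * m)).integrableOn
    ((integrable_id_mul_siteWeight m).const_mul 6).integrableOn, integral_const_mul,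
    integral_const_mul, siteWeight_zero, ← sitePart] at h
  have hZ := (sitePart_pos hI m).ne'
  rw [siteMean, integral_siteQuantile hI m (g := fun t => t) measurable_id]
  field_simp
  linarith

/-- Integrating the derivative of `t * siteWeight m t` produces no boundary term, because this
function vanishes at `0`. The identity therefore has the same form for the line and for both
half-lines. -/
theorem integral_siteQuantile_sq {I : Set ℝ} (hI : IsSiteRange I) (m : ℝ) :
    ∫ u, siteQuantile I m u ^ 2 ∂unifLaw = m * siteMean I m + 1 / 6 := by
  have hd : ∀ t, HasDerivAt (fun t => t * siteWeight m t)
      (siteWeight m t + (6 * m * (t * siteWeight m t) - 6 * (t ^ 2 * siteWeight m t))) t := by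
    intro t
    refine ((hasDerivAt_id' t).mul (hasDerivAt_siteWeight m t)).congr_deriv ?_
    ring
  have i1 := integrable_siteWeight m
  have i2 := (integrable_id_mul_siteWeight m).const_mul (6 * m)
  have i3 := (integrable_sq_mul_siteWeight m).const_mul 6
  have h := setIntegral_deriv hI hd (i1.add (i2.sub i3)) (integrable_id_mul_siteWeight m)
  have e := integral_add i1.integrableOn (i2.sub i3).integrableOn (μ := volume.restrict I)
  simp only [Pi.sub_apply] at e
  rw [e,
    integral_sub i2.integrableOn i3.integrableOn, integral_const_mul,
    integral_const_mul, ← sitePart] at h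
  have hZ := (sitePart_pos hI m).ne'
  rw [siteMean, integral_siteQuantile hI m (g := fun t => t) measurable_id,
    integral_siteQuantile hI m (g := fun t => t ^ 2) (measurable_id.pow_const 2)]
  field_simp
  linarith

/-- How much closer the site is to its range than to the mean of the neighbors. -/
noncomputable def siteGap (I : Set ℝ) (m : ℝ) : ℝ := m - siteMean I m

theorem siteGap_eq {I : Set ℝ} (hI : IsSiteRange I) (m : ℝ) :
    siteGap I m = - siteFlux I / (6 * sitePart I m) := by
  rw [siteGap, siteMean_eq hI]; ring

/-- The mass is convex in `m`, and this is its tangent line, from `1 + x ≤ exp x`. The positive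
slope makes the monotonicity of the mass quantitative. -/
theorem sitePart_Ioi_add_le (m m' : ℝ) :
    sitePart (Set.Ioi 0) m + (m' - m) * (6 * ∫ t in Set.Ioi 0, t * siteWeight m t) ≤
      sitePart (Set.Ioi 0) m' := by
  rw [← integral_const_mul, ← integral_const_mul, sitePart, sitePart, ← integral_add
    (integrable_siteWeight m).integrableOn
    (((integrable_id_mul_siteWeight m).const_mul 6).const_mul _).integrableOn]
  refine setIntegral_mono_on ((integrable_siteWeight m).add
    (((integrable_id_mul_siteWeight m).const_mul 6).const_mul _)).integrableOn
    (integrable_siteWeight m').integrableOn measurableSet_Ioi fun t ht => ?_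
  have hw : siteWeight m' t = Real.exp (6 * (m' - m) * t) * siteWeight m t := by
    rw [siteWeight, siteWeight, ← Real.exp_add]; congr 1; ring
  rw [hw]
  have h1 := Real.add_one_le_exp (6 * (m' - m) * t)
  have h2 := siteWeight_pos m t
  nlinarith

theorem setIntegral_id_mul_siteWeight_pos (m : ℝ) : 0 < ∫ t in Set.Ioi 0, t * siteWeight m t := by
  rw [setIntegral_pos_iff_support_of_nonneg_ae]
  · have : Function.support (fun t => t * siteWeight m t) = {0}ᶜ := by
      ext t; simp [(siteWeight_pos m t).ne']
    rw [this, Set.inter_eq_right.2 (show Set.Ioi (0 : ℝ) ⊆ {0}ᶜ from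
      fun t (ht : 0 < t) => by simpa using ht.ne')]
    simp
  · filter_upwards [ae_restrict_mem measurableSet_Ioi] with t ht
    exact mul_nonneg (le_of_lt ht) (siteWeight_pos m t).le
  · exact (integrable_id_mul_siteWeight m).integrableOn

theorem sitePart_Ioi_mono : Monotone (sitePart (Set.Ioi 0)) := fun m m' h => by
  have h1 := sitePart_Ioi_add_le m m'
  have h2 := setIntegral_id_mul_siteWeight_pos m
  have := mul_nonneg (sub_nonneg.2 h) (mul_nonneg (by norm_num : (0 : ℝ) ≤ 6) h2.le)
  linarith

theorem sitePart_Iio (m : ℝ) : sitePart (Set.Iio 0) m = sitePart (Set.Ioi 0) (-m) := by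
  have h := integral_comp_neg_Ioi 0 (siteWeight m)
  rw [neg_zero, integral_Iic_eq_integral_Iio] at h
  rw [sitePart, ← h, sitePart]
  refine integral_congr_ae ?_
  filter_upwards with t
  simp only [siteWeight]; congr 1; ring

theorem siteGap_Iio (m : ℝ) : siteGap (Set.Iio 0) m = - siteGap (Set.Ioi 0) (-m) := by
  rw [siteGap_eq (Or.inr (Or.inr rfl)), siteGap_eq (Or.inr (Or.inl rfl)), sitePart_Iio]
  simp; ring

theorem siteGap_Ioi (m : ℝ) : siteGap (Set.Ioi 0) m = -(6 * sitePart (Set.Ioi 0) m)⁻¹ := by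
  rw [siteGap_eq (Or.inr (Or.inl rfl)), siteFlux_Ioi, neg_div, one_div]

theorem siteGap_univ (m : ℝ) : siteGap Set.univ m = 0 := by
  rw [siteGap_eq (Or.inl rfl)]; simp

/-- As the mean at the site is `m` minus the gap, this says that resampling does not expand
differences of the neighbor means. -/
theorem siteGap_mono {I : Set ℝ} (hI : IsSiteRange I) : Monotone (siteGap I) := by
  have hp : Monotone (siteGap (Set.Ioi 0)) := fun m m' h => by
    rw [siteGap_Ioi, siteGap_Ioi]
    have h1 := sitePart_pos (I := Set.Ioi 0) (Or.inr (Or.inl rfl)) m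
    have h2 := sitePart_Ioi_mono h
    gcongr
  rcases hI with rfl | rfl | rfl
  · intro _ _ _; rw [siteGap_univ, siteGap_univ]
  · exact hp
  · intro m m' h
    rw [siteGap_Iio, siteGap_Iio]
    exact neg_le_neg (hp (neg_le_neg h))

/-- On a half-line resampling contracts strictly, uniformly over bounded means. The positive
half-line has gap `-1 / (6 p)`, with `p` the mass; on `[-A, A]` the mass has slope at least `a` and
value at most `Z`, whence the constant `a / (6 Z²)`. Reflection gives the other half-line. -/
theorem exists_siteGap_lower (A : ℝ) : ∃ c > 0, ∀ I : Set ℝ, (I = Set.Ioi 0 ∨ I = Set.Iio 0) →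
    ∀ x ∈ Set.Icc (-A) A, ∀ y ∈ Set.Icc (-A) A, c * |x - y| ≤ |siteGap I x - siteGap I y| := by
  set a := 6 * ∫ t in Set.Ioi 0, t * siteWeight (-A) t
  have ha : 0 < a := mul_pos (by norm_num) (setIntegral_id_mul_siteWeight_pos _)
  set Z := sitePart (Set.Ioi 0) A
  have hZ : 0 < Z := sitePart_pos (Or.inr (Or.inl rfl)) A
  have hlt : ∀ x ∈ Set.Icc (-A) A, ∀ y ∈ Set.Icc (-A) A, x ≤ y →
      a / (6 * Z ^ 2) * (y - x) ≤ siteGap (Set.Ioi 0) y - siteGap (Set.Ioi 0) x := by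
    intro x hx y hy hxy
    rw [siteGap_Ioi, siteGap_Ioi]
    have h1 := sitePart_Ioi_add_le x y
    have hmono : ∫ t in Set.Ioi 0, t * siteWeight (-A) t ≤ ∫ t in Set.Ioi 0, t * siteWeight x t := by
      refine setIntegral_mono_on (integrable_id_mul_siteWeight _).integrableOn
        (integrable_id_mul_siteWeight _).integrableOn measurableSet_Ioi fun t ht => ?_
      have ht' : 0 < t := ht
      have : siteWeight (-A) t ≤ siteWeight x t := by
        refine Real.exp_le_exp.2 ?_
        nlinarith [hx.1]
      gcongr
    have hpx := sitePart_pos (I := Set.Ioi 0) (Or.inr (Or.inl rfl)) x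
    have hpy := sitePart_pos (I := Set.Ioi 0) (Or.inr (Or.inl rfl)) y
    have hxZ : sitePart (Set.Ioi 0) x ≤ Z := sitePart_Ioi_mono hx.2
    have hyZ : sitePart (Set.Ioi 0) y ≤ Z := sitePart_Ioi_mono hy.2
    set p := sitePart (Set.Ioi 0) x
    set q := sitePart (Set.Ioi 0) y
    have hd : a * (y - x) ≤ q - p := by
      have : a ≤ 6 * ∫ t in Set.Ioi 0, t * siteWeight x t := by
        simp only [a]; linarith
      nlinarith [mul_le_mul_of_nonneg_left this (sub_nonneg.2 hxy)]
    have e : -(6 * q)⁻¹ - -(6 * p)⁻¹ = (q - p) / (6 * (p * q)) := by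
      field_simp; ring
    rw [e, div_mul_eq_mul_div]
    have hpq : p * q ≤ Z ^ 2 := by rw [sq]; exact mul_le_mul hxZ hyZ hpy.le hZ.le
    have h0 : 0 ≤ a * (y - x) := mul_nonneg ha.le (sub_nonneg.2 hxy)
    calc a * (y - x) / (6 * Z ^ 2) ≤ (q - p) / (6 * Z ^ 2) := by gcongr
      _ ≤ _ := by
        apply div_le_div_of_nonneg_left (h0.trans hd) (by positivity) (by linarith)
  have habs : ∀ x ∈ Set.Icc (-A) A, ∀ y ∈ Set.Icc (-A) A,
      a / (6 * Z ^ 2) * |x - y| ≤ |siteGap (Set.Ioi 0) x - siteGap (Set.Ioi 0) y| := by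
    intro x hx y hy
    rcases le_total x y with h | h
    · rw [abs_sub_comm x y, abs_of_nonneg (sub_nonneg.2 h), abs_sub_comm]
      exact (hlt x hx y hy h).trans (le_abs_self _)
    · rw [abs_of_nonneg (sub_nonneg.2 h)]
      exact (hlt y hy x hx h).trans (le_abs_self _)
  refine ⟨a / (6 * Z ^ 2), by positivity, ?_⟩
  rintro I (rfl | rfl) x hx y hy
  · exact habs x hx y hy
  · have := habs (-x) ⟨by linarith [hx.2], by linarith [hx.1]⟩ (-y)
      ⟨by linarith [hy.2], by linarith [hy.1]⟩
    rw [siteGap_Iio, siteGap_Iio]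
    rw [neg_sub_neg, abs_sub_comm] at this
    rwa [neg_sub_neg, abs_sub_comm (siteGap _ (-y))]

/-- With a common uniform variable the difference of the two quantiles has constant sign, so the
mean of its absolute value is the absolute difference of the means. The gap term is the exact gain
of one resampling. -/
theorem integral_abs_siteQuantile_sub {I : Set ℝ} (hI : IsSiteRange I) (m m' : ℝ) :
    ∫ u, |siteQuantile I m u - siteQuantile I m' u| ∂unifLaw =
      |m - m'| - |siteGap I m - siteGap I m'| := by
  wlog h : m ≤ m' generalizing m m'
  · rw [abs_sub_comm m, abs_sub_comm (siteGap I m), ← this m' m (le_of_not_ge h)]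
    simp_rw [abs_sub_comm]
  have h1 : ∀ u, |siteQuantile I m u - siteQuantile I m' u| =
      siteQuantile I m' u - siteQuantile I m u := fun u => by
    rw [abs_sub_comm, abs_of_nonneg (sub_nonneg.2 (siteQuantile_mono hI u h))]
  simp_rw [h1]
  rw [integral_sub (integrable_siteQuantile hI _) (integrable_siteQuantile hI _),
    abs_sub_comm, abs_of_nonneg (sub_nonneg.2 h), abs_sub_comm,
    abs_of_nonneg (sub_nonneg.2 (siteGap_mono hI h))]
  simp only [siteGap, siteMean]; ring

/-- A constant bounding the overshoot of a half-line Gaussian site over its mean. -/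
noncomputable def siteOvershoot : ℝ := (6 * sitePart (Set.Ioi 0) 0)⁻¹

/-- For `m ≥ 0` the mean exceeds `m` by the negative of the gap, which is largest at `m = 0`. For `m
≤ 0` the product is nonpositive, since the law lives on the positive half-line. -/
theorem mul_siteMean_Ioi_le (m : ℝ) :
    m * siteMean (Set.Ioi 0) m ≤ (max m 0) ^ 2 + siteOvershoot * max m 0 := by
  have hI : IsSiteRange (Set.Ioi 0) := Or.inr (Or.inl rfl)
  have hgap := siteGap_Ioi m
  rw [siteGap] at hgap
  have hp := inv_pos.2 (mul_pos (by norm_num : (0 : ℝ) < 6) (sitePart_pos hI m))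
  rcases le_total 0 m with h | h
  · rw [max_eq_left h]
    have h1 : (6 * sitePart (Set.Ioi 0) m)⁻¹ ≤ siteOvershoot := by
      have := sitePart_pos hI 0
      have := sitePart_Ioi_mono h
      unfold siteOvershoot
      gcongr
    nlinarith
  · rw [max_eq_right h]
    have h1 : 0 ≤ siteMean (Set.Ioi 0) m := by
      rw [siteMean, integral_siteQuantile hI m (g := fun t => t) measurable_id]
      exact div_nonneg (setIntegral_id_mul_siteWeight_pos m).le (sitePart_pos hI m).le
    nlinarith

theorem siteMean_Iio (m : ℝ) : siteMean (Set.Iio 0) m = - siteMean (Set.Ioi 0) (-m) := by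
  have := siteGap_Iio m
  simp only [siteGap] at this
  linarith

/-! ## Potential theory on the triangular grid -/

/-- The graph Laplacian of the triangular grid. -/
noncomputable def TGlap (φ : TGVertex → ℝ) (x : TGVertex) : ℝ := ∑ d ∈ TGdirs, (φ (x + d) - φ x)

theorem TGdirs_card : TGdirs.card = 6 := by decide

theorem neg_mem_TGdirs {d : TGVertex} (hd : d ∈ TGdirs) : -d ∈ TGdirs := by
  revert d; decide

theorem TGlap_eq (φ : TGVertex → ℝ) (x : TGVertex) :
    TGlap φ x = ∑ d ∈ TGdirs, φ (x + d) - 6 * φ x := by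
  rw [TGlap, Finset.sum_sub_distrib, Finset.sum_const, TGdirs_card]; simp

/-! ### Minimum principle, Dirichlet problem and harmonic measure -/

theorem nonneg_of_TGlap_nonpos (W : Finset TGVertex) (φ : TGVertex → ℝ) (h0 : ∀ x ∉ W, 0 ≤ φ x)
    (h : ∀ x ∈ W, TGlap φ x ≤ 0) (x : TGVertex) : 0 ≤ φ x := by
  by_contra! hx
  have hxW : x ∈ W := by by_contra hW; exact absurd (h0 x hW) (not_le.2 hx)
  obtain ⟨y, hyW, hy⟩ := W.exists_min_image φ ⟨x, hxW⟩
  have hyneg : φ y < 0 := (hy x hxW).trans_lt hx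
  have hymin : ∀ z, φ y ≤ φ z := fun z => by
    by_cases hz : z ∈ W
    · exact hy z hz
    · exact hyneg.le.trans (h0 z hz)
  -- Of all minimizers, take one with largest first coordinate. Its right neighbor is again a
  -- minimizer, a contradiction; no connectedness of `W` is needed.
  obtain ⟨z, hz, hzmax⟩ := (W.filter fun z => φ z = φ y).exists_max_image (fun z => z.1)
    ⟨y, by simp [hyW]⟩
  rw [Finset.mem_filter] at hz
  have hs : ∑ d ∈ TGdirs, (φ (z + d) - φ z) = 0 :=
    le_antisymm (h z hz.1) (Finset.sum_nonneg fun d _ => by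
      rw [hz.2]; exact sub_nonneg.2 (hymin _))
  have h1 := (Finset.sum_eq_zero_iff_of_nonneg (fun d _ => by
      rw [hz.2]; exact sub_nonneg.2 (hymin _))).1 hs (1, 0) (by decide)
  have h2 : φ (z + (1, 0)) = φ y := by rw [← hz.2]; linarith
  have h3 : z + (1, 0) ∈ W := by
    by_contra hW
    have := h0 _ hW
    rw [h2] at this
    linarith
  have := hzmax (z + (1, 0)) (by rw [Finset.mem_filter]; exact ⟨h3, h2⟩)
  simp at this

theorem TGlap_neg (φ : TGVertex → ℝ) (x : TGVertex) : TGlap (fun y => -φ y) x = -TGlap φ x := by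
  simp only [TGlap, ← Finset.sum_neg_distrib]
  exact Finset.sum_congr rfl fun d _ => by ring

theorem TGlap_add (φ ψ : TGVertex → ℝ) (x : TGVertex) :
    TGlap (fun y => φ y + ψ y) x = TGlap φ x + TGlap ψ x := by
  simp only [TGlap, ← Finset.sum_add_distrib]
  exact Finset.sum_congr rfl fun d _ => by ring

theorem TGlap_sub (φ ψ : TGVertex → ℝ) (x : TGVertex) :
    TGlap (fun y => φ y - ψ y) x = TGlap φ x - TGlap ψ x := by
  simp only [TGlap, ← Finset.sum_sub_distrib]
  exact Finset.sum_congr rfl fun d _ => by ring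

theorem TGlap_mul_const (φ : TGVertex → ℝ) (c : ℝ) (x : TGVertex) :
    TGlap (fun y => φ y * c) x = TGlap φ x * c := by
  simp only [TGlap, Finset.sum_mul]
  exact Finset.sum_congr rfl fun d _ => by ring

theorem TGlap_sum {ι : Type*} (s : Finset ι) (φ : ι → TGVertex → ℝ) (x : TGVertex) :
    TGlap (fun y => ∑ i ∈ s, φ i y) x = ∑ i ∈ s, TGlap (φ i) x := by
  simp only [TGlap, ← Finset.sum_sub_distrib]
  exact Finset.sum_comm

theorem eq_zero_of_TGlap_eq_zero (W : Finset TGVertex) (φ : TGVertex → ℝ) (h0 : ∀ x ∉ W, φ x = 0)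
    (h : ∀ x ∈ W, TGlap φ x = 0) (x : TGVertex) : φ x = 0 :=
  le_antisymm
    (by
      have := nonneg_of_TGlap_nonpos W (fun y => -φ y) (fun y hy => by simp [h0 y hy])
        (fun y hy => by rw [TGlap_neg, h y hy, neg_zero]) x
      linarith)
    (nonneg_of_TGlap_nonpos W φ (fun y hy => (h0 y hy).ge) (fun y hy => (h y hy).le) x)

/-- The Laplacian on functions supported in the finite set `W` is injective by the minimum
principle, hence surjective; a correction supported in `W` makes the extension of `g` harmonic
there. -/
theorem exists_dirichlet_solution (W : Finset TGVertex) (g : TGVertex → ℝ) :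
    ∃ φ : TGVertex → ℝ, (∀ x ∉ W, φ x = g x) ∧ ∀ x ∈ W, TGlap φ x = 0 := by
  classical
  let ext : (W → ℝ) → TGVertex → ℝ := fun ψ y => if h : y ∈ W then ψ ⟨y, h⟩ else 0
  let T : (W → ℝ) →ₗ[ℝ] (W → ℝ) :=
    { toFun := fun ψ x => TGlap (ext ψ) x
      map_add' := by
        intro a b
        funext x
        rw [Pi.add_apply, ← TGlap_add]
        congr 1
        funext y
        by_cases h : y ∈ W <;> simp [ext, h]
      map_smul' := by
        intro c a
        funext x
        rw [Pi.smul_apply, RingHom.id_apply, smul_eq_mul, mul_comm, ← TGlap_mul_const]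
        congr 1
        funext y
        by_cases h : y ∈ W <;> simp [ext, h, mul_comm] }
  have hT : Function.Injective T := by
    rw [injective_iff_map_eq_zero]
    intro ψ hψ
    funext x
    have := eq_zero_of_TGlap_eq_zero W (ext ψ) (fun y hy => by simp [ext, hy])
      (fun y hy => congrFun hψ ⟨y, hy⟩) x
    simpa [ext] using this
  obtain ⟨ψ, hψ⟩ := (LinearMap.injective_iff_surjective.1 hT)
    (fun x => -TGlap (fun y => if y ∈ W then 0 else g y) x)
  refine ⟨fun y => ext ψ y + if y ∈ W then 0 else g y, fun x hx => by simp [ext, hx],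
    fun x hx => ?_⟩
  rw [TGlap_add]
  have := congrFun hψ ⟨x, hx⟩
  change TGlap (ext ψ) x = _ at this
  rw [this]
  ring

open Classical in
/-- The harmonic measure of `u`, seen from the complement of which the walk is stopped on
leaving `W`. -/
noncomputable def harmonicKernel (W : Finset TGVertex) (x u : TGVertex) : ℝ :=
  (exists_dirichlet_solution W fun y => if y = u then 1 else 0).choose x

theorem harmonicKernel_of_notMem {W : Finset TGVertex} {x : TGVertex} (hx : x ∉ W)
    (u : TGVertex) : harmonicKernel W x u = if x = u then 1 else 0 := by
  classical
  rw [harmonicKernel, (exists_dirichlet_solution W _).choose_spec.1 x hx]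

theorem TGlap_harmonicKernel {W : Finset TGVertex} {x : TGVertex} (hx : x ∈ W) (u : TGVertex) :
    TGlap (fun y => harmonicKernel W y u) x = 0 :=
  (exists_dirichlet_solution W _).choose_spec.2 x hx

theorem harmonicKernel_nonneg (W : Finset TGVertex) (x u : TGVertex) :
    0 ≤ harmonicKernel W x u := by
  refine nonneg_of_TGlap_nonpos W (fun y => harmonicKernel W y u) (fun y hy => ?_)
    (fun y hy => (TGlap_harmonicKernel hy u).le) x
  rw [harmonicKernel_of_notMem hy]
  split_ifs <;> norm_num

theorem sum_harmonicKernel_le_one (W F : Finset TGVertex) (x : TGVertex) :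
    ∑ u ∈ F, harmonicKernel W x u ≤ 1 := by
  have := nonneg_of_TGlap_nonpos W (fun y => 1 - ∑ u ∈ F, harmonicKernel W y u) (fun y hy => ?_)
    (fun y hy => ?_) x
  · linarith
  · simp_rw [harmonicKernel_of_notMem hy]
    rw [Finset.sum_ite_eq]
    split_ifs <;> norm_num
  · rw [TGlap_sub, TGlap_sum, Finset.sum_eq_zero fun u _ => TGlap_harmonicKernel hy u]
    simp [TGlap]

/-! ### Summation by parts -/

theorem summable_mul_of_support {f g : TGVertex → ℝ} (hf : f.support.Finite) :
    Summable fun x => f x * g x :=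
  summable_of_hasFiniteSupport (hf.subset (Function.support_mul_subset_left _ _))

theorem TGlap_support {φ : TGVertex → ℝ} (hφ : φ.support.Finite) :
    (TGlap φ).support.Finite := by
  have : (TGlap φ).support ⊆ φ.support ∪ ⋃ d ∈ TGdirs, (fun x => x - d) '' φ.support := by
    intro x hx
    by_contra hnot
    simp only [Set.mem_union, Set.mem_iUnion, Set.mem_image, not_or, not_exists, not_and,
      Function.mem_support, not_not] at hnot
    apply hx
    refine Finset.sum_eq_zero fun d hd => ?_
    have h1 : φ (x + d) = 0 := by
      by_contra h
      exact hnot.2 d hd (x + d) h (by abel)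
    rw [h1, hnot.1, sub_zero]
  exact (hφ.union (Set.Finite.biUnion TGdirs.finite_toSet fun d _ => hφ.image _)).subset this

theorem tsum_mul_add_eq (φ ψ : TGVertex → ℝ) (d : TGVertex) :
    ∑' x, ψ x * φ (x + d) = ∑' x, φ x * ψ (x + -d) := by
  rw [← (Equiv.addRight (-d)).tsum_eq]
  refine tsum_congr fun x => ?_
  simp [mul_comm]

theorem sum_TGdirs_neg (f : TGVertex → ℝ) : ∑ d ∈ TGdirs, f (-d) = ∑ d ∈ TGdirs, f d :=
  Finset.sum_bij' (fun d _ => -d) (fun d _ => -d) (fun _ hd => neg_mem_TGdirs hd)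
    (fun _ hd => neg_mem_TGdirs hd) (by simp) (by simp) (by simp)

/-- The set of directions is symmetric, so shifting the summation index moves the Laplacian across.
Finite support of one factor suffices, which later allows testing an arbitrary function against a
cutoff. -/
theorem tsum_mul_TGlap (φ ψ : TGVertex → ℝ) (hφ : φ.support.Finite) :
    ∑' x, φ x * TGlap ψ x = ∑' x, ψ x * TGlap φ x := by
  have hs : ∀ d, Summable fun x => φ x * ψ (x + d) := fun d => summable_mul_of_support hφ
  have hs' : ∀ d, Summable fun x => ψ x * φ (x + d) := fun d => by
    have := (Equiv.addRight d).summable_iff.2 (summable_mul_of_support (g := fun x => ψ (x + -d)) hφ)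
    refine this.congr fun x => ?_
    simp [mul_comm]
  have h1 : ∀ x, φ x * TGlap ψ x = ∑ d ∈ TGdirs, φ x * ψ (x + d) - 6 * (φ x * ψ x) := fun x => by
    rw [TGlap_eq, mul_sub, Finset.mul_sum]; ring
  have h2 : ∀ x, ψ x * TGlap φ x = ∑ d ∈ TGdirs, ψ x * φ (x + d) - 6 * (φ x * ψ x) := fun x => by
    rw [TGlap_eq, mul_sub, Finset.mul_sum]; ring
  simp_rw [h1, h2]
  rw [Summable.tsum_sub (summable_sum fun d _ => hs d)
      ((summable_mul_of_support hφ).mul_left 6),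
    Summable.tsum_sub (summable_sum fun d _ => hs' d) ((summable_mul_of_support hφ).mul_left 6),
    Summable.tsum_finsetSum (fun d _ => hs d), Summable.tsum_finsetSum (fun d _ => hs' d)]
  congr 1
  simp_rw [tsum_mul_add_eq φ ψ]
  exact (sum_TGdirs_neg fun d => ∑' x, φ x * ψ (x + d)).symm

/-- The sum of the squared increments along the directed edges at a vertex. -/
noncomputable def localEnergy (φ : TGVertex → ℝ) (x : TGVertex) : ℝ :=
  ∑ d ∈ TGdirs, (φ (x + d) - φ x) ^ 2

/-- The Dirichlet energy, every edge counted twice. -/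
noncomputable def TGenergy (φ : TGVertex → ℝ) : ℝ := ∑' x, localEnergy φ x

theorem localEnergy_nonneg (φ : TGVertex → ℝ) (x : TGVertex) : 0 ≤ localEnergy φ x :=
  Finset.sum_nonneg fun _ _ => sq_nonneg _

theorem sq_le_localEnergy (φ : TGVertex → ℝ) (x : TGVertex) {d : TGVertex} (hd : d ∈ TGdirs) :
    (φ (x + d) - φ x) ^ 2 ≤ localEnergy φ x :=
  Finset.single_le_sum (f := fun d => (φ (x + d) - φ x) ^ 2) (fun _ _ => sq_nonneg _) hd

theorem TGlap_sq (φ : TGVertex → ℝ) (x : TGVertex) :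
    TGlap (fun y => φ y ^ 2) x = localEnergy φ x + 2 * (φ x * TGlap φ x) := by
  simp only [TGlap, localEnergy, Finset.mul_sum, ← Finset.sum_add_distrib]
  exact Finset.sum_congr rfl fun d _ => by ring

theorem summable_localEnergy {φ : TGVertex → ℝ} (hφ : φ.support.Finite) :
    Summable (localEnergy φ) := by
  have h2 : (fun y => φ y ^ 2).support.Finite := by
    refine hφ.subset fun x hx => ?_
    simpa using hx
  have := (summable_of_hasFiniteSupport (TGlap_support h2)).sub
    ((summable_mul_of_support (g := TGlap φ) hφ).mul_left 2)
  refine this.congr fun x => ?_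
  rw [TGlap_sq]; ring

/-- This is `TGlap_sq` summed over the grid; the Laplacian of a finitely supported function has
total sum zero. -/
theorem TGenergy_eq {φ : TGVertex → ℝ} (hφ : φ.support.Finite) :
    TGenergy φ = -2 * ∑' x, φ x * TGlap φ x := by
  have h2 : (fun y => φ y ^ 2).support.Finite := by
    refine hφ.subset fun x hx => ?_
    simpa using hx
  have hs1 : Summable (TGlap fun y => φ y ^ 2) := summable_of_hasFiniteSupport (TGlap_support h2)
  have hs2 := (summable_mul_of_support (g := TGlap φ) hφ).mul_left 2
  have h0 : ∑' x, TGlap (fun y => φ y ^ 2) x = 0 := by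
    have := tsum_mul_TGlap (fun y => φ y ^ 2) (fun _ => 1) h2
    simp only [one_mul] at this
    rw [← this]
    simp [TGlap]
  calc TGenergy φ = ∑' x, (TGlap (fun y => φ y ^ 2) x - 2 * (φ x * TGlap φ x)) := by
        rw [TGenergy]
        exact tsum_congr fun x => by rw [TGlap_sq]; ring
    _ = _ := by rw [hs1.tsum_sub hs2, h0, tsum_mul_left]; ring

theorem localEnergy_le_TGenergy {φ : TGVertex → ℝ} (hφ : φ.support.Finite) (x : TGVertex) :
    localEnergy φ x ≤ TGenergy φ :=
  (summable_localEnergy hφ).le_tsum x fun y _ => localEnergy_nonneg φ y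

/-! ### The resistance between two vertices -/

/-- The mean of `φ` over the lattice points `p + i e + j e'` with `i + j = n`. -/
noncomputable def levelMean (φ : TGVertex → ℝ) (p e e' : TGVertex) (n : ℕ) : ℝ :=
  (∑ q ∈ Finset.HasAntidiagonal.antidiagonal n, φ (p + q.1 • e + q.2 • e')) / (n + 1)

/-- Let the point `(i, j)` of level `n` send masses proportional to `i + 1` and `j + 1` to its two
successors. This carries the uniform measure of level `n` to that of level `n + 1`, with mass at
most `1 / (n + 1)` on each edge. Cauchy–Schwarz over the `n + 1` points of the level then gives the
factor `4 / (n + 1)`. -/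
theorem levelMean_sub_succ_sq_le (φ : TGVertex → ℝ) (p : TGVertex) {e e' : TGVertex}
    (he : e ∈ TGdirs) (he' : e' ∈ TGdirs) (n : ℕ) :
    (levelMean φ p e e' n - levelMean φ p e e' (n + 1)) ^ 2 ≤
      4 / (n + 1) * ∑ q ∈ Finset.HasAntidiagonal.antidiagonal n, localEnergy φ (p + q.1 • e + q.2 • e') := by
  set f : ℕ × ℕ → ℝ := fun q => φ (p + q.1 • e + q.2 • e') with hf
  have hsum : (n + 1 : ℝ) * ∑ q ∈ Finset.HasAntidiagonal.antidiagonal (n + 1), f q =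
      ∑ q ∈ Finset.HasAntidiagonal.antidiagonal n,
        ((q.1 + 1 : ℝ) * f (q.1 + 1, q.2) + (q.2 + 1 : ℝ) * f (q.1, q.2 + 1)) := by
    have h1 := Finset.Nat.sum_antidiagonal_succ (n := n) (f := fun q => (q.1 : ℝ) * f q)
    have h2 := Finset.Nat.sum_antidiagonal_succ' (n := n) (f := fun q => (q.2 : ℝ) * f q)
    simp only [Nat.cast_zero, zero_mul, zero_add, Nat.cast_add, Nat.cast_one] at h1 h2
    rw [Finset.sum_add_distrib, ← h1, ← h2, ← Finset.sum_add_distrib, Finset.mul_sum]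
    refine Finset.sum_congr rfl fun q hq => ?_
    have : (q.1 + q.2 : ℝ) = n + 1 := by exact_mod_cast Finset.HasAntidiagonal.mem_antidiagonal.1 hq
    rw [← this]; ring
  have hdiff : levelMean φ p e e' n - levelMean φ p e e' (n + 1) =
      ∑ q ∈ Finset.HasAntidiagonal.antidiagonal n, (((q.1 + 1 : ℝ) / ((n + 1) * (n + 2))) * (f q - f (q.1 + 1, q.2))
        + ((q.2 + 1 : ℝ) / ((n + 1) * (n + 2))) * (f q - f (q.1, q.2 + 1))) := by
    have h3 : ∑ q ∈ Finset.HasAntidiagonal.antidiagonal (n + 1), f q = (∑ q ∈ Finset.HasAntidiagonal.antidiagonal n,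
        ((q.1 + 1 : ℝ) * f (q.1 + 1, q.2) + (q.2 + 1 : ℝ) * f (q.1, q.2 + 1))) / (n + 1) := by
      rw [← hsum]; field_simp
    simp only [levelMean]
    change (∑ q ∈ Finset.HasAntidiagonal.antidiagonal n, f q) / _ - (∑ q ∈ Finset.HasAntidiagonal.antidiagonal (n + 1), f q) / _ = _
    rw [h3, div_div, Finset.sum_div, Finset.sum_div, ← Finset.sum_sub_distrib]
    refine Finset.sum_congr rfl fun q hq => ?_
    have : (q.1 + q.2 : ℝ) = n := by exact_mod_cast Finset.HasAntidiagonal.mem_antidiagonal.1 hq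
    push_cast
    have : (q.1 : ℝ) = n - q.2 := by linarith
    rw [this]
    field_simp
    ring
  have hterm : ∀ q ∈ Finset.HasAntidiagonal.antidiagonal n,
      (((q.1 + 1 : ℝ) / ((n + 1) * (n + 2))) * (f q - f (q.1 + 1, q.2))
        + ((q.2 + 1 : ℝ) / ((n + 1) * (n + 2))) * (f q - f (q.1, q.2 + 1))) ^ 2 ≤
      4 / (n + 1) ^ 2 * localEnergy φ (p + q.1 • e + q.2 • e') := by
    intro q hq
    have hq' : (q.1 + q.2 : ℝ) = n := by exact_mod_cast Finset.HasAntidiagonal.mem_antidiagonal.1 hq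
    have hq1 : (0 : ℝ) ≤ q.1 := Nat.cast_nonneg _
    have hq2 : (0 : ℝ) ≤ q.2 := Nat.cast_nonneg _
    have hn : (0 : ℝ) ≤ n := Nat.cast_nonneg _
    have e1 : (f q - f (q.1 + 1, q.2)) ^ 2 ≤ localEnergy φ (p + q.1 • e + q.2 • e') := by
      have := sq_le_localEnergy φ (p + q.1 • e + q.2 • e') he
      have h : p + q.1 • e + q.2 • e' + e = p + (q.1 + 1) • e + q.2 • e' := by
        rw [add_smul, one_smul]; abel
      rw [h] at this
      simp only [hf]; linarith [this]
    have e2 : (f q - f (q.1, q.2 + 1)) ^ 2 ≤ localEnergy φ (p + q.1 • e + q.2 • e') := by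
      have := sq_le_localEnergy φ (p + q.1 • e + q.2 • e') he'
      have h : p + q.1 • e + q.2 • e' + e' = p + q.1 • e + (q.2 + 1) • e' := by
        rw [add_smul, one_smul]; abel
      rw [h] at this
      simp only [hf]; linarith [this]
    have c1 : ((q.1 + 1 : ℝ) / ((n + 1) * (n + 2))) ^ 2 ≤ 1 / (n + 1) ^ 2 := by
      rw [← one_div_pow]
      refine pow_le_pow_left₀ (by positivity) ?_ 2
      rw [div_le_div_iff₀ (by positivity) (by positivity)]
      nlinarith
    have c2 : ((q.2 + 1 : ℝ) / ((n + 1) * (n + 2))) ^ 2 ≤ 1 / (n + 1) ^ 2 := by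
      rw [← one_div_pow]
      refine pow_le_pow_left₀ (by positivity) ?_ 2
      rw [div_le_div_iff₀ (by positivity) (by positivity)]
      nlinarith
    set a := (q.1 + 1 : ℝ) / ((n + 1) * (n + 2))
    set b := (q.2 + 1 : ℝ) / ((n + 1) * (n + 2))
    set x := f q - f (q.1 + 1, q.2)
    set y := f q - f (q.1, q.2 + 1)
    have k1 : a ^ 2 * x ^ 2 ≤ 1 / (n + 1) ^ 2 * localEnergy φ (p + q.1 • e + q.2 • e') :=
      mul_le_mul c1 e1 (sq_nonneg _) (by positivity)
    have k2 : b ^ 2 * y ^ 2 ≤ 1 / (n + 1) ^ 2 * localEnergy φ (p + q.1 • e + q.2 • e') :=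
      mul_le_mul c2 e2 (sq_nonneg _) (by positivity)
    have k3 : (4 : ℝ) / (n + 1) ^ 2 = 4 * (1 / (n + 1) ^ 2) := by ring
    rw [k3]
    nlinarith [sq_nonneg (a * x - b * y)]
  rw [hdiff]
  have hcs := sq_sum_le_card_mul_sum_sq (s := Finset.HasAntidiagonal.antidiagonal n) (f := fun q =>
    (((q.1 + 1 : ℝ) / ((n + 1) * (n + 2))) * (f q - f (q.1 + 1, q.2))
        + ((q.2 + 1 : ℝ) / ((n + 1) * (n + 2))) * (f q - f (q.1, q.2 + 1))))
  refine hcs.trans ?_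
  rw [Finset.Nat.card_antidiagonal]
  calc _ ≤ ((n + 1 : ℕ) : ℝ) * ∑ q ∈ Finset.HasAntidiagonal.antidiagonal n,
        4 / (n + 1 : ℝ) ^ 2 * localEnergy φ (p + q.1 • e + q.2 • e') := by
        gcongr with q hq
        exact hterm q hq
    _ = _ := by
        rw [← Finset.mul_sum, ← mul_assoc]
        congr 1
        push_cast
        field_simp

theorem levelMean_zero (φ : TGVertex → ℝ) (p e e' : TGVertex) : levelMean φ p e e' 0 = φ p := by
  simp [levelMean]

/-- Independence of `e` and `e'` makes the points of the cone distinct, so no local energy is used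
twice. -/
theorem sum_levels_le_TGenergy {φ : TGVertex → ℝ} (hφ : φ.support.Finite) (p : TGVertex)
    {e e' : TGVertex} (hdet : e.1 * e'.2 - e.2 * e'.1 ≠ 0) (n : ℕ) :
    ∑ k ∈ Finset.range n, ∑ q ∈ Finset.HasAntidiagonal.antidiagonal k, localEnergy φ (p + q.1 • e + q.2 • e') ≤
      TGenergy φ := by
  classical
  rw [Finset.sum_sigma']
  set s := (Finset.range n).sigma fun k => Finset.HasAntidiagonal.antidiagonal k
  have hinj : Set.InjOn (fun x : (Σ _ : ℕ, ℕ × ℕ) => p + x.2.1 • e + x.2.2 • e') s := by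
    rintro ⟨k, i, j⟩ hx ⟨k', i', j'⟩ hx' h
    simp only [s, Finset.coe_sigma, Set.mem_sigma_iff, Finset.mem_coe,
      Finset.HasAntidiagonal.mem_antidiagonal] at hx hx'
    have h1 := congrArg Prod.fst h
    have h2 := congrArg Prod.snd h
    simp only [Prod.fst_add, Prod.snd_add, Prod.smul_fst, Prod.smul_snd] at h1 h2
    simp only [nsmul_eq_mul] at h1 h2
    have hi : (i : ℤ) = i' := by
      have : ((i : ℤ) - i') * (e.1 * e'.2 - e.2 * e'.1) = 0 := by
        linear_combination e'.2 * h1 - e'.1 * h2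
      rcases mul_eq_zero.1 this with h | h
      · linarith
      · exact absurd h hdet
    have hj : (j : ℤ) = j' := by
      have : ((j : ℤ) - j') * (e.1 * e'.2 - e.2 * e'.1) = 0 := by
        linear_combination e.1 * h2 - e.2 * h1
      rcases mul_eq_zero.1 this with h | h
      · linarith
      · exact absurd h hdet
    have hi' : i = i' := by exact_mod_cast hi
    have hj' : j = j' := by exact_mod_cast hj
    subst hi' hj'
    have : k = k' := by rw [← hx.2, ← hx'.2]
    rw [this]
  rw [← Finset.sum_image (f := localEnergy φ) hinj]
  exact (summable_localEnergy hφ).sum_le_tsum _ fun x _ => localEnergy_nonneg φ x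

/-- Cauchy–Schwarz for the telescoping sum over levels: the cost of level `k` is of order `1 / (k +
1)`, and the harmonic sum produces the logarithm. -/
theorem sub_levelMean_sq_le {φ : TGVertex → ℝ} (hφ : φ.support.Finite) (p : TGVertex)
    {e e' : TGVertex} (he : e ∈ TGdirs) (he' : e' ∈ TGdirs)
    (hdet : e.1 * e'.2 - e.2 * e'.1 ≠ 0) (n : ℕ) :
    (φ p - levelMean φ p e e' n) ^ 2 ≤ 4 * (1 + Real.log n) * TGenergy φ := by
  have htel : φ p - levelMean φ p e e' n =
      ∑ k ∈ Finset.range n, (levelMean φ p e e' k - levelMean φ p e e' (k + 1)) := by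
    rw [Finset.sum_range_sub', levelMean_zero]
  have hcs := Finset.sum_sq_le_sum_mul_sum_of_sq_le_mul (Finset.range n)
    (r := fun k => levelMean φ p e e' k - levelMean φ p e e' (k + 1))
    (f := fun k => 4 / (k + 1 : ℝ))
    (g := fun k => ∑ q ∈ Finset.HasAntidiagonal.antidiagonal k, localEnergy φ (p + q.1 • e + q.2 • e'))
    (fun k _ => by positivity) (fun k _ => Finset.sum_nonneg fun q _ => localEnergy_nonneg _ _)
    (fun k _ => levelMean_sub_succ_sq_le φ p he he' k)
  rw [htel]
  refine hcs.trans ?_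
  have hharm : ∑ k ∈ Finset.range n, 4 / (k + 1 : ℝ) ≤ 4 * (1 + Real.log n) := by
    have h := harmonic_le_one_add_log n
    rw [harmonic] at h
    push_cast at h
    calc ∑ k ∈ Finset.range n, 4 / (k + 1 : ℝ) = 4 * ∑ k ∈ Finset.range n, ((k : ℝ) + 1)⁻¹ := by
          rw [Finset.mul_sum]; rfl
      _ ≤ _ := by linarith
  refine mul_le_mul hharm (sum_levels_le_TGenergy hφ p hdet n)
    (Finset.sum_nonneg fun k _ => Finset.sum_nonneg fun q _ => localEnergy_nonneg _ _) ?_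
  have := Real.log_natCast_nonneg n
  positivity

/-- The cones opening from `p` and from `p + n (e + e')` toward each other share their last level.
Through this common mean the values at the two tips can be compared. -/
theorem levelMean_reverse (φ : TGVertex → ℝ) (p e e' : TGVertex) (n : ℕ) :
    levelMean φ (p + n • (e + e')) (-e) (-e') n = levelMean φ p e e' n := by
  rw [levelMean, levelMean, ← Finset.Nat.sum_antidiagonal_swap]
  congr 1
  refine Finset.sum_congr rfl fun q hq => ?_
  rw [← Finset.HasAntidiagonal.mem_antidiagonal.1 hq]
  congr 1
  simp only [Prod.fst_swap, Prod.snd_swap, smul_neg, add_smul, smul_add]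
  abel

theorem sub_sq_le_of_add_smul {φ : TGVertex → ℝ} (hφ : φ.support.Finite) (p : TGVertex)
    {e e' : TGVertex} (he : e ∈ TGdirs) (he' : e' ∈ TGdirs)
    (hdet : e.1 * e'.2 - e.2 * e'.1 ≠ 0) (n : ℕ) :
    (φ p - φ (p + n • (e + e'))) ^ 2 ≤ 16 * (1 + Real.log n) * TGenergy φ := by
  have h1 := sub_levelMean_sq_le hφ p he he' hdet n
  have h2 := sub_levelMean_sq_le hφ (p + n • (e + e')) (neg_mem_TGdirs he) (neg_mem_TGdirs he')
    (by simpa using hdet) n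
  rw [levelMean_reverse] at h2
  nlinarith [sq_nonneg (φ p - levelMean φ p e e' n + (φ (p + n • (e + e')) - levelMean φ p e e' n))]

theorem sub_sq_le_log_mul_TGenergy {φ : TGVertex → ℝ} (hφ : φ.support.Finite) (w : TGVertex)
    {N : ℕ} (h1 : w.1.natAbs ≤ N) (h2 : w.2.natAbs ≤ N) :
    (φ w - φ 0) ^ 2 ≤ 64 * (1 + Real.log N) * TGenergy φ := by
  have hE : 0 ≤ TGenergy φ := tsum_nonneg fun x => localEnergy_nonneg φ x
  have hlog : ∀ n : ℕ, n ≤ N → Real.log n ≤ Real.log N := by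
    intro n hn
    rcases Nat.eq_zero_or_pos n with rfl | h
    · simpa using Real.log_natCast_nonneg N
    · exact Real.log_le_log (by exact_mod_cast h) (by exact_mod_cast hn)
  have step : ∀ (p e e' : TGVertex), e ∈ TGdirs → e' ∈ TGdirs →
      e.1 * e'.2 - e.2 * e'.1 ≠ 0 → ∀ a : ℤ, a.natAbs ≤ N →
      (φ p - φ (p + a • (e + e'))) ^ 2 ≤ 16 * (1 + Real.log N) * TGenergy φ := by
    intro p e e' he he' hdet a ha
    have hle : 16 * (1 + Real.log a.natAbs) * TGenergy φ ≤ 16 * (1 + Real.log N) * TGenergy φ := by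
      have := hlog _ ha
      exact mul_le_mul_of_nonneg_right (by linarith) hE
    rcases Int.natAbs_eq a with h | h
    · have := sub_sq_le_of_add_smul hφ p he he' hdet a.natAbs
      rw [← natCast_zsmul, ← h] at this
      exact this.trans hle
    · have := sub_sq_le_of_add_smul hφ p (neg_mem_TGdirs he) (neg_mem_TGdirs he')
        (by simpa using hdet) a.natAbs
      have e1 : a.natAbs • (-e + -e') = a • (e + e') := by
        rw [← natCast_zsmul]
        nth_rw 2 [h]
        rw [neg_smul, ← neg_add, smul_neg]
      rw [e1] at this
      exact this.trans hle
  -- Each unit vector along a coordinate is a sum of two independent grid directions, so `w` is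
  -- reached from `0` by two such moves. Splitting the square doubles the two bounds of `16`, which
  -- gives `64`.
  have s1 := step 0 (0, 1) (1, -1) (by decide) (by decide) (by decide) w.1 h1
  have s2 := step (0 + w.1 • ((0, 1) + (1, -1))) (1, 0) (-1, 1) (by decide) (by decide) (by decide)
    w.2 h2
  have hw : (0 : TGVertex) + w.1 • ((0, 1) + (1, -1)) + w.2 • ((1, 0) + (-1, 1)) = w := by
    ext <;> simp
  rw [hw] at s2
  set m := φ (0 + w.1 • ((0, 1) + (1, -1)))
  nlinarith [sq_nonneg (φ 0 - m - (m - φ w))]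

/-! ### A logarithmic cutoff -/

/-- `1 + |x|²`. -/
noncomputable def TGbracket (x : TGVertex) : ℝ := 1 + TGnormSq x

theorem one_le_TGbracket (x : TGVertex) : 1 ≤ TGbracket x := by
  have : (0 : ℝ) ≤ TGnormSq x := by exact_mod_cast TGnormSq_nonneg x
  unfold TGbracket; linarith

/-- The function is almost harmonic: with `s = 1 + |x|²`, the product of the bracket over the six
neighbors is `(s³ + 3s + 4)²` minus a square. So the leading `6 log s` cancels and the remainder is
of order `s⁻²`, summable over the plane. -/
theorem TGlap_log_le (x : TGVertex) :
    TGlap (fun y => Real.log (TGbracket y)) x ≤ 14 / TGbracket x ^ 2 := by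
  set s := TGbracket x with hs
  have hs1 : 1 ≤ s := one_le_TGbracket x
  have hpos : ∀ y, TGbracket y ≠ 0 := fun y => (zero_lt_one.trans_le (one_le_TGbracket y)).ne'
  have hprod : ∏ d ∈ TGdirs, TGbracket (x + d) =
      (s ^ 3 + 3 * s + 4) ^ 2 -
      ((2 * x.1 + x.2) * (x.1 + 2 * x.2) * (x.1 - x.2) : ℝ) ^ 2 := by
    rcases x with ⟨a, b⟩
    simp only [hs, TGdirs]
    repeat rw [Finset.prod_insert (by decide)]
    rw [Finset.prod_singleton]
    simp only [TGbracket, TGnormSq, Prod.mk_add_mk]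
    push_cast
    ring
  rw [TGlap_eq, ← Real.log_prod (fun d _ => hpos _), hprod]
  have h1 : Real.log ((s ^ 3 + 3 * s + 4) ^ 2 -
      ((2 * x.1 + x.2) * (x.1 + 2 * x.2) * (x.1 - x.2) : ℝ) ^ 2) ≤
      2 * Real.log (s ^ 3 + 3 * s + 4) := by
    rw [← Real.log_rpow (by positivity)]
    refine Real.log_le_log ?_ ?_
    · rw [← hprod]
      exact Finset.prod_pos fun d _ => zero_lt_one.trans_le (one_le_TGbracket _)
    · rw [Real.rpow_two]
      linarith [sq_nonneg ((2 * x.1 + x.2) * (x.1 + 2 * x.2) * (x.1 - x.2) : ℝ)]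
  have h2 : Real.log (s ^ 3 + 3 * s + 4) = 3 * Real.log s + Real.log (1 + 3 / s ^ 2 + 4 / s ^ 3) := by
    have : s ^ 3 + 3 * s + 4 = s ^ 3 * (1 + 3 / s ^ 2 + 4 / s ^ 3) := by field_simp
    rw [this, Real.log_mul (by positivity) (by positivity), Real.log_pow]; norm_num
  have h3 : Real.log (1 + 3 / s ^ 2 + 4 / s ^ 3) ≤ 3 / s ^ 2 + 4 / s ^ 3 := by
    have := Real.log_le_sub_one_of_pos (x := 1 + 3 / s ^ 2 + 4 / s ^ 3) (by positivity)
    linarith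
  have h4 : 4 / s ^ 3 ≤ 4 / s ^ 2 := by
    apply div_le_div_of_nonneg_left (by norm_num) (by positivity)
    exact pow_le_pow_right₀ hs1 (by norm_num)
  have h5 : 14 / s ^ 2 = 2 * (3 / s ^ 2 + 4 / s ^ 2) := by ring
  rw [h5]
  linarith

theorem summable_inv_TGbracket_sq : Summable fun x => 1 / TGbracket x ^ 2 := by
  have h1 : Summable fun n : ℤ => 1 / (1 + (n : ℝ) ^ 2) := by
    have h0 : Summable fun n : ℤ => 1 / (n : ℝ) ^ 2 + if n = 0 then 1 else 0 :=
      (Real.summable_one_div_int_pow.2 one_lt_two).add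
        (summable_of_hasFiniteSupport ((Set.finite_singleton (0 : ℤ)).subset fun n hn => by
          by_contra h
          exact hn (if_neg h)))
    refine Summable.of_nonneg_of_le (fun n => by positivity) (fun n => ?_) h0
    split_ifs with h
    · simp [h]
    · rw [add_zero]
      apply one_div_le_one_div_of_le
      · have : (n : ℝ) ≠ 0 := by exact_mod_cast h
        positivity
      · linarith
  have h2 := h1.mul_of_nonneg h1 (fun n => by simp only [Pi.zero_apply]; positivity)
    (fun n => by simp only [Pi.zero_apply]; positivity)
  refine Summable.of_nonneg_of_le (fun x => by positivity) (fun x => ?_) h2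
  rw [one_div_mul_one_div]
  apply one_div_le_one_div_of_le (by positivity)
  unfold TGbracket TGnormSq
  push_cast
  set a := (x.1 : ℝ)
  set b := (x.2 : ℝ)
  -- The form is at least `(a² + b²) / 2`, and the product of `1 + a²` and `1 + b²` is at most the
  -- square of their arithmetic mean.
  have e1 : 1 + (a ^ 2 + b ^ 2) / 2 ≤ 1 + (a ^ 2 + a * b + b ^ 2) := by
    nlinarith [sq_nonneg (a + b)]
  calc (1 + a ^ 2) * (1 + b ^ 2) ≤ (1 + (a ^ 2 + b ^ 2) / 2) ^ 2 := by
        nlinarith [sq_nonneg (a ^ 2 - b ^ 2)]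
    _ ≤ _ := by gcongr

/-- The logarithmic cutoff that vanishes at distance `N` from the origin. -/
noncomputable def logCutoff (N : ℕ) (x : TGVertex) : ℝ :=
  max 0 (1 - Real.log (TGbracket x) / Real.log (1 + (N : ℝ) ^ 2))

theorem log_one_add_sq_pos {N : ℕ} (hN : 1 ≤ N) : 0 < Real.log (1 + (N : ℝ) ^ 2) := by
  have : (1 : ℝ) ≤ N := by exact_mod_cast hN
  exact Real.log_pos (by nlinarith)

theorem TGnormSq_lt_of_logCutoff_ne_zero {N : ℕ} (hN : 1 ≤ N) {x : TGVertex}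
    (hx : logCutoff N x ≠ 0) : (TGnormSq x : ℝ) < (N : ℝ) ^ 2 := by
  by_contra! h
  apply hx
  rw [logCutoff, max_eq_left]
  have : Real.log (1 + (N : ℝ) ^ 2) ≤ Real.log (TGbracket x) :=
    Real.log_le_log (by positivity) (by unfold TGbracket; linarith)
  have := (one_le_div (log_one_add_sq_pos hN)).2 this
  linarith

theorem finite_TGnormSq_lt (r : ℝ) : {x : TGVertex | (TGnormSq x : ℝ) < r}.Finite := by
  refine (TGvertices_finite (Metric.isBounded_ball (x := (0 : ℂ)) (r := √(max r 0) + 1))).subset ?_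
  intro x hx
  apply subset_closure
  rw [Metric.mem_ball, dist_zero_right]
  have h : (TGnormSq x : ℝ) < r := hx
  have : ‖TGpos x‖ ≤ √(max r 0) := by
    apply Real.le_sqrt_of_sq_le
    rw [norm_TGpos_sq]
    exact h.le.trans (le_max_left _ _)
  linarith

theorem logCutoff_support {N : ℕ} (hN : 1 ≤ N) : (logCutoff N).support.Finite :=
  (finite_TGnormSq_lt _).subset fun _ hx => TGnormSq_lt_of_logCutoff_ne_zero hN hx

theorem logCutoff_nonneg (N : ℕ) (x : TGVertex) : 0 ≤ logCutoff N x := le_max_left _ _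

/-- Truncation at zero does no harm: where the cutoff vanishes it has a minimum and nonnegative
Laplacian, and elsewhere truncation only raises the neighboring values. -/
theorem neg_TGlap_logCutoff_le {N : ℕ} (hN : 1 ≤ N) (x : TGVertex) :
    -TGlap (logCutoff N) x ≤ 14 / Real.log (1 + (N : ℝ) ^ 2) * (1 / TGbracket x ^ 2) := by
  have hL := log_one_add_sq_pos hN
  set L := Real.log (1 + (N : ℝ) ^ 2)
  have hs : 0 < TGbracket x := zero_lt_one.trans_le (one_le_TGbracket x)
  rcases le_total (1 - Real.log (TGbracket x) / L) 0 with h | h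
  · have h0 : logCutoff N x = 0 := max_eq_left h
    have : 0 ≤ TGlap (logCutoff N) x := by
      refine Finset.sum_nonneg fun d _ => ?_
      rw [h0, sub_zero]; exact logCutoff_nonneg _ _
    have : 0 ≤ 14 / L * (1 / TGbracket x ^ 2) := by positivity
    linarith
  · have h0 : logCutoff N x = 1 - Real.log (TGbracket x) / L := max_eq_right h
    have h1 : -(TGlap (fun y => Real.log (TGbracket y)) x / L) ≤ TGlap (logCutoff N) x := by
      simp only [TGlap, Finset.sum_div, ← Finset.sum_neg_distrib]
      refine Finset.sum_le_sum fun d _ => ?_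
      have : 1 - Real.log (TGbracket (x + d)) / L ≤ logCutoff N (x + d) := le_max_right _ _
      rw [h0, sub_div]; linarith
    have h2 := div_le_div_of_nonneg_right (TGlap_log_le x) hL.le
    have h3 : 14 / L * (1 / TGbracket x ^ 2) = 14 / TGbracket x ^ 2 / L := by
      field_simp
    rw [h3]; linarith

theorem half_le_logCutoff {N : ℕ} (hN : 1 ≤ N) {x : TGVertex}
    (hx : TGbracket x ^ 2 ≤ 1 + (N : ℝ) ^ 2) : 1 / 2 ≤ logCutoff N x := by
  have hL := log_one_add_sq_pos hN
  have hs : 0 < TGbracket x := zero_lt_one.trans_le (one_le_TGbracket x)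
  have h := Real.log_le_log (by positivity) hx
  rw [Real.log_pow] at h
  refine le_trans ?_ (le_max_right _ _)
  have : Real.log (TGbracket x) / Real.log (1 + (N : ℝ) ^ 2) ≤ 1 / 2 := by
    rw [div_le_iff₀ hL]; push_cast at h; linarith
  linarith

/-- An almost subharmonic function that is bounded by `M` in a large ball has a small Laplacian
near the origin. -/
theorem logCutoff_mul_TGlap_le {N : ℕ} (hN : 1 ≤ N) {D : TGVertex → ℝ} {M η : ℝ}
    (hη : 0 ≤ η) (hM : 0 ≤ M) (hD0 : ∀ x, 0 ≤ D x)
    (hDM : ∀ x, (TGnormSq x : ℝ) < ((N : ℝ) + 1) ^ 2 → D x ≤ M)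
    (hlap : ∀ x, (TGnormSq x : ℝ) < (N : ℝ) ^ 2 → -η ≤ TGlap D x) (v : TGVertex) :
    logCutoff N v * TGlap D v ≤
      M * (14 / Real.log (1 + (N : ℝ) ^ 2)) * (∑' x, 1 / TGbracket x ^ 2) +
        η * ∑' x, logCutoff N x := by
  have hsupp := logCutoff_support hN
  have hψs : Summable (logCutoff N) := summable_of_hasFiniteSupport hsupp
  have hparts := tsum_mul_TGlap (logCutoff N) D hsupp
  have hs1 : Summable fun x => logCutoff N x * TGlap D x := summable_mul_of_support hsupp
  have hs2 : Summable fun x => D x * TGlap (logCutoff N) x := by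
    simpa only [mul_comm] using summable_mul_of_support (g := D) (TGlap_support hsupp)
  have hzero : ∑' x, TGlap (logCutoff N) x = 0 := by
    have := tsum_mul_TGlap (logCutoff N) (fun _ => 1) hsupp
    simp only [one_mul] at this
    rw [← this]
    simp [TGlap]
  have hs3 : Summable (TGlap (logCutoff N)) := summable_of_hasFiniteSupport (TGlap_support hsupp)
  set c := 14 / Real.log (1 + (N : ℝ) ^ 2)
  have hc : 0 < c := div_pos (by norm_num) (log_one_add_sq_pos hN)
  -- Where the cutoff has positive Laplacian, `D` is replaced by its bound `M`; this happens only
  -- within distance `N + 1`. Where the Laplacian is negative, the product is at most zero, which is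
  -- `M` times the Laplacian plus `M` times its negative part. The first term sums to zero.
  have hpt : ∀ x, D x * TGlap (logCutoff N) x ≤
      M * TGlap (logCutoff N) x + M * c * (1 / TGbracket x ^ 2) := by
    intro x
    have hs : 0 < TGbracket x := zero_lt_one.trans_le (one_le_TGbracket x)
    have h0 : 0 ≤ M * c * (1 / TGbracket x ^ 2) := by positivity
    rcases lt_trichotomy (TGlap (logCutoff N) x) 0 with h | h | h
    · have h1 := neg_TGlap_logCutoff_le hN x
      have h2 := mul_le_mul_of_nonneg_left h1 hM
      have h3 := mul_nonneg (hD0 x) (neg_nonneg.2 h.le)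
      have h4 : M * (c * (1 / TGbracket x ^ 2)) = M * c * (1 / TGbracket x ^ 2) := by ring
      linarith
    · rw [h]; simpa using h0
    · have hx : (TGnormSq x : ℝ) < ((N : ℝ) + 1) ^ 2 := by
        obtain ⟨d, hd, hne⟩ : ∃ d ∈ TGdirs, logCutoff N (x + d) - logCutoff N x ≠ 0 := by
          by_contra! hall
          rw [TGlap, Finset.sum_eq_zero hall] at h
          exact lt_irrefl _ h
        rw [← norm_TGpos_sq]
        have hd1 : ‖TGpos d‖ = 1 := by
          have := norm_TGpos_sq d
          rw [(mem_TGdirs_iff d).1 hd] at this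
          have h0 := norm_nonneg (TGpos d)
          push_cast at this
          nlinarith
        have hlt : ∀ y, logCutoff N y ≠ 0 → ‖TGpos y‖ < N := by
          intro y hy
          have := TGnormSq_lt_of_logCutoff_ne_zero hN hy
          rw [← norm_TGpos_sq] at this
          exact lt_of_pow_lt_pow_left₀ 2 (by positivity) this
        refine pow_lt_pow_left₀ ?_ (norm_nonneg _) two_ne_zero
        by_cases hz : logCutoff N x = 0
        · have h1 := hlt (x + d) (by simpa [hz] using hne)
          have h2 : TGpos x = TGpos (x + d) - TGpos d := by rw [TGpos_add]; ring
          have h3 := norm_sub_le (TGpos (x + d)) (TGpos d)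
          rw [← h2] at h3
          linarith
        · linarith [hlt x hz]
      have := mul_le_mul_of_nonneg_right (hDM x hx) h.le
      linarith
  have hsum : ∑' x, logCutoff N x * TGlap D x ≤ M * c * ∑' x, 1 / TGbracket x ^ 2 := by
    rw [hparts]
    have hs4 := summable_inv_TGbracket_sq.mul_left (M * c)
    refine (hs2.tsum_le_tsum hpt ((hs3.mul_left M).add hs4)).trans ?_
    rw [(hs3.mul_left M).tsum_add hs4, tsum_mul_left, hzero, tsum_mul_left]
    simp
  -- After adding `η` times the cutoff all terms are nonnegative, so the term at `v` is at most the
  -- whole sum.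
  have hlow : ∀ x, 0 ≤ logCutoff N x * TGlap D x + η * logCutoff N x := by
    intro x
    by_cases hx : logCutoff N x = 0
    · simp [hx]
    · have := hlap x (TGnormSq_lt_of_logCutoff_ne_zero hN hx)
      nlinarith [logCutoff_nonneg N x]
  have hsingle := (hs1.add (hψs.mul_left η)).le_tsum v fun x _ => hlow x
  rw [hs1.tsum_add (hψs.mul_left η), tsum_mul_left] at hsingle
  have := mul_nonneg hη (logCutoff_nonneg N v)
  linarith

/-! ## Integrals against the field -/

theorem continuous_glueBoundary {V : Type*} (B : Set V) (b : B → ℝ) : Continuous (glueBoundary B b) := by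
  refine continuous_pi fun v => ?_
  unfold glueBoundary
  by_cases hv : v ∈ B
  · simp only [hv, dif_pos]; exact continuous_const
  · simp only [hv, dif_neg, not_false_iff]; exact continuous_apply _

theorem glueBoundary_update {V : Type*} [DecidableEq V] (B : Set V) (b : B → ℝ) (g : (Bᶜ : Set V) → ℝ) (i : (Bᶜ : Set V))
    (t : ℝ) : glueBoundary B b (Function.update g i t) =
      Function.update (glueBoundary B b g) i t := by
  funext v
  by_cases hv : v ∈ B
  · have : v ≠ i := fun h => i.2 (h ▸ hv)
    simp [glueBoundary, hv, Function.update_of_ne this]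
  · by_cases hvi : v = i
    · subst hvi
      have : (⟨i, hv⟩ : (Bᶜ : Set V)) = i := rfl
      simp [glueBoundary, hv]
    · have : (⟨v, hv⟩ : (Bᶜ : Set V)) ≠ i := fun h => hvi (by rw [← h])
      simp [glueBoundary, hv, Function.update_of_ne hvi, Function.update_of_ne this]

section DGFF

variable {V : Type*} [Fintype V]

open Classical in
theorem gradNormSq_update [DecidableEq V] (G : SimpleGraph V) (h : V → ℝ) (v : V) (t : ℝ) :
    gradNormSq G (Function.update h v t) = gradNormSq G (Function.update h v 0) +
      ∑ u, if G.Adj v u then t ^ 2 - 2 * t * h u else 0 := by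
  set φ : V → ℝ := fun u => if G.Adj v u then t ^ 2 - 2 * t * h u else 0 with hφ
  have key : ∀ a b, (if G.Adj a b then
      (Function.update h v t a - Function.update h v t b) ^ 2 else 0) =
      (if G.Adj a b then (Function.update h v 0 a - Function.update h v 0 b) ^ 2 else 0) +
        ((if a = v then φ b else 0) + if b = v then φ a else 0) := by
    intro a b
    by_cases ha : a = v
    · by_cases hb : b = v
      · subst ha; subst hb; simp [φ]
      · subst ha
        by_cases hadj : G.Adj a b
        · simp [φ, hadj, hb]; ring
        · simp [φ, hadj, hb]
    · by_cases hb : b = v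
      · subst hb
        by_cases hadj : G.Adj b a
        · simp [φ, hadj, hadj.symm, ha]; ring
        · have : ¬ G.Adj a b := fun h => hadj h.symm
          simp [φ, hadj, this, ha]
      · simp [ha, hb]
  simp only [gradNormSq]
  simp_rw [key, Finset.sum_add_distrib]
  have h1 : ∑ a, ∑ b, (if a = v then φ b else 0) = ∑ u, φ u := by
    rw [Finset.sum_comm]
    refine Finset.sum_congr rfl fun b _ => ?_
    simp
  have h2 : ∑ a, ∑ b, (if b = v then φ a else 0) = ∑ u, φ u :=
    Finset.sum_congr rfl fun a _ => by simp
  rw [h1, h2]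
  ring

theorem sq_sub_le_gradNormSq (G : SimpleGraph V) (h : V → ℝ) {v w : V} (hvw : G.Adj v w) :
    (h v - h w) ^ 2 ≤ 2 * gradNormSq G h := by
  classical
  have h0 : ∀ a b, (0 : ℝ) ≤ if G.Adj a b then (h a - h b) ^ 2 else 0 := fun a b => by
    split_ifs
    · exact sq_nonneg _
    · exact le_rfl
  have h1 : (h v - h w) ^ 2 ≤ ∑ u, if G.Adj v u then (h v - h u) ^ 2 else 0 := by
    have := Finset.single_le_sum (f := fun u => if G.Adj v u then (h v - h u) ^ 2 else 0)
      (fun u _ => h0 v u) (Finset.mem_univ w)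
    simpa [hvw] using this
  have h2 := Finset.single_le_sum
    (f := fun a => ∑ u, if G.Adj a u then (h a - h u) ^ 2 else 0)
    (fun a _ => Finset.sum_nonneg fun u _ => h0 a u) (Finset.mem_univ v)
  have h3 : 2 * gradNormSq G h = ∑ a, ∑ u, if G.Adj a u then (h a - h u) ^ 2 else 0 := by
    rw [gradNormSq, ← mul_assoc]
    norm_num
  rw [h3]
  exact h1.trans h2

theorem gradNormSq_nonneg (G : SimpleGraph V) (h : V → ℝ) : 0 ≤ gradNormSq G h := by
  classical
  unfold gradNormSq
  refine mul_nonneg (by norm_num) (Finset.sum_nonneg fun a _ => Finset.sum_nonneg fun b _ => ?_)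
  split_ifs
  · exact sq_nonneg _
  · exact le_rfl

theorem continuous_gradNormSq (G : SimpleGraph V) : Continuous (gradNormSq G) := by
  classical
  unfold gradNormSq
  refine continuous_const.mul (continuous_finsetSum _ fun a _ => continuous_finsetSum _ fun b _ => ?_)
  split_ifs <;> fun_prop

/-- The density of the DGFF. -/
noncomputable def dgffWeight (G : SimpleGraph V) (h : V → ℝ) : ENNReal :=
  ENNReal.ofReal (Real.exp (-(gradNormSq G h / 2)))

theorem measurable_dgffWeight (G : SimpleGraph V) : Measurable (dgffWeight G) := by
  have := (continuous_gradNormSq G).measurable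
  unfold dgffWeight
  fun_prop

open Classical in
theorem lintegral_dgffUnnormalized (G : SimpleGraph V) (B : Set V) (b : B → ℝ)
    {F : (V → ℝ) → ENNReal} (hF : Measurable F) :
    ∫⁻ h, F h ∂dgffUnnormalized G B b =
      ∫⁻ g : (Bᶜ : Set V) → ℝ, dgffWeight G (glueBoundary B b g) * F (glueBoundary B b g) := by
  have hm := (continuous_glueBoundary B b).measurable
  rw [dgffUnnormalized, lintegral_map hF hm]
  exact lintegral_withDensity_eq_lintegral_mul _ ((measurable_dgffWeight G).comp hm) (hF.comp hm)

end DGFF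

/-! ### The conditioned field and its law at a single site -/

namespace SignedSystem

variable (S : SignedSystem)

open Classical in
/-- The field at a vertex of the grid, extended by zero. -/
noncomputable def field (v : TGVertex) (h : S.V → ℝ) : ℝ := if hv : v ∈ S.V then h ⟨v, hv⟩ else 0

/-- The mean of the field over the neighbors of a vertex. -/
noncomputable def nbrMean (v : TGVertex) (h : S.V → ℝ) : ℝ :=
  (∑ d ∈ TGdirs, S.field (v + d) h) / 6

open Classical in
/-- The set of values allowed at a vertex. -/
noncomputable def range (v : TGVertex) : Set ℝ :=
  if v ∈ S.Vplus then Set.Ioi 0 else if v ∈ S.Vminus then Set.Iio 0 else Set.univ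

theorem isSiteRange_range (v : TGVertex) : IsSiteRange (S.range v) := by
  unfold range IsSiteRange
  split_ifs <;> simp

theorem range_of_mem_Vplus {v : TGVertex} (hv : v ∈ S.Vplus) : S.range v = Set.Ioi 0 := by
  simp [range, hv]

theorem range_of_mem_Vminus {v : TGVertex} (hv : v ∈ S.Vminus) : S.range v = Set.Iio 0 := by
  have : v ∉ S.Vplus := fun h => Set.disjoint_left.1 S.disjoint h hv
  simp [range, hv, this]

theorem range_of_notMem {v : TGVertex} (h1 : v ∉ S.Vplus) (h2 : v ∉ S.Vminus) :
    S.range v = Set.univ := by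
  simp [range, h1, h2]

theorem signEvent_eq : S.signEvent = {h | ∀ v : S.V, h v ∈ S.range v} := by
  ext h
  simp only [signEvent, Set.mem_ofPred_eq]
  constructor
  · rintro ⟨h1, h2⟩ v
    by_cases hp : (v : TGVertex) ∈ S.Vplus
    · rw [S.range_of_mem_Vplus hp]; exact h1 v hp
    by_cases hm : (v : TGVertex) ∈ S.Vminus
    · rw [S.range_of_mem_Vminus hm]; exact h2 v hm
    rw [S.range_of_notMem hp hm]; trivial
  · intro hall
    refine ⟨fun v hv => ?_, fun v hv => ?_⟩
    · have := hall v; rwa [S.range_of_mem_Vplus hv] at this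
    · have := hall v; rwa [S.range_of_mem_Vminus hv] at this

theorem isOpen_signEvent : IsOpen S.signEvent := by
  rw [signEvent_eq, Set.ofPred_forall]
  refine isOpen_iInter_of_finite fun v => ?_
  have : IsOpen (S.range v) := by
    rcases S.isSiteRange_range v with h | h | h <;> rw [h]
    · exact isOpen_univ
    · exact isOpen_Ioi
    · exact isOpen_Iio
  exact this.preimage (continuous_apply v)

theorem mem_V_of_mem_D {v : TGVertex} (hv : TGpos v ∈ S.D) : v ∈ S.V := subset_closure hv

theorem add_mem_V {v d : TGVertex} (hv : TGpos v ∈ S.D) (hd : d ∈ TGdirs) : v + d ∈ S.V :=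
  S.isTGRegion.neighbor_mem_closure hv hd

theorem mem_bdry_iff (v : S.V) : v ∈ S.bdry ↔ TGpos v ∉ S.D := by
  change TGpos v ∈ frontier S.D ↔ _
  rw [S.isTGRegion.isOpen.frontier_eq]
  exact ⟨fun h => h.2, fun h => ⟨v.2, h⟩⟩

theorem field_of_mem {v : TGVertex} (hv : v ∈ S.V) (h : S.V → ℝ) : S.field v h = h ⟨v, hv⟩ := by
  simp [field, hv]

theorem field_of_notMem {v : TGVertex} (hv : v ∉ S.V) (h : S.V → ℝ) : S.field v h = 0 := by
  simp [field, hv]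

@[fun_prop]
theorem measurable_field (v : TGVertex) : Measurable (S.field v) := by
  by_cases hv : v ∈ S.V
  · have : S.field v = fun h => h ⟨v, hv⟩ := funext fun h => S.field_of_mem hv h
    rw [this]; exact measurable_pi_apply _
  · have : S.field v = fun _ => 0 := funext fun h => S.field_of_notMem hv h
    rw [this]; exact measurable_const

@[fun_prop]
theorem measurable_nbrMean (v : TGVertex) : Measurable (S.nbrMean v) := by
  unfold nbrMean
  exact (Finset.measurable_sum _ fun d _ => S.measurable_field _).div_const _

open Classical in
/-- The field with the value at `v` drawn anew, given the other values. -/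
noncomputable def resample (v : TGVertex) (p : (S.V → ℝ) × ℝ) : S.V → ℝ :=
  if hv : v ∈ S.V then
    Function.update p.1 ⟨v, hv⟩ (siteQuantile (S.range v) (S.nbrMean v p.1) p.2)
  else p.1

theorem field_resample_self {v : TGVertex} (hv : v ∈ S.V) (p : (S.V → ℝ) × ℝ) :
    S.field v (S.resample v p) = siteQuantile (S.range v) (S.nbrMean v p.1) p.2 := by
  rw [S.field_of_mem hv, resample, dif_pos hv, Function.update_self]

theorem field_update_of_ne {v w : TGVertex} (hv : v ∈ S.V) (h : S.V → ℝ) (t : ℝ) (hw : w ≠ v) :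
    S.field w (Function.update h ⟨v, hv⟩ t) = S.field w h := by
  classical
  by_cases hwV : w ∈ S.V
  · rw [S.field_of_mem hwV, S.field_of_mem hwV, Function.update_of_ne]
    exact fun h => hw (congrArg Subtype.val h)
  · rw [S.field_of_notMem hwV, S.field_of_notMem hwV]

theorem field_resample_of_ne {v w : TGVertex} (hw : w ≠ v) (p : (S.V → ℝ) × ℝ) :
    S.field w (S.resample v p) = S.field w p.1 := by
  by_cases hv : v ∈ S.V
  · rw [resample, dif_pos hv, S.field_update_of_ne hv _ _ hw]
  · rw [resample, dif_neg hv]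

theorem add_ne_self {v d : TGVertex} (hd : d ∈ TGdirs) : v + d ≠ v := by
  have : d ≠ 0 := by rintro rfl; revert hd; decide
  simpa using this

theorem nbrMean_update {v : TGVertex} (hv : v ∈ S.V) (h : S.V → ℝ) (t : ℝ) :
    S.nbrMean v (Function.update h ⟨v, hv⟩ t) = S.nbrMean v h := by
  classical
  simp only [nbrMean]
  congr 1
  exact Finset.sum_congr rfl fun d hd => S.field_update_of_ne hv h t (add_ne_self hd)

theorem measurable_resample (v : TGVertex) : Measurable (S.resample v) := by
  have hp : Measurable fun p : (S.V → ℝ) × ℝ => (S.nbrMean v p.1, p.2) :=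
    ((S.measurable_nbrMean v).comp measurable_fst).prodMk measurable_snd
  have hq : Measurable fun p : (S.V → ℝ) × ℝ =>
      siteQuantile (S.range v) (S.nbrMean v p.1) p.2 := by
    simpa only [Function.comp_def] using
      (measurable_siteQuantile (S.isSiteRange_range v)).comp hp
  by_cases hv : v ∈ S.V
  · have h1 : S.resample v = fun p => Function.update p.1 ⟨v, hv⟩
        (siteQuantile (S.range v) (S.nbrMean v p.1) p.2) := by
      funext p; rw [resample, dif_pos hv]
    rw [h1, measurable_pi_iff]
    intro w
    by_cases hw : w = ⟨v, hv⟩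
    · rw [hw]
      simp only [Function.update_self]
      exact hq
    · simp only [Function.update_of_ne hw]
      exact (measurable_pi_apply w).comp measurable_fst
  · have h1 : S.resample v = fun p => p.1 := by
      funext p; rw [resample, dif_neg hv]
    rw [h1]; exact measurable_fst

open Classical in
theorem sum_adj_eq {v : TGVertex} (hv : TGpos v ∈ S.D) (f : TGVertex → ℝ) :
    (∑ u : S.V, if (TG.induce S.V).Adj ⟨v, S.mem_V_of_mem_D hv⟩ u then f u else 0) =
      ∑ d ∈ TGdirs, f (v + d) := by
  rw [← Finset.sum_filter]
  symm
  refine Finset.sum_bij (fun d hd => (⟨v + d, S.add_mem_V hv hd⟩ : S.V)) ?_ ?_ ?_ ?_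
  · intro d hd
    exact Finset.mem_filter.2 ⟨Finset.mem_univ _, SimpleGraph.comap_adj.2 (TG_adj_add v hd)⟩
  · intro d _ d' _ h
    exact add_left_cancel (congrArg Subtype.val h)
  · intro u hu
    simp only [Finset.mem_filter, Finset.mem_univ, true_and] at hu
    have hu' : TG.Adj v u := hu
    exact ⟨u - v, (TG_adj_iff _ _).1 hu', Subtype.ext (add_sub_cancel v (u : TGVertex))⟩
  · intro d _
    rfl

theorem gradNormSq_update {v : TGVertex} (hv : TGpos v ∈ S.D) (h : S.V → ℝ) (t : ℝ) :
    gradNormSq (TG.induce S.V) (Function.update h ⟨v, S.mem_V_of_mem_D hv⟩ t) =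
      gradNormSq (TG.induce S.V) (Function.update h ⟨v, S.mem_V_of_mem_D hv⟩ 0) +
        (6 * t ^ 2 - 12 * S.nbrMean v h * t) := by
  rw [_root_.gradNormSq_update]
  congr 1
  have h1 : ∀ u : S.V, h u = S.field u h := fun u => (S.field_of_mem u.2 h).symm
  have h2 := S.sum_adj_eq hv fun u => t ^ 2 - 2 * t * S.field u h
  calc _ = _ := by
        refine Finset.sum_congr rfl fun u _ => ?_
        rw [h1 u]
        congr
    _ = _ := h2
    _ = _ := by
        rw [Finset.sum_sub_distrib, ← Finset.mul_sum, Finset.sum_const, TGdirs_card, nbrMean]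
        simp; ring

theorem dgffWeight_update {v : TGVertex} (hv : TGpos v ∈ S.D) (h : S.V → ℝ) (t : ℝ) :
    dgffWeight (TG.induce S.V) (Function.update h ⟨v, S.mem_V_of_mem_D hv⟩ t) =
      dgffWeight (TG.induce S.V) (Function.update h ⟨v, S.mem_V_of_mem_D hv⟩ 0) *
        ENNReal.ofReal (siteWeight (S.nbrMean v h) t) := by
  rw [dgffWeight, dgffWeight, S.gradNormSq_update hv, ← ENNReal.ofReal_mul (Real.exp_pos _).le,
    siteWeight, ← Real.exp_add]
  congr 2
  ring

/-- The boundary values, as a function on the boundary of the finite graph. -/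
noncomputable def graphBval : S.bdry → ℝ := fun v => S.bval ⟨((v : S.V) : TGVertex), v.2⟩

open Classical in
/-- The field on the whole graph with given values at the inner vertices. -/
noncomputable def glue (g : (S.bdryᶜ : Set S.V) → ℝ) : S.V → ℝ := glueBoundary S.bdry S.graphBval g

theorem measurable_glue : Measurable S.glue := (continuous_glueBoundary _ _).measurable

theorem glue_of_mem_bdry (g : (S.bdryᶜ : Set S.V) → ℝ) {v : S.V} (hv : v ∈ S.bdry) :
    S.glue g v = S.graphBval ⟨v, hv⟩ := by
  simp [glue, glueBoundary, hv]

theorem glue_of_notMem_bdry (g : (S.bdryᶜ : Set S.V) → ℝ) {v : S.V} (hv : v ∉ S.bdry) :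
    S.glue g v = g ⟨v, hv⟩ := by
  simp [glue, glueBoundary, hv]

/-- A discrete Poincaré inequality. From `v` a walk in the direction `(1, 0)` leaves the bounded
domain, reaching a boundary vertex where the value is prescribed, and every step is paid for by the
gradient. The summand `1` absorbs the boundary value. -/
theorem exists_sq_le_gradNormSq (v : S.V) : ∃ C : ℝ, 0 ≤ C ∧ ∀ g,
    (S.glue g v) ^ 2 ≤ C * (1 + gradNormSq (TG.induce S.V) (S.glue g)) := by
  have key : ∀ k : ℕ, ∀ v : S.V, TGpos (v + (k : ℤ) • ((1, 0) : TGVertex)) ∉ S.D →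
      ∃ C : ℝ, 0 ≤ C ∧ ∀ g,
        (S.glue g v) ^ 2 ≤ C * (1 + gradNormSq (TG.induce S.V) (S.glue g)) := by
    have hb : ∀ v : S.V, TGpos v ∉ S.D → ∃ C : ℝ, 0 ≤ C ∧ ∀ g,
        (S.glue g v) ^ 2 ≤ C * (1 + gradNormSq (TG.induce S.V) (S.glue g)) := by
      intro v hv
      have hv' := (S.mem_bdry_iff v).2 hv
      refine ⟨S.graphBval ⟨v, hv'⟩ ^ 2, sq_nonneg _, fun g => ?_⟩
      rw [S.glue_of_mem_bdry g hv']
      have := gradNormSq_nonneg (TG.induce S.V) (S.glue g)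
      nlinarith [sq_nonneg (S.graphBval ⟨v, hv'⟩)]
    intro k
    induction k with
    | zero =>
      intro v hv
      exact hb v (by simpa using hv)
    | succ k ih =>
      intro v hv
      by_cases hvD : TGpos v ∈ S.D
      · have hd : ((1, 0) : TGVertex) ∈ TGdirs := by decide
        obtain ⟨C, hC, h⟩ := ih ⟨(v : TGVertex) + (1, 0), S.add_mem_V hvD hd⟩ (by
          have e : (v : TGVertex) + (1, 0) + (k : ℤ) • ((1, 0) : TGVertex) =
              (v : TGVertex) + ((k + 1 : ℕ) : ℤ) • ((1, 0) : TGVertex) := by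
            rw [Nat.cast_add, Nat.cast_one, add_smul, one_smul]; abel
          rw [e]; exact hv)
        -- With `a` and `b` the values at `v` and its right neighbor, `a² ≤ 2 (a - b)² + 2 b²`; the
        -- first term is at most four times `gradNormSq`.
        refine ⟨2 * C + 4, by positivity, fun g => ?_⟩
        have h1 := h g
        have hadj : (TG.induce S.V).Adj v ⟨(v : TGVertex) + (1, 0), S.add_mem_V hvD hd⟩ :=
          SimpleGraph.comap_adj.2 (TG_adj_add (v : TGVertex) hd)
        have h2 := sq_sub_le_gradNormSq (TG.induce S.V) (S.glue g) hadj
        set a := S.glue g v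
        set b := S.glue g ⟨(v : TGVertex) + (1, 0), S.add_mem_V hvD hd⟩
        have := gradNormSq_nonneg (TG.induce S.V) (S.glue g)
        nlinarith [sq_nonneg (a - b - b)]
      · exact hb v hvD
  have hfin : S.V.Finite := TGvertices_finite S.isTGRegion.isBounded
  obtain ⟨k, hk⟩ : ∃ k : ℕ, (v : TGVertex) + (k : ℤ) • ((1, 0) : TGVertex) ∉ S.V := by
    by_contra! hall
    refine Set.infinite_of_injective_forall_mem (f := fun k : ℕ =>
      (v : TGVertex) + (k : ℤ) • ((1, 0) : TGVertex)) ?_ hall hfin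
    intro k k' h
    have := congrArg Prod.fst h
    simpa using this
  exact key k v fun h => hk (S.mem_V_of_mem_D h)

open Classical in
theorem exists_coercive : ∃ κ : ℝ, 0 < κ ∧ ∀ g : (S.bdryᶜ : Set S.V) → ℝ,
    κ * ∑ i, g i ^ 2 ≤ 1 + gradNormSq (TG.induce S.V) (S.glue g) := by
  choose C hC0 hC using S.exists_sq_le_gradNormSq
  set M := 1 + ∑ i : (S.bdryᶜ : Set S.V), C i
  have hM : 0 < M := by
    have : 0 ≤ ∑ i : (S.bdryᶜ : Set S.V), C i := Finset.sum_nonneg fun i _ => hC0 _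
    positivity
  refine ⟨M⁻¹, inv_pos.2 hM, fun g => ?_⟩
  rw [inv_mul_le_iff₀ hM]
  have hg := gradNormSq_nonneg (TG.induce S.V) (S.glue g)
  have : ∑ i, g i ^ 2 ≤ (∑ i : (S.bdryᶜ : Set S.V), C i) *
      (1 + gradNormSq (TG.induce S.V) (S.glue g)) := by
    rw [Finset.sum_mul]
    refine Finset.sum_le_sum fun i _ => ?_
    have := hC i g
    rwa [S.glue_of_notMem_bdry g i.2] at this
  simp only [M]
  nlinarith

open Classical in
-- Coercivity dominates the weight by a product of Gaussians. This gives both finite total mass and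
-- finite second moments.
theorem integrable_weight_mul (v : TGVertex) :
    Integrable (fun g : (S.bdryᶜ : Set S.V) → ℝ => (1 + S.field v (S.glue g) ^ 2) *
      Real.exp (-(gradNormSq (TG.induce S.V) (S.glue g) / 2))) := by
  obtain ⟨κ, hκ, hco⟩ := S.exists_coercive
  have hfield : ∃ C : ℝ, 0 ≤ C ∧ ∀ g : (S.bdryᶜ : Set S.V) → ℝ,
      S.field v (S.glue g) ^ 2 ≤ C + ∑ i, g i ^ 2 := by
    have hs : ∀ g : (S.bdryᶜ : Set S.V) → ℝ, 0 ≤ ∑ i, g i ^ 2 := fun g =>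
      Finset.sum_nonneg fun i _ => sq_nonneg _
    by_cases hv : v ∈ S.V
    · by_cases hb : (⟨v, hv⟩ : S.V) ∈ S.bdry
      · refine ⟨S.graphBval ⟨_, hb⟩ ^ 2, sq_nonneg _, fun g => ?_⟩
        rw [S.field_of_mem hv, S.glue_of_mem_bdry g hb]
        linarith [hs g]
      · refine ⟨0, le_rfl, fun g => ?_⟩
        rw [S.field_of_mem hv, S.glue_of_notMem_bdry g hb, zero_add]
        exact Finset.single_le_sum (f := fun i => g i ^ 2) (fun i _ => sq_nonneg _)
          (Finset.mem_univ (⟨⟨v, hv⟩, hb⟩ : (S.bdryᶜ : Set S.V)))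
    · exact ⟨0, le_rfl, fun g => by rw [S.field_of_notMem hv]; simpa using hs g⟩
  obtain ⟨C, hC, hCg⟩ := hfield
  have hgauss : Integrable fun g : (S.bdryᶜ : Set S.V) → ℝ =>
      ∏ i, Real.exp (-(κ / 4) * g i ^ 2) :=
    Integrable.fintype_prod (f := fun _ x => Real.exp (-(κ / 4) * x ^ 2))
      fun i => integrable_exp_neg_mul_sq (by positivity)
  refine (hgauss.const_mul ((1 + C + 4 / κ) * Real.exp (1 / 2))).mono' ?_ ?_
  · have h1 := (S.measurable_field v).comp S.measurable_glue
    have h2 := (continuous_gradNormSq (TG.induce S.V)).measurable.comp S.measurable_glue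
    exact ((measurable_const.add (h1.pow_const 2)).mul
      (Real.measurable_exp.comp (h2.div_const 2).neg)).aestronglyMeasurable
  · filter_upwards with g
    have hs : 0 ≤ ∑ i, g i ^ 2 := Finset.sum_nonneg fun i _ => sq_nonneg _
    rw [Real.norm_of_nonneg (mul_nonneg (by positivity) (Real.exp_pos _).le), ← Real.exp_sum,
      ← Finset.mul_sum]
    set s := ∑ i, g i ^ 2
    have e1 : Real.exp (-(gradNormSq (TG.induce S.V) (S.glue g) / 2)) ≤
        Real.exp (1 / 2) * Real.exp (-(κ / 2) * s) := by
      rw [← Real.exp_add]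
      apply Real.exp_le_exp.2
      linarith [hco g]
    -- Half of the decay rate `κ / 2` is spent on absorbing the quadratic factor; the rate `κ / 4`
    -- remains.
    have e2 : 1 + S.field v (S.glue g) ^ 2 ≤ (1 + C + 4 / κ) * Real.exp (κ / 4 * s) := by
      have h1 := Real.add_one_le_exp (κ / 4 * s)
      have h2 : s = 4 / κ * (κ / 4 * s) := by field_simp
      have h3 := hCg g
      have h4 : 0 ≤ κ / 4 * s := by positivity
      have h5 : 0 < 4 / κ := by positivity
      have h6 := mul_le_mul_of_nonneg_left h1 (by positivity : 0 ≤ 1 + C + 4 / κ)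
      nlinarith [mul_nonneg hC h4]
    calc _ ≤ ((1 + C + 4 / κ) * Real.exp (κ / 4 * s)) *
          (Real.exp (1 / 2) * Real.exp (-(κ / 2) * s)) :=
          mul_le_mul e2 e1 (Real.exp_pos _).le (by positivity)
      _ = (1 + C + 4 / κ) * Real.exp (1 / 2) *
          (Real.exp (κ / 4 * s) * Real.exp (-(κ / 2) * s)) := by ring
      _ = _ := by
          rw [← Real.exp_add]
          congr 2
          ring

/-- The unnormalized law of the field. -/
noncomputable def rawLaw : Measure (S.V → ℝ) := dgffUnnormalized (TG.induce S.V) S.bdry S.graphBval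

open Classical in
theorem lintegral_rawLaw {F : (S.V → ℝ) → ENNReal} (hF : Measurable F) :
    ∫⁻ h, F h ∂S.rawLaw = ∫⁻ g, dgffWeight (TG.induce S.V) (S.glue g) * F (S.glue g) :=
  lintegral_dgffUnnormalized _ _ _ hF

theorem lintegral_rawLaw_field_lt_top (v : TGVertex) :
    ∫⁻ h, ENNReal.ofReal (1 + S.field v h ^ 2) ∂S.rawLaw < ⊤ := by
  classical
  rw [S.lintegral_rawLaw (by fun_prop)]
  refine lt_of_eq_of_lt (lintegral_congr fun g => ?_) (S.integrable_weight_mul v).lintegral_lt_top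
  rw [dgffWeight, ← ENNReal.ofReal_mul (Real.exp_pos _).le, mul_comm]

instance : IsFiniteMeasure S.rawLaw := ⟨by
  obtain ⟨v, -⟩ := S.plus_nonempty
  refine lt_of_le_of_lt ?_ (S.lintegral_rawLaw_field_lt_top v)
  rw [← lintegral_one]
  refine lintegral_mono fun h => ?_
  rw [← ENNReal.ofReal_one]
  exact ENNReal.ofReal_le_ofReal (by linarith [sq_nonneg (S.field v h)])⟩

/-- The event is open, the density is positive, and the signed vertices are inner, so no boundary
value obstructs a configuration with the prescribed signs. -/
theorem rawLaw_signEvent_ne_zero : S.rawLaw S.signEvent ≠ 0 := by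
  classical
  have hopen : IsOpen (S.glue ⁻¹' S.signEvent) :=
    S.isOpen_signEvent.preimage (continuous_glueBoundary _ _)
  have hne : (S.glue ⁻¹' S.signEvent).Nonempty := by
    refine ⟨fun i => if ((i : S.V) : TGVertex) ∈ S.Vplus then 1 else -1, ?_, ?_⟩
    · intro v hv
      rw [S.glue_of_notMem_bdry _ fun h => (S.mem_bdry_iff v).1 h (S.plus_subset v hv)]
      simp [hv]
    · intro v hv
      rw [S.glue_of_notMem_bdry _ fun h => (S.mem_bdry_iff v).1 h (S.minus_subset v hv)]
      have : (v : TGVertex) ∉ S.Vplus := fun h => Set.disjoint_left.1 S.disjoint h hv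
      simp [this]
  have hpos := (hopen.measure_pos volume hne).ne'
  intro h0
  apply hpos
  rw [rawLaw, dgffUnnormalized, Measure.map_apply (continuous_glueBoundary _ _).measurable
    S.isOpen_signEvent.measurableSet] at h0
  refine withDensity_absolutelyContinuous' ?_ ?_ h0
  · exact ((measurable_dgffWeight (TG.induce S.V)).comp S.measurable_glue).aemeasurable
  · filter_upwards with g
    simp [Real.exp_pos]

theorem freeLaw_eq : S.freeLaw = (S.rawLaw Set.univ)⁻¹ • S.rawLaw := rfl

theorem rawLaw_univ_ne_zero : S.rawLaw Set.univ ≠ 0 := fun h =>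
  S.rawLaw_signEvent_ne_zero (measure_mono_null (Set.subset_univ _) h)

theorem condLaw_eq : ∃ c : ENNReal, c ≠ ⊤ ∧ S.condLaw = c • S.rawLaw.restrict S.signEvent := by
  refine ⟨(S.freeLaw S.signEvent)⁻¹ * (S.rawLaw Set.univ)⁻¹, ?_, ?_⟩
  · refine ENNReal.mul_ne_top ?_ (ENNReal.inv_ne_top.2 S.rawLaw_univ_ne_zero)
    rw [ENNReal.inv_ne_top, freeLaw_eq, Measure.smul_apply, smul_eq_mul]
    exact mul_ne_zero (ENNReal.inv_ne_zero.2 (measure_ne_top _ _)) S.rawLaw_signEvent_ne_zero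
  · rw [condLaw, ProbabilityTheory.cond, mul_smul, S.freeLaw_eq, Measure.restrict_smul]

instance : IsProbabilityMeasure S.condLaw := by
  have : IsFiniteMeasure S.freeLaw := by
    rw [freeLaw_eq]
    exact Measure.smul_finite _ (ENNReal.inv_ne_top.2 S.rawLaw_univ_ne_zero)
  refine cond_isProbabilityMeasure ?_
  rw [freeLaw_eq, Measure.smul_apply, smul_eq_mul]
  exact mul_ne_zero (ENNReal.inv_ne_zero.2 (measure_ne_top _ _)) S.rawLaw_signEvent_ne_zero

theorem ae_mem_range : ∀ᵐ h ∂S.condLaw, ∀ v : S.V, h v ∈ S.range v := by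
  have h := ae_cond_mem (μ := S.freeLaw) S.isOpen_signEvent.measurableSet
  rw [S.signEvent_eq] at h
  change ∀ᵐ h ∂(ProbabilityTheory.cond S.freeLaw S.signEvent), _
  rw [S.signEvent_eq]
  exact h

theorem condLaw_absolutelyContinuous : S.condLaw ≪ S.rawLaw := by
  obtain ⟨c, -, hc⟩ := S.condLaw_eq
  rw [hc]
  exact (Measure.smul_absolutelyContinuous).trans Measure.restrict_le_self.absolutelyContinuous

theorem ae_eq_graphBval : ∀ᵐ h ∂S.condLaw, ∀ v : S.bdry, h v = S.graphBval v := by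
  refine S.condLaw_absolutelyContinuous.ae_le (ae_all_iff.2 fun v => ?_)
  rw [rawLaw, dgffUnnormalized, ae_map_iff (continuous_glueBoundary _ _).aemeasurable
    (measurableSet_eq_fun (measurable_pi_apply _) measurable_const)]
  filter_upwards with g
  exact S.glue_of_mem_bdry g v.2

theorem integrable_field_sq (v : TGVertex) : Integrable (fun h => S.field v h ^ 2) S.condLaw := by
  obtain ⟨c, hc, hc'⟩ := S.condLaw_eq
  rw [hc']
  refine Integrable.smul_measure ?_ hc
  refine Integrable.restrict ?_
  refine ⟨by fun_prop, ?_⟩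
  rw [hasFiniteIntegral_iff_ofReal (by filter_upwards with h using sq_nonneg _)]
  refine lt_of_le_of_lt (lintegral_mono fun h => ?_) (S.lintegral_rawLaw_field_lt_top v)
  exact ENNReal.ofReal_le_ofReal (by linarith)

theorem memLp_field (v : TGVertex) : MemLp (S.field v) 2 S.condLaw :=
  (memLp_two_iff_integrable_sq (S.measurable_field v).aestronglyMeasurable).2
    (S.integrable_field_sq v)

theorem update_mem_signEvent_iff {v : TGVertex} (hv : v ∈ S.V) (h : S.V → ℝ) (t : ℝ) :
    Function.update h ⟨v, hv⟩ t ∈ S.signEvent ↔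
      t ∈ S.range v ∧ ∀ w : S.V, (w : TGVertex) ≠ v → h w ∈ S.range w := by
  rw [signEvent_eq, Set.mem_ofPred_eq]
  constructor
  · intro hall
    refine ⟨by simpa using hall ⟨v, hv⟩, fun w hw => ?_⟩
    have := hall w
    rwa [Function.update_of_ne fun e => hw (congrArg Subtype.val e)] at this
  · rintro ⟨ht, hall⟩ w
    by_cases hw : w = ⟨v, hv⟩
    · subst hw; simpa using ht
    · rw [Function.update_of_ne hw]
      exact hall w fun e => hw (Subtype.ext e)

/-- Redrawing the value at an inner vertex, given the other values, preserves the law. -/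
theorem map_resample {v : TGVertex} (hv : TGpos v ∈ S.D) :
    (S.condLaw.prod unifLaw).map (S.resample v) = S.condLaw := by
  classical
  have hvV := S.mem_V_of_mem_D hv
  have hI := S.isSiteRange_range v
  refine Measure.ext_of_lintegral _ fun F hF => ?_
  rw [lintegral_map hF (S.measurable_resample v),
    lintegral_prod (fun p => F (S.resample v p)) (hF.comp (S.measurable_resample v)).aemeasurable]
  have hTmeas : Measurable fun h => ∫⁻ u, F (S.resample v (h, u)) ∂unifLaw :=
    (hF.comp (S.measurable_resample v)).lintegral_prod_right'
  obtain ⟨c, hc, hc'⟩ := S.condLaw_eq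
  rw [hc', lintegral_smul_measure, lintegral_smul_measure]
  congr 1
  have hK := S.isOpen_signEvent.measurableSet
  rw [← lintegral_indicator hK, ← lintegral_indicator hK,
    S.lintegral_rawLaw (hTmeas.indicator hK), S.lintegral_rawLaw (hF.indicator hK)]
  have hbv : (⟨v, hvV⟩ : S.V) ∉ S.bdry := fun h => (S.mem_bdry_iff _).1 h hv
  set i : (S.bdryᶜ : Set S.V) := ⟨⟨v, hvV⟩, hbv⟩
  have hmw := (measurable_dgffWeight (TG.induce S.V)).comp S.measurable_glue
  rw [volume_pi]
  -- It suffices to integrate over the coordinate at `v` alone. There the density is a constant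
  -- times `siteWeight m t`, and the resampled value does not depend on the old one.
  refine lintegral_eq_of_lmarginal_eq {i}
    (hmw.mul ((hTmeas.indicator hK).comp S.measurable_glue))
    (hmw.mul ((hF.indicator hK).comp S.measurable_glue)) ?_
  rw [lmarginal_singleton, lmarginal_singleton]
  funext g
  have hup : ∀ t, S.glue (Function.update g i t) = Function.update (S.glue g) ⟨v, hvV⟩ t := fun t =>
    glueBoundary_update _ _ _ _ _
  simp only [hup]
  set h := S.glue g
  set m := S.nbrMean v h
  set w0 := dgffWeight (TG.induce S.V) (Function.update h ⟨v, hvV⟩ 0)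
  have hres : ∀ t u, S.resample v (Function.update h ⟨v, hvV⟩ t, u) =
      Function.update h ⟨v, hvV⟩ (siteQuantile (S.range v) m u) := by
    intro t u
    rw [resample, dif_pos hvV, S.nbrMean_update hvV, Function.update_idem]
  -- If a sign constraint away from `v` fails, both integrands vanish for every value at `v`.
  by_cases hother : ∀ w : S.V, (w : TGVertex) ≠ v → h w ∈ S.range w
  swap
  · have : ∀ t, Function.update h ⟨v, hvV⟩ t ∉ S.signEvent := fun t ht =>
      hother ((S.update_mem_signEvent_iff hvV h t).1 ht).2
    simp only [Set.indicator_of_notMem (this _)]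
  have hmem : ∀ t, Function.update h ⟨v, hvV⟩ t ∈ S.signEvent ↔ t ∈ S.range v := fun t => by
    rw [S.update_mem_signEvent_iff hvV]; exact and_iff_left hother
  have hind : ∀ (f : (S.V → ℝ) → ENNReal) (t : ℝ),
      dgffWeight (TG.induce S.V) (Function.update h ⟨v, hvV⟩ t) *
        S.signEvent.indicator f (Function.update h ⟨v, hvV⟩ t) =
      (S.range v).indicator (fun t => w0 * (ENNReal.ofReal (siteWeight m t) *
        f (Function.update h ⟨v, hvV⟩ t))) t := by
    intro f t
    rw [S.dgffWeight_update hv]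
    by_cases ht : t ∈ S.range v
    · rw [Set.indicator_of_mem ht, Set.indicator_of_mem ((hmem t).2 ht), mul_assoc]
    · rw [Set.indicator_of_notMem ht, Set.indicator_of_notMem fun e => ht ((hmem t).1 e), mul_zero]
  simp only [hind, hres]
  rw [lintegral_indicator hI.measurableSet, lintegral_indicator hI.measurableSet]
  have hupm : Measurable fun t : ℝ => Function.update h ⟨v, hvV⟩ t := measurable_update h
  have hwm : Measurable fun t => ENNReal.ofReal (siteWeight m t) :=
    (continuous_siteWeight_right m).measurable.ennreal_ofReal
  have hFh : Measurable fun t => F (Function.update h ⟨v, hvV⟩ t) := hF.comp hupm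
  have hprod : Measurable fun t =>
      ENNReal.ofReal (siteWeight m t) * F (Function.update h ⟨v, hvV⟩ t) := hwm.mul hFh
  have hlaw : ∫⁻ u, F (Function.update h ⟨v, hvV⟩ (siteQuantile (S.range v) m u)) ∂unifLaw =
      (ENNReal.ofReal (sitePart (S.range v) m))⁻¹ * ∫⁻ t in S.range v,
        ENNReal.ofReal (siteWeight m t) * F (Function.update h ⟨v, hvV⟩ t) := by
    rw [← lintegral_map (f := fun t => F (Function.update h ⟨v, hvV⟩ t)) hFh
      (measurable_siteQuantile_right _ m), map_siteQuantile hI, siteLaw,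
      ← lintegral_const_mul _ hprod]
    refine (lintegral_withDensity_eq_lintegral_mul _ (measurable_siteDensity _ m) hFh).trans ?_
    refine lintegral_congr fun t => ?_
    rw [Pi.mul_apply, ENNReal.ofReal_div_of_pos (sitePart_pos hI m), ENNReal.div_eq_inv_mul,
      mul_assoc]
  rw [hlaw, lintegral_const_mul _ (hwm.mul_const _), lintegral_mul_const _ hwm,
    lintegral_const_mul _ hprod,
    ← ofReal_integral_eq_lintegral_ofReal (integrable_siteWeight m).integrableOn
      (by filter_upwards with t using (siteWeight_pos m t).le)]
  change w0 * (ENNReal.ofReal (sitePart (S.range v) m) * _) = _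
  rw [← mul_assoc (ENNReal.ofReal _), ENNReal.mul_inv_cancel
    (by simpa using sitePart_pos hI m) ENNReal.ofReal_ne_top, one_mul]

end SignedSystem

/-! ## Second moments of the conditioned field -/

namespace SignedSystem

variable (S : SignedSystem)

theorem integral_resample {v : TGVertex} (hv : TGpos v ∈ S.D) {g : (S.V → ℝ) → ℝ}
    (hg : Integrable g S.condLaw) (hgm : Measurable g) :
    Integrable (fun p => g (S.resample v p)) (S.condLaw.prod unifLaw) ∧
      ∫ h, g h ∂S.condLaw = ∫ h, ∫ u, g (S.resample v (h, u)) ∂unifLaw ∂S.condLaw := by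
  have h1 : Integrable (fun p => g (S.resample v p)) (S.condLaw.prod unifLaw) := by
    rw [← S.map_resample hv] at hg
    exact (integrable_map_measure hgm.aestronglyMeasurable
      (S.measurable_resample v).aemeasurable).1 hg
  refine ⟨h1, ?_⟩
  conv_lhs => rw [← S.map_resample hv]
  rw [integral_map (S.measurable_resample v).aemeasurable hgm.aestronglyMeasurable,
    integral_prod _ h1]

theorem integrable_field_mul (v w : TGVertex) :
    Integrable (fun h => S.field v h * S.field w h) S.condLaw :=
  (S.memLp_field v).integrable_mul (S.memLp_field w)

theorem memLp_nbrMean (v : TGVertex) : MemLp (S.nbrMean v) 2 S.condLaw := by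
  have h := (memLp_finsetSum TGdirs fun d _ => S.memLp_field (v + d)).const_mul (6⁻¹ : ℝ)
  refine h.congr_norm (S.measurable_nbrMean v).aestronglyMeasurable ?_
  filter_upwards with x
  simp [nbrMean, div_eq_inv_mul]

theorem siteMean_univ (m : ℝ) : siteMean Set.univ m = m := by
  have := siteGap_univ m
  rw [siteGap] at this
  linarith

theorem integral_field_mul_of_ne {v w : TGVertex} (hv : TGpos v ∈ S.D)
    (hr : S.range v = Set.univ) (hw : w ≠ v) :
    ∫ h, S.field v h * S.field w h ∂S.condLaw =
      ∫ h, S.nbrMean v h * S.field w h ∂S.condLaw := by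
  rw [(S.integral_resample hv (S.integrable_field_mul v w)
    ((S.measurable_field v).mul (S.measurable_field w))).2]
  refine integral_congr_ae ?_
  filter_upwards with h
  simp only [S.field_resample_self (S.mem_V_of_mem_D hv), S.field_resample_of_ne hw]
  rw [integral_mul_const, hr]
  congr 1
  exact siteMean_univ _

theorem integral_field_sq {v : TGVertex} (hv : TGpos v ∈ S.D) :
    Integrable (fun h => S.nbrMean v h * siteMean (S.range v) (S.nbrMean v h)) S.condLaw ∧
    ∫ h, S.field v h ^ 2 ∂S.condLaw =
      ∫ h, S.nbrMean v h * siteMean (S.range v) (S.nbrMean v h) ∂S.condLaw + 1 / 6 := by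
  obtain ⟨h1, h2⟩ := S.integral_resample hv (S.integrable_field_sq v)
    ((S.measurable_field v).pow_const 2)
  have h3 : ∀ h, ∫ u, S.field v (S.resample v (h, u)) ^ 2 ∂unifLaw =
      S.nbrMean v h * siteMean (S.range v) (S.nbrMean v h) + 1 / 6 := by
    intro h
    simp only [S.field_resample_self (S.mem_V_of_mem_D hv)]
    exact integral_siteQuantile_sq (S.isSiteRange_range v) _
  have h4 := h1.integral_prod_left
  simp only [h3] at h2 h4
  have h5 : Integrable (fun h => S.nbrMean v h * siteMean (S.range v) (S.nbrMean v h))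
      S.condLaw := by
    refine (h4.sub (integrable_const (1 / 6 : ℝ))).congr ?_
    filter_upwards with h
    simp
  refine ⟨h5, ?_⟩
  rw [h2, integral_add h5 (integrable_const _)]
  simp

/-- The second-moment kernel of the field. -/
noncomputable def moment (x y : TGVertex) : ℝ := ∫ h, S.field x h * S.field y h ∂S.condLaw

/-! ### Green function identities and the deviation from the harmonic extension -/

theorem sum_moment (v y : TGVertex) : ∑ d ∈ TGdirs, S.moment (v + d) y =
    6 * ∫ h, S.nbrMean v h * S.field y h ∂S.condLaw := by
  simp only [moment]
  rw [← integral_finsetSum _ fun d _ => S.integrable_field_mul _ _, ← integral_const_mul]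
  refine integral_congr_ae ?_
  filter_upwards with h
  rw [← Finset.sum_mul, nbrMean]
  ring

/-- Resampling a free site replaces it by the mean of its neighbors plus independent noise of
variance `1/6`. Off the diagonal the moments are thus harmonic, and on it the noise, times the
degree `6`, is a unit source. -/
theorem TGlap_moment {v : TGVertex} (hv : TGpos v ∈ S.D) (hr : S.range v = Set.univ)
    (y : TGVertex) : TGlap (fun x => S.moment x y) v = if v = y then -1 else 0 := by
  have hne : ∀ w, w ≠ v → ∑ d ∈ TGdirs, S.moment (v + d) w = 6 * S.moment v w := by
    intro w hw
    rw [S.sum_moment, moment, S.integral_field_mul_of_ne hv hr hw]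
  rw [TGlap_eq]
  by_cases hy : v = y
  · subst hy
    rw [if_pos rfl]
    have h1 : S.moment v v = ∫ h, S.nbrMean v h * S.nbrMean v h ∂S.condLaw + 1 / 6 := by
      have := (S.integral_field_sq hv).2
      simp only [hr, siteMean_univ] at this
      rw [← this, moment]
      simp only [sq]
    have h2 : ∑ d ∈ TGdirs, S.moment (v + d) v =
        6 * ∫ h, S.nbrMean v h * S.nbrMean v h ∂S.condLaw := by
      have h3 : ∀ d ∈ TGdirs, S.moment (v + d) v =
          ∫ h, S.nbrMean v h * S.field (v + d) h ∂S.condLaw := by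
        intro d hd
        rw [← S.integral_field_mul_of_ne hv hr (add_ne_self hd), moment]
        simp only [mul_comm]
      have hi : ∀ d, Integrable (fun h => S.nbrMean v h * S.field (v + d) h) S.condLaw :=
        fun d => (S.memLp_nbrMean v).integrable_mul (S.memLp_field _)
      rw [Finset.sum_congr rfl h3, ← integral_finsetSum _ fun d _ => hi d, ← integral_const_mul]
      refine integral_congr_ae ?_
      filter_upwards with h
      rw [← Finset.mul_sum, nbrMean]
      ring
    rw [h1, h2]; ring
  · rw [if_neg hy, hne y (fun h => hy h.symm), sub_self]

open Classical in
/-- The inner vertices without sign constraint. -/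
noncomputable def freeSites : Finset TGVertex :=
  (TGvertices_finite S.isTGRegion.isBounded).toFinset.filter
    fun v => TGpos v ∈ S.D ∧ S.range v = Set.univ

open Classical in
/-- The vertices of the boundary and those with a sign constraint. -/
noncomputable def pinnedSites : Finset TGVertex :=
  (TGvertices_finite S.isTGRegion.isBounded).toFinset \ S.freeSites

theorem mem_freeSites {v : TGVertex} :
    v ∈ S.freeSites ↔ TGpos v ∈ S.D ∧ S.range v = Set.univ := by
  simp only [freeSites, Finset.mem_filter, Set.Finite.mem_toFinset]
  exact and_iff_right_of_imp fun h => S.mem_V_of_mem_D h.1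

theorem mem_pinnedSites {v : TGVertex} : v ∈ S.pinnedSites ↔ v ∈ S.V ∧ v ∉ S.freeSites := by
  simp only [pinnedSites, Finset.mem_sdiff, Set.Finite.mem_toFinset]
  exact Iff.rfl

/-- The harmonic extension of the pinned values of `f`. -/
noncomputable def pinnedMean (f : TGVertex → ℝ) (z : TGVertex) : ℝ :=
  ∑ u ∈ S.pinnedSites, harmonicKernel S.freeSites z u * f u

theorem pinnedMean_of_notMem (f : TGVertex → ℝ) {z : TGVertex} (hz : z ∉ S.freeSites) :
    S.pinnedMean f z = if z ∈ S.pinnedSites then f z else 0 := by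
  simp_rw [pinnedMean, harmonicKernel_of_notMem hz, ite_mul, one_mul, zero_mul]
  rw [Finset.sum_ite_eq]

theorem TGlap_pinnedMean (f : TGVertex → ℝ) {z : TGVertex} (hz : z ∈ S.freeSites) :
    TGlap (S.pinnedMean f) z = 0 := by
  unfold pinnedMean
  rw [TGlap_sum]
  refine Finset.sum_eq_zero fun u _ => ?_
  rw [TGlap_mul_const, TGlap_harmonicKernel hz, zero_mul]

theorem pinnedMean_sq_le (f : TGVertex → ℝ) (z : TGVertex) :
    S.pinnedMean f z ^ 2 ≤ S.pinnedMean (fun u => f u ^ 2) z := by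
  have h := Finset.sum_sq_le_sum_mul_sum_of_sq_le_mul S.pinnedSites
    (r := fun u => harmonicKernel S.freeSites z u * f u)
    (f := fun u => harmonicKernel S.freeSites z u)
    (g := fun u => harmonicKernel S.freeSites z u * f u ^ 2)
    (fun u _ => harmonicKernel_nonneg _ _ _)
    (fun u _ => mul_nonneg (harmonicKernel_nonneg _ _ _) (sq_nonneg _))
    (fun u _ => le_of_eq (by ring))
  refine h.trans ?_
  refine mul_le_of_le_one_left (Finset.sum_nonneg fun u _ =>
    mul_nonneg (harmonicKernel_nonneg _ _ _) (sq_nonneg _)) ?_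
  exact sum_harmonicKernel_le_one _ _ _

theorem pinnedMean_le {f : TGVertex → ℝ} {M : ℝ} (hM : 0 ≤ M) (h : ∀ u ∈ S.pinnedSites, f u ≤ M)
    (z : TGVertex) : S.pinnedMean f z ≤ M := by
  calc S.pinnedMean f z ≤ ∑ u ∈ S.pinnedSites, harmonicKernel S.freeSites z u * M :=
        Finset.sum_le_sum fun u hu => mul_le_mul_of_nonneg_left (h u hu) (harmonicKernel_nonneg _ _ _)
    _ ≤ 1 * M := by
        rw [← Finset.sum_mul]
        exact mul_le_mul_of_nonneg_right (sum_harmonicKernel_le_one _ _ _) hM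
    _ = M := one_mul M

/-- The deviation of the field from the harmonic extension of its pinned values. -/
noncomputable def deviation (z : TGVertex) (h : S.V → ℝ) : ℝ :=
  S.field z h - S.pinnedMean (fun u => S.field u h) z

theorem deviation_of_notMem {z : TGVertex} (hz : z ∉ S.freeSites) (h : S.V → ℝ) :
    S.deviation z h = 0 := by
  rw [deviation, S.pinnedMean_of_notMem _ hz]
  split_ifs with hp
  · exact sub_self _
  · have : z ∉ S.V := fun hzV => hp (S.mem_pinnedSites.2 ⟨hzV, hz⟩)
    rw [S.field_of_notMem this, sub_zero]

theorem memLp_deviation (z : TGVertex) : MemLp (S.deviation z) 2 S.condLaw :=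
  (S.memLp_field z).sub (memLp_finsetSum _ fun u _ => (S.memLp_field u).const_mul _)

theorem integral_mul_deviation (x w : TGVertex) :
    ∫ h, S.field x h * S.deviation w h ∂S.condLaw =
      S.moment w x - S.pinnedMean (fun u => S.moment u x) w := by
  simp only [deviation, pinnedMean, mul_sub, Finset.mul_sum]
  rw [integral_sub (S.integrable_field_mul _ _) (integrable_finsetSum _ fun u _ => by
    refine ((S.integrable_field_mul x u).const_mul
      (harmonicKernel S.freeSites w u)).congr ?_
    filter_upwards with h using by ring)]
  rw [integral_finsetSum _ fun u _ => by
    refine ((S.integrable_field_mul x u).const_mul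
      (harmonicKernel S.freeSites w u)).congr ?_
    filter_upwards with h using by ring]
  congr 1
  · simp only [moment, mul_comm]
  · refine Finset.sum_congr rfl fun u _ => ?_
    rw [moment, ← integral_const_mul]
    refine integral_congr_ae ?_
    filter_upwards with h
    ring

/-- As functions of `w`, the moments with `u` and the harmonic extension of their pinned values are
both harmonic at the free sites and agree elsewhere, so they coincide. The pinned values need not be
Gaussian. -/
theorem integral_pinned_mul_deviation {u : TGVertex} (hu : u ∉ S.freeSites) (w : TGVertex) :
    ∫ h, S.field u h * S.deviation w h ∂S.condLaw = 0 := by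
  rw [S.integral_mul_deviation]
  refine eq_zero_of_TGlap_eq_zero S.freeSites
    (fun w => S.moment w u - S.pinnedMean (fun u' => S.moment u' u) w) (fun x hx => ?_)
    (fun x hx => ?_) w
  · rw [← S.integral_mul_deviation]
    simp [S.deviation_of_notMem hx]
  · rw [TGlap_sub, S.TGlap_pinnedMean _ hx, S.TGlap_moment (S.mem_freeSites.1 hx).1
      (S.mem_freeSites.1 hx).2, if_neg (fun h => hu (by rwa [h] at hx)), sub_zero]

theorem moment_comm (x y : TGVertex) : S.moment x y = S.moment y x := by
  simp only [moment, mul_comm]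

/-- The second moment of the deviation is bounded by the resistance to a pinned vertex. -/
theorem integral_deviation_sq_le {w y : TGVertex} {ρ : ℝ} (hρ0 : 0 ≤ ρ) (hy : y ∉ S.freeSites)
    (hρ : ∀ φ : TGVertex → ℝ, φ.support.Finite → (φ w - φ y) ^ 2 ≤ ρ * TGenergy φ) :
    ∫ h, S.deviation w h ^ 2 ∂S.condLaw ≤ 2 * ρ := by
  by_cases hw : w ∈ S.freeSites
  swap
  · simp only [S.deviation_of_notMem hw]
    simpa using hρ0
  -- This is the Green function of the free sites with pole `w`: zero off the free sites, with
  -- Laplacian `-1` at `w` and `0` at the other free sites. Its value at `w` is the second moment in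
  -- question and half its energy, so the resistance bound reads `c(w)² ≤ 2 ρ c(w)`.
  set c : TGVertex → ℝ := fun x => ∫ h, S.field x h * S.deviation w h ∂S.condLaw with hc
  have hc0 : ∀ x ∉ S.freeSites, c x = 0 := fun x hx => S.integral_pinned_mul_deviation hx w
  have hsupp : c.support.Finite := S.freeSites.finite_toSet.subset fun x hx => by
    by_contra h
    exact hx (hc0 x h)
  have hlap : ∀ x ∈ S.freeSites, TGlap c x = if x = w then -1 else 0 := by
    intro x hx
    obtain ⟨h1, h2⟩ := S.mem_freeSites.1 hx
    have h3 : c = fun x => S.moment x w - ∑ u ∈ S.pinnedSites,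
        S.moment x u * harmonicKernel S.freeSites w u := by
      funext x
      simp only [hc]
      rw [S.integral_mul_deviation, S.moment_comm, pinnedMean]
      congr 1
      refine Finset.sum_congr rfl fun u _ => ?_
      rw [S.moment_comm, mul_comm]
    rw [h3, TGlap_sub, TGlap_sum, S.TGlap_moment h1 h2]
    rw [Finset.sum_eq_zero, sub_zero]
    intro u hu
    rw [TGlap_mul_const, S.TGlap_moment h1 h2, if_neg, zero_mul]
    rintro rfl
    exact (S.mem_pinnedSites.1 hu).2 hx
  have hE : TGenergy c = 2 * c w := by
    rw [TGenergy_eq hsupp, tsum_eq_single w]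
    · rw [hlap w hw, if_pos rfl]; ring
    · intro x hx
      by_cases hxf : x ∈ S.freeSites
      · rw [hlap x hxf, if_neg hx, mul_zero]
      · rw [hc0 x hxf, zero_mul]
  have hcw : ∫ h, S.deviation w h ^ 2 ∂S.condLaw = c w := by
    have i1 : ∀ x, Integrable (fun h => S.field x h * S.deviation w h) S.condLaw := fun x =>
      (S.memLp_field x).integrable_mul (S.memLp_deviation w)
    have h1 : ∀ h, S.deviation w h ^ 2 = S.field w h * S.deviation w h -
        ∑ u ∈ S.pinnedSites, harmonicKernel S.freeSites w u *
          (S.field u h * S.deviation w h) := by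
      intro h
      have : ∑ u ∈ S.pinnedSites, harmonicKernel S.freeSites w u *
          (S.field u h * S.deviation w h) =
          S.pinnedMean (fun u => S.field u h) w * S.deviation w h := by
        rw [pinnedMean, Finset.sum_mul]
        exact Finset.sum_congr rfl fun u _ => by ring
      rw [this, sq]
      nth_rw 1 [deviation]
      ring
    simp only [h1]
    rw [integral_sub (i1 w) (integrable_finsetSum _ fun u _ => (i1 u).const_mul _),
      integral_finsetSum _ fun u _ => (i1 u).const_mul _, Finset.sum_eq_zero, sub_zero]
    intro u hu
    rw [integral_const_mul, S.integral_pinned_mul_deviation (S.mem_pinnedSites.1 hu).2, mul_zero]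
  rw [hcw]
  have hnn : 0 ≤ c w := by rw [← hcw]; exact integral_nonneg fun h => sq_nonneg _
  have h := hρ c hsupp
  rw [hc0 y hy, sub_zero, hE] at h
  rcases hnn.eq_or_lt with h0 | h0
  · rw [← h0]; positivity
  · nlinarith

/-- The single edge to the pinned vertex already bounds the resistance by `1`. -/
theorem integral_deviation_sq_le_two {v d : TGVertex} (hv : v ∉ S.freeSites) (hd : d ∈ TGdirs) :
    ∫ h, S.deviation (v + d) h ^ 2 ∂S.condLaw ≤ 2 := by
  have := S.integral_deviation_sq_le (w := v + d) (ρ := 1) zero_le_one hv fun φ hφ => by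
    rw [one_mul]
    exact (sq_le_localEnergy φ v hd).trans (localEnergy_le_TGenergy hφ v)
  simpa using this

/-- Second moments of the field in terms of those of the pinned values. -/
theorem integral_field_sq_le {w : TGVertex} {M ρ : ℝ} (hM0 : 0 ≤ M)
    (hM : ∀ u ∈ S.pinnedSites, ∫ h, S.field u h ^ 2 ∂S.condLaw ≤ M)
    (hρ : ∫ h, S.deviation w h ^ 2 ∂S.condLaw ≤ ρ) :
    ∫ h, S.field w h ^ 2 ∂S.condLaw ≤ 2 * ρ + 2 * M := by
  have i1 := (S.memLp_deviation w).integrable_sq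
  have i2 : Integrable (fun h => S.pinnedMean (fun u => S.field u h ^ 2) w) S.condLaw :=
    integrable_finsetSum _ fun u _ => (S.integrable_field_sq u).const_mul _
  calc ∫ h, S.field w h ^ 2 ∂S.condLaw
      ≤ ∫ h, (2 * S.deviation w h ^ 2 + 2 * S.pinnedMean (fun u => S.field u h ^ 2) w)
          ∂S.condLaw := by
        refine integral_mono (S.integrable_field_sq w) ((i1.const_mul 2).add (i2.const_mul 2))
          fun h => ?_
        have h1 := S.pinnedMean_sq_le (fun u => S.field u h) w
        have h2 : S.field w h = S.deviation w h + S.pinnedMean (fun u => S.field u h) w := by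
          rw [deviation]; ring
        simp only
        rw [h2]
        nlinarith [sq_nonneg (S.deviation w h - S.pinnedMean (fun u => S.field u h) w)]
    _ = 2 * ∫ h, S.deviation w h ^ 2 ∂S.condLaw +
          2 * S.pinnedMean (fun u => ∫ h, S.field u h ^ 2 ∂S.condLaw) w := by
        rw [integral_add (i1.const_mul 2) (i2.const_mul 2), integral_const_mul, integral_const_mul]
        congr 2
        simp only [pinnedMean]
        rw [integral_finsetSum _ fun u _ => (S.integrable_field_sq u).const_mul _]
        simp only [integral_const_mul]
    _ ≤ _ := by
        have := S.pinnedMean_le hM0 hM w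
        linarith

/-- The bound for the second moment at a vertex with a sign constraint. -/
theorem integral_signed_sq_le {v d₀ : TGVertex} {s M L : ℝ} (hv : TGpos v ∈ S.D)
    (hvf : v ∉ S.freeSites) (hd₀ : d₀ ∈ TGdirs) (hs : s = 1 ∨ s = -1) (hM0 : 0 ≤ M)
    (hle : ∀ m, m * siteMean (S.range v) m ≤ max (s * m) 0 ^ 2 + siteOvershoot * max (s * m) 0)
    (hM : ∀ u ∈ S.pinnedSites, ∫ h, S.field u h ^ 2 ∂S.condLaw ≤ M)
    (hnbr : ∀ᵐ h ∂S.condLaw, max (s * S.field (v + d₀) h) 0 ≤ L) :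
    ∫ h, S.field v h ^ 2 ∂S.condLaw ≤ 0.92 * M + (37 + L ^ 2 + 5 * siteOvershoot ^ 2) := by
  have hs2 : ∀ x : ℝ, (s * x) ^ 2 = x ^ 2 := fun x => by
    rcases hs with rfl | rfl <;> ring
  have hmaxsq : ∀ x : ℝ, max (s * x) 0 ^ 2 ≤ x ^ 2 := fun x => by
    rcases le_total (s * x) 0 with h | h
    · rw [max_eq_right h]; nlinarith [sq_nonneg x]
    · rw [max_eq_left h, hs2]
  have hmeas : ∀ f : (S.V → ℝ) → ℝ, Measurable f → Measurable fun h => max (s * f h) 0 :=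
    fun f hf => (hf.const_mul s).max measurable_const
  have hint : ∀ z, Integrable (fun h => max (s * S.field z h) 0 ^ 2) S.condLaw := fun z => by
    refine (S.integrable_field_sq z).mono'
      ((hmeas _ (S.measurable_field z)).pow_const 2).aestronglyMeasurable ?_
    filter_upwards with h
    rw [Real.norm_of_nonneg (sq_nonneg _)]
    exact hmaxsq _
  -- The split is `(a + b)² ≤ 21 a² + 1.05 b²`: the coefficient of `M` must stay close to `1`, while
  -- the deviation, of second moment at most `2`, may carry a large constant.
  have hnb : ∀ d ∈ TGdirs, ∫ h, max (s * S.field (v + d) h) 0 ^ 2 ∂S.condLaw ≤ 1.05 * M + 42 := by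
    intro d hd
    have i1 := (S.memLp_deviation (v + d)).integrable_sq
    have i2 : Integrable (fun h => S.pinnedMean (fun u => S.field u h ^ 2) (v + d)) S.condLaw :=
      integrable_finsetSum _ fun u _ => (S.integrable_field_sq u).const_mul _
    calc ∫ h, max (s * S.field (v + d) h) 0 ^ 2 ∂S.condLaw
        ≤ ∫ h, (21 * S.deviation (v + d) h ^ 2 +
            1.05 * S.pinnedMean (fun u => S.field u h ^ 2) (v + d)) ∂S.condLaw := by
          refine integral_mono (hint _) ((i1.const_mul 21).add (i2.const_mul 1.05)) fun h => ?_
          have h1 := S.pinnedMean_sq_le (fun u => S.field u h) (v + d)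
          have h2 : S.field (v + d) h =
              S.deviation (v + d) h + S.pinnedMean (fun u => S.field u h) (v + d) := by
            rw [deviation]; ring
          refine (hmaxsq _).trans ?_
          rw [h2]
          nlinarith [sq_nonneg (20 * S.deviation (v + d) h -
            S.pinnedMean (fun u => S.field u h) (v + d))]
      _ = 21 * ∫ h, S.deviation (v + d) h ^ 2 ∂S.condLaw +
            1.05 * S.pinnedMean (fun u => ∫ h, S.field u h ^ 2 ∂S.condLaw) (v + d) := by
          rw [integral_add (i1.const_mul 21) (i2.const_mul 1.05), integral_const_mul,
            integral_const_mul]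
          congr 2
          simp only [pinnedMean]
          rw [integral_finsetSum _ fun u _ => (S.integrable_field_sq u).const_mul _]
          simp only [integral_const_mul]
      _ ≤ _ := by
          have h1 := S.pinnedMean_le hM0 hM (v + d)
          have h2 := S.integral_deviation_sq_le_two hvf hd
          linarith
  -- This neighbor contributes no multiple of `M`. The resulting loss of one sixth makes the final
  -- coefficient of `M` smaller than one.
  have hn0 : ∫ h, max (s * S.field (v + d₀) h) 0 ^ 2 ∂S.condLaw ≤ L ^ 2 := by
    calc _ ≤ ∫ _, L ^ 2 ∂S.condLaw := by
          refine integral_mono_ae (hint _) (integrable_const _) ?_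
          filter_upwards [hnbr] with h hh
          exact pow_le_pow_left₀ (le_max_right _ _) hh 2
      _ = L ^ 2 := by simp
  have hm : ∀ h, max (s * S.nbrMean v h) 0 ^ 2 ≤
      (∑ d ∈ TGdirs, max (s * S.field (v + d) h) 0 ^ 2) / 6 := by
    intro h
    have h1 : max (s * S.nbrMean v h) 0 ≤ (∑ d ∈ TGdirs, max (s * S.field (v + d) h) 0) / 6 := by
      refine max_le ?_ (div_nonneg (Finset.sum_nonneg fun d _ => le_max_right _ _) (by norm_num))
      rw [nbrMean, ← mul_div_assoc, Finset.mul_sum]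
      gcongr with d hd
      exact le_max_left _ _
    have h2 := sq_sum_le_card_mul_sum_sq (s := TGdirs)
      (f := fun d => max (s * S.field (v + d) h) 0)
    rw [TGdirs_card] at h2
    push_cast at h2
    have h3 := pow_le_pow_left₀ (le_max_right _ _) h1 2
    rw [div_pow] at h3
    linarith
  have him : Integrable (fun h => max (s * S.nbrMean v h) 0 ^ 2) S.condLaw := by
    refine (S.memLp_nbrMean v).integrable_sq.mono'
      ((hmeas _ (S.measurable_nbrMean v)).pow_const 2).aestronglyMeasurable ?_
    filter_upwards with h
    rw [Real.norm_of_nonneg (sq_nonneg _)]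
    exact hmaxsq _
  have hm2 : ∫ h, max (s * S.nbrMean v h) 0 ^ 2 ∂S.condLaw ≤
      (5 * (1.05 * M + 42) + L ^ 2) / 6 := by
    calc _ ≤ ∫ h, (∑ d ∈ TGdirs, max (s * S.field (v + d) h) 0 ^ 2) / 6 ∂S.condLaw :=
          integral_mono him ((integrable_finsetSum _ fun d _ => hint _).div_const 6) hm
      _ = (∑ d ∈ TGdirs, ∫ h, max (s * S.field (v + d) h) 0 ^ 2 ∂S.condLaw) / 6 := by
          rw [integral_div, integral_finsetSum _ fun d _ => hint _]
      _ ≤ _ := by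
          rw [← Finset.add_sum_erase _ _ hd₀]
          have h1 : ∑ d ∈ TGdirs.erase d₀, ∫ h, max (s * S.field (v + d) h) 0 ^ 2 ∂S.condLaw ≤
              ∑ _d ∈ TGdirs.erase d₀, (1.05 * M + 42) :=
            Finset.sum_le_sum fun d hd => hnb d (Finset.mem_of_mem_erase hd)
          rw [Finset.sum_const, Finset.card_erase_of_mem hd₀, TGdirs_card, nsmul_eq_mul] at h1
          push_cast at h1
          refine div_le_div_of_nonneg_right ?_ (by norm_num)
          linarith
  obtain ⟨i3, h3⟩ := S.integral_field_sq hv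
  rw [h3]
  -- With `x` the positive part and `o` the overshoot constant, `x² + o x ≤ 1.05 x² + 5 o²`, because
  -- the difference is `0.05 (x - 10 o)²`.
  have h4 : ∫ h, S.nbrMean v h * siteMean (S.range v) (S.nbrMean v h) ∂S.condLaw ≤
      ∫ h, (1.05 * max (s * S.nbrMean v h) 0 ^ 2 + 5 * siteOvershoot ^ 2) ∂S.condLaw := by
    refine integral_mono i3 ((him.const_mul 1.05).add (integrable_const _)) fun h => ?_
    refine (hle _).trans ?_
    nlinarith [sq_nonneg (max (s * S.nbrMean v h) 0 - 10 * siteOvershoot)]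
  rw [integral_add (him.const_mul 1.05) (integrable_const _), integral_const_mul] at h4
  simp only [integral_const, probReal_univ, one_smul] at h4
  -- The coefficient of `M` is `1.05² * 5 / 6 < 0.92`, and the numerical constant is `1.05 * 5 * 42
  -- / 6 + 1 / 6 < 37`.
  nlinarith [sq_nonneg L, sq_nonneg siteOvershoot]

theorem field_bdry_abs_le {L : ℝ} (hL : S.BoundaryBoundedBy L) :
    ∀ᵐ h ∂S.condLaw, ∀ v, TGpos v ∈ frontier S.D → |S.field v h| ≤ L := by
  filter_upwards [S.ae_eq_graphBval] with h hh v hv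
  have hvV : v ∈ S.V := frontier_subset_closure hv
  rw [S.field_of_mem hvV, hh ⟨⟨v, hvV⟩, hv⟩]
  exact hL _

/-- A bound for the second moments on the boundary and at the vertices with a sign constraint. -/
noncomputable def _root_.pinnedSqBound (L : ℝ) : ℝ := 13 * (37 + L ^ 2 + 5 * siteOvershoot ^ 2)

/-- At a pinned vertex with the largest second moment `M`, either the value is a boundary value, or
the vertex is signed. A signed vertex has a neighbor of opposite sign or on the boundary, and then
`M ≤ 0.92 M + C`. The factor `13` in the bound exceeds `1 / 0.08`. -/
theorem integral_pinned_sq_le {L : ℝ} (hL0 : 0 ≤ L) (hL : S.BoundaryBoundedBy L) :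
    ∀ u ∈ S.pinnedSites, ∫ h, S.field u h ^ 2 ∂S.condLaw ≤ pinnedSqBound L := by
  obtain ⟨v₀, hv₀⟩ := S.plus_nonempty
  have hv₀p : v₀ ∈ S.pinnedSites := by
    refine S.mem_pinnedSites.2 ⟨S.mem_V_of_mem_D (S.plus_subset v₀ hv₀), fun h => ?_⟩
    have h1 := (S.mem_freeSites.1 h).2
    rw [S.range_of_mem_Vplus hv₀] at h1
    have : (0 : ℝ) ∈ Set.Ioi (0 : ℝ) := h1 ▸ Set.mem_univ _
    simp at this
  obtain ⟨v, hv, hmax⟩ := S.pinnedSites.exists_max_image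
    (fun u => ∫ h, S.field u h ^ 2 ∂S.condLaw) ⟨v₀, hv₀p⟩
  set M := ∫ h, S.field v h ^ 2 ∂S.condLaw
  have hM0 : 0 ≤ M := integral_nonneg fun h => sq_nonneg _
  suffices hM : M ≤ pinnedSqBound L from fun u hu => (hmax u hu).trans hM
  obtain ⟨hvV, hvf⟩ := S.mem_pinnedSites.1 hv
  have hov := sq_nonneg siteOvershoot
  by_cases hvD : TGpos v ∈ S.D
  swap
  · have hfr : TGpos v ∈ frontier S.D := by
      rw [S.isTGRegion.isOpen.frontier_eq]; exact ⟨hvV, hvD⟩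
    have : M ≤ ∫ _, L ^ 2 ∂S.condLaw := by
      refine integral_mono_ae (S.integrable_field_sq v) (integrable_const _) ?_
      filter_upwards [S.field_bdry_abs_le hL] with h hh
      rw [← sq_abs]
      exact pow_le_pow_left₀ (abs_nonneg _) (hh v hfr) 2
    simp only [integral_const, probReal_univ, one_smul] at this
    unfold pinnedSqBound
    nlinarith [sq_nonneg L]
  have hfin : M ≤ 0.92 * M + (37 + L ^ 2 + 5 * siteOvershoot ^ 2) := by
    by_cases hp : v ∈ S.Vplus
    · obtain ⟨w, hvw, hw⟩ := S.plus_neighbor v hp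
      have hd := (TG_adj_iff v w).1 hvw
      have hvw' : v + (w - v) = w := by abel
      refine S.integral_signed_sq_le hvD hvf hd (Or.inl rfl) hM0 (fun m => ?_) hmax ?_
      · rw [S.range_of_mem_Vplus hp, one_mul]; exact mul_siteMean_Ioi_le m
      · rw [hvw']
        rcases hw with hw | hw
        · filter_upwards [S.ae_mem_range] with h hh
          have hwV := S.mem_V_of_mem_D (S.minus_subset w hw)
          have := hh ⟨w, hwV⟩
          rw [S.range_of_mem_Vminus hw] at this
          have h1 : h ⟨w, hwV⟩ < 0 := this
          rw [S.field_of_mem hwV, max_eq_right (by linarith)]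
          exact hL0
        · filter_upwards [S.field_bdry_abs_le hL] with h hh
          rw [one_mul]
          exact max_le ((le_abs_self _).trans (hh w hw)) hL0
    · have hm : v ∈ S.Vminus := by
        by_contra hm
        exact hvf (S.mem_freeSites.2 ⟨hvD, S.range_of_notMem hp hm⟩)
      obtain ⟨w, hvw, hw⟩ := S.minus_neighbor v hm
      have hd := (TG_adj_iff v w).1 hvw
      have hvw' : v + (w - v) = w := by abel
      refine S.integral_signed_sq_le hvD hvf hd (Or.inr rfl) hM0 (fun m => ?_) hmax ?_
      · rw [S.range_of_mem_Vminus hm, siteMean_Iio]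
        have := mul_siteMean_Ioi_le (-m)
        rw [neg_one_mul]
        linarith
      · rw [hvw']
        rcases hw with hw | hw
        · filter_upwards [S.ae_mem_range] with h hh
          have hwV := S.mem_V_of_mem_D (S.plus_subset w hw)
          have := hh ⟨w, hwV⟩
          rw [S.range_of_mem_Vplus hw] at this
          have h1 : 0 < h ⟨w, hwV⟩ := this
          rw [S.field_of_mem hwV, max_eq_right (by linarith)]
          exact hL0
        · filter_upwards [S.field_bdry_abs_le hL] with h hh
          rw [neg_one_mul]
          exact max_le ((neg_le_abs _).trans (hh w hw)) hL0
  unfold pinnedSqBound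
  linarith [sq_nonneg L]

theorem _root_.pinnedSqBound_nonneg (L : ℝ) : 0 ≤ pinnedSqBound L := by
  unfold pinnedSqBound; positivity

theorem notMem_freeSites_of_mem_U {v : TGVertex} (hv : v ∈ S.U) : v ∉ S.freeSites := by
  intro h
  obtain ⟨h1, h2⟩ := S.mem_freeSites.1 h
  rcases hv with (hv | hv) | hv
  · have : TGpos v ∈ frontier S.D := hv
    rw [S.isTGRegion.isOpen.frontier_eq] at this
    exact this.2 h1
  · rw [S.range_of_mem_Vplus hv] at h2
    have : (0 : ℝ) ∈ Set.Ioi (0 : ℝ) := h2 ▸ Set.mem_univ _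
    simp at this
  · rw [S.range_of_mem_Vminus hv] at h2
    have : (0 : ℝ) ∈ Set.Iio (0 : ℝ) := h2 ▸ Set.mem_univ _
    simp at this

theorem integral_field_sq_le_of_neighbor {L : ℝ} (hL0 : 0 ≤ L) (hL : S.BoundaryBoundedBy L)
    {v d : TGVertex} (hv : v ∈ S.U) (hd : d ∈ TGdirs) :
    ∫ h, S.field (v + d) h ^ 2 ∂S.condLaw ≤ 4 + 2 * pinnedSqBound L := by
  have := S.integral_field_sq_le (pinnedSqBound_nonneg L) (S.integral_pinned_sq_le hL0 hL)
    (S.integral_deviation_sq_le_two (S.notMem_freeSites_of_mem_U hv) hd)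
  linarith

theorem integral_field_sq_le_log {L : ℝ} (hL0 : 0 ≤ L) (hL : S.BoundaryBoundedBy L)
    (h0 : (0 : TGVertex) ∈ S.U) {w : TGVertex} {N : ℕ} (h1 : w.1.natAbs ≤ N)
    (h2 : w.2.natAbs ≤ N) :
    ∫ h, S.field w h ^ 2 ∂S.condLaw ≤ 256 * (1 + Real.log N) + 2 * pinnedSqBound L := by
  have hlog := Real.log_natCast_nonneg N
  have := S.integral_field_sq_le (pinnedSqBound_nonneg L) (S.integral_pinned_sq_le hL0 hL)
    (S.integral_deviation_sq_le (w := w) (by positivity) (S.notMem_freeSites_of_mem_U h0)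
      fun φ hφ => sub_sq_le_log_mul_TGenergy hφ w h1 h2)
  linarith

end SignedSystem

/-! ## Couplings -/

namespace IsCouplingOf

variable {α β : Type*} [MeasurableSpace α] [MeasurableSpace β] {P : Measure (α × β)}
  {μ : Measure α} {ν : Measure β}

theorem integrable_fst (hP : IsCouplingOf P μ ν) {f : α → ℝ} (hf : Integrable f μ) :
    Integrable (fun p => f p.1) P := by
  rw [← hP.map_fst] at hf
  exact hf.comp_measurable measurable_fst

theorem integrable_snd (hP : IsCouplingOf P μ ν) {f : β → ℝ} (hf : Integrable f ν) :
    Integrable (fun p => f p.2) P := by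
  rw [← hP.map_snd] at hf
  exact hf.comp_measurable measurable_snd

theorem integral_fst (hP : IsCouplingOf P μ ν) {f : α → ℝ} (hf : Integrable f μ) :
    ∫ p, f p.1 ∂P = ∫ a, f a ∂μ := by
  rw [← hP.map_fst] at hf ⊢
  exact (integral_map measurable_fst.aemeasurable hf.aestronglyMeasurable).symm

theorem integral_snd (hP : IsCouplingOf P μ ν) {f : β → ℝ} (hf : Integrable f ν) :
    ∫ p, f p.2 ∂P = ∫ a, f a ∂ν := by
  rw [← hP.map_snd] at hf ⊢
  exact (integral_map measurable_snd.aemeasurable hf.aestronglyMeasurable).symm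

theorem ae_fst (hP : IsCouplingOf P μ ν) {q : α → Prop} (h : ∀ᵐ a ∂μ, q a) :
    ∀ᵐ p ∂P, q p.1 := by
  rw [← hP.map_fst] at h
  exact ae_of_ae_map measurable_fst.aemeasurable h

theorem ae_snd (hP : IsCouplingOf P μ ν) {q : β → Prop} (h : ∀ᵐ a ∂ν, q a) :
    ∀ᵐ p ∂P, q p.2 := by
  rw [← hP.map_snd] at h
  exact ae_of_ae_map measurable_snd.aemeasurable h

theorem prod [IsProbabilityMeasure μ] [IsProbabilityMeasure ν] :
    IsCouplingOf (μ.prod ν) μ ν :=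
  ⟨inferInstance, by simp, by simp⟩

end IsCouplingOf

/-! ### Distances under a coupling and simultaneous resampling at one vertex -/

namespace SignedSystem

variable {S T : SignedSystem}

/-- The expected distance of the two fields at a vertex. -/
noncomputable def fieldDist (P : Measure ((S.V → ℝ) × (T.V → ℝ))) (v : TGVertex) : ℝ :=
  ∫ p, |S.field v p.1 - T.field v p.2| ∂P

/-- The expected distance of the two local means at a vertex. -/
noncomputable def meanDist (P : Measure ((S.V → ℝ) × (T.V → ℝ))) (v : TGVertex) : ℝ :=
  ∫ p, |S.nbrMean v p.1 - T.nbrMean v p.2| ∂P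

/-- The expected distance of the two gaps at a vertex. -/
noncomputable def gapDist (P : Measure ((S.V → ℝ) × (T.V → ℝ))) (v : TGVertex) : ℝ :=
  ∫ p, |siteGap (S.range v) (S.nbrMean v p.1) - siteGap (S.range v) (T.nbrMean v p.2)| ∂P

theorem fieldDist_nonneg (P : Measure ((S.V → ℝ) × (T.V → ℝ))) (v : TGVertex) :
    0 ≤ fieldDist P v := integral_nonneg fun _ => abs_nonneg _

theorem gapDist_nonneg (P : Measure ((S.V → ℝ) × (T.V → ℝ))) (v : TGVertex) :
    0 ≤ gapDist P v := integral_nonneg fun _ => abs_nonneg _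

theorem integrable_fieldDist {P : Measure ((S.V → ℝ) × (T.V → ℝ))}
    (hP : IsCouplingOf P S.condLaw T.condLaw) (v : TGVertex) :
    Integrable (fun p => |S.field v p.1 - T.field v p.2|) P :=
  ((hP.integrable_fst ((S.memLp_field v).integrable one_le_two)).sub
    (hP.integrable_snd ((T.memLp_field v).integrable one_le_two))).abs

theorem integrable_meanDist {P : Measure ((S.V → ℝ) × (T.V → ℝ))}
    (hP : IsCouplingOf P S.condLaw T.condLaw) (v : TGVertex) :
    Integrable (fun p => |S.nbrMean v p.1 - T.nbrMean v p.2|) P :=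
  ((hP.integrable_fst ((S.memLp_nbrMean v).integrable one_le_two)).sub
    (hP.integrable_snd ((T.memLp_nbrMean v).integrable one_le_two))).abs

theorem _root_.abs_siteGap_sub_le {I : Set ℝ} (hI : IsSiteRange I) (m m' : ℝ) :
    |siteGap I m - siteGap I m'| ≤ |m - m'| := by
  have h1 := integral_abs_siteQuantile_sub hI m m'
  have h2 : 0 ≤ ∫ u, |siteQuantile I m u - siteQuantile I m' u| ∂unifLaw :=
    integral_nonneg fun _ => abs_nonneg _
  linarith

theorem integrable_gapDist {P : Measure ((S.V → ℝ) × (T.V → ℝ))}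
    (hP : IsCouplingOf P S.condLaw T.condLaw) (v : TGVertex) :
    Integrable (fun p => |siteGap (S.range v) (S.nbrMean v p.1) -
      siteGap (S.range v) (T.nbrMean v p.2)|) P := by
  have hg : Measurable (siteGap (S.range v)) := (siteGap_mono (S.isSiteRange_range v)).measurable
  have h1 := hg.comp ((S.measurable_nbrMean v).comp
    (measurable_fst : Measurable (Prod.fst : (S.V → ℝ) × (T.V → ℝ) → _)))
  have h2 := hg.comp ((T.measurable_nbrMean v).comp
    (measurable_snd : Measurable (Prod.snd : (S.V → ℝ) × (T.V → ℝ) → _)))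
  refine (integrable_meanDist hP v).mono' (h1.sub h2).abs.aestronglyMeasurable ?_
  filter_upwards with p
  rw [Real.norm_of_nonneg (abs_nonneg _)]
  exact abs_siteGap_sub_le (S.isSiteRange_range v) _ _

theorem meanDist_le {P : Measure ((S.V → ℝ) × (T.V → ℝ))}
    (hP : IsCouplingOf P S.condLaw T.condLaw) (v : TGVertex) :
    meanDist P v ≤ (∑ d ∈ TGdirs, fieldDist P (v + d)) / 6 := by
  simp only [meanDist, fieldDist]
  rw [← integral_finsetSum _ fun d _ => integrable_fieldDist hP (v + d), ← integral_div]
  refine integral_mono (integrable_meanDist hP v)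
    ((integrable_finsetSum _ fun d _ => integrable_fieldDist hP (v + d)).div_const 6) fun p => ?_
  simp only [nbrMean]
  rw [← sub_div, ← Finset.sum_sub_distrib, abs_div, abs_of_pos (by norm_num : (0 : ℝ) < 6)]
  exact div_le_div_of_nonneg_right (Finset.abs_sum_le_sum_abs _ _) (by norm_num)

/-- The two fields with their values at `v` drawn anew from the same uniform variable. -/
noncomputable def coupledResample (v : TGVertex) (q : ((S.V → ℝ) × (T.V → ℝ)) × ℝ) :
    (S.V → ℝ) × (T.V → ℝ) :=
  (S.resample v (q.1.1, q.2), T.resample v (q.1.2, q.2))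

theorem measurable_coupledResample (v : TGVertex) :
    Measurable (coupledResample (S := S) (T := T) v) :=
  ((S.measurable_resample v).comp ((measurable_fst.comp measurable_fst).prodMk
    measurable_snd)).prodMk
    ((T.measurable_resample v).comp ((measurable_snd.comp measurable_fst).prodMk measurable_snd))

theorem isCouplingOf_map_coupledResample {P : Measure ((S.V → ℝ) × (T.V → ℝ))}
    (hP : IsCouplingOf P S.condLaw T.condLaw) {v : TGVertex} (hS : TGpos v ∈ S.D)
    (hT : TGpos v ∈ T.D) :
    IsCouplingOf ((P.prod unifLaw).map (coupledResample v)) S.condLaw T.condLaw := by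
  have := hP.isProbabilityMeasure
  have hm := measurable_coupledResample (S := S) (T := T) v
  refine ⟨Measure.isProbabilityMeasure_map hm.aemeasurable, ?_, ?_⟩
  · rw [Measure.map_map measurable_fst hm]
    have e : Prod.fst ∘ coupledResample (S := S) (T := T) v =
        S.resample v ∘ Prod.map Prod.fst id := rfl
    rw [e, ← Measure.map_map (S.measurable_resample v) (measurable_fst.prodMap measurable_id),
      ← Measure.map_prod_map _ _ measurable_fst measurable_id, hP.map_fst, Measure.map_id,
      S.map_resample hS]
  · rw [Measure.map_map measurable_snd hm]
    have e : Prod.snd ∘ coupledResample (S := S) (T := T) v =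
        T.resample v ∘ Prod.map Prod.snd id := rfl
    rw [e, ← Measure.map_map (T.measurable_resample v) (measurable_snd.prodMap measurable_id),
      ← Measure.map_prod_map _ _ measurable_snd measurable_id, hP.map_snd, Measure.map_id,
      T.map_resample hT]

theorem fieldDist_map_coupledResample {P : Measure ((S.V → ℝ) × (T.V → ℝ))}
    (hP : IsCouplingOf P S.condLaw T.condLaw) {v : TGVertex} (hS : TGpos v ∈ S.D)
    (hT : TGpos v ∈ T.D) (w : TGVertex) :
    fieldDist ((P.prod unifLaw).map (coupledResample v)) w =
      ∫ p, ∫ u, |S.field w (S.resample v (p.1, u)) - T.field w (T.resample v (p.2, u))|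
        ∂unifLaw ∂P := by
  have := hP.isProbabilityMeasure
  have hm := measurable_coupledResample (S := S) (T := T) v
  have hi := integrable_fieldDist (isCouplingOf_map_coupledResample hP hS hT) w
  rw [fieldDist, integral_map hm.aemeasurable hi.aestronglyMeasurable]
  exact integral_prod _ (hi.comp_measurable hm)

theorem fieldDist_map_coupledResample_of_ne {P : Measure ((S.V → ℝ) × (T.V → ℝ))}
    (hP : IsCouplingOf P S.condLaw T.condLaw) {v w : TGVertex} (hS : TGpos v ∈ S.D)
    (hT : TGpos v ∈ T.D) (hw : w ≠ v) :
    fieldDist ((P.prod unifLaw).map (coupledResample v)) w = fieldDist P w := by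
  rw [fieldDist_map_coupledResample hP hS hT, fieldDist]
  simp only [field_resample_of_ne _ hw, integral_const, probReal_univ, one_smul]

theorem fieldDist_map_coupledResample_self {P : Measure ((S.V → ℝ) × (T.V → ℝ))}
    (hP : IsCouplingOf P S.condLaw T.condLaw) {v : TGVertex} (hS : TGpos v ∈ S.D)
    (hT : TGpos v ∈ T.D) (hr : S.range v = T.range v) :
    fieldDist ((P.prod unifLaw).map (coupledResample v)) v = meanDist P v - gapDist P v := by
  rw [fieldDist_map_coupledResample hP hS hT, meanDist, gapDist,
    ← integral_sub (integrable_meanDist hP v) (integrable_gapDist hP v)]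
  simp only [field_resample_self _ (S.mem_V_of_mem_D hS),
    field_resample_self _ (T.mem_V_of_mem_D hT), ← hr,
    integral_abs_siteQuantile_sub (S.isSiteRange_range v)]

/-- The two systems have the same data at the vertex `v`. -/
structure AgreeAt (S T : SignedSystem) (v : TGVertex) : Prop where
  mem_D : TGpos v ∈ S.D ↔ TGpos v ∈ T.D
  mem_V : v ∈ S.V ↔ v ∈ T.V
  range : S.range v = T.range v
  bval : ∀ (hS : v ∈ S.Vbdry) (hT : v ∈ T.Vbdry), S.bval ⟨v, hS⟩ = T.bval ⟨v, hT⟩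

theorem ae_field_eq_bval (S : SignedSystem) {v : TGVertex} (hv : v ∈ S.Vbdry) :
    ∀ᵐ h ∂S.condLaw, S.field v h = S.bval ⟨v, hv⟩ := by
  filter_upwards [S.ae_eq_graphBval] with h hh
  rw [S.field_of_mem (frontier_subset_closure hv), hh ⟨⟨v, frontier_subset_closure hv⟩, hv⟩]
  rfl

theorem AgreeAt.fieldDist_eq_zero {v : TGVertex} (h : AgreeAt S T v)
    {P : Measure ((S.V → ℝ) × (T.V → ℝ))} (hP : IsCouplingOf P S.condLaw T.condLaw)
    (hv : TGpos v ∉ S.D) : fieldDist P v = 0 := by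
  by_cases hV : v ∈ S.V
  · have hS : v ∈ S.Vbdry := by
      change _ ∈ frontier _
      rw [S.isTGRegion.isOpen.frontier_eq]; exact ⟨hV, hv⟩
    have hT : v ∈ T.Vbdry := by
      change _ ∈ frontier _
      rw [T.isTGRegion.isOpen.frontier_eq]; exact ⟨h.mem_V.1 hV, fun e => hv (h.mem_D.2 e)⟩
    refine integral_eq_zero_of_ae ?_
    filter_upwards [hP.ae_fst (S.ae_field_eq_bval hS), hP.ae_snd (T.ae_field_eq_bval hT)]
      with p h1 h2
    rw [h1, h2, h.bval hS hT]
    simp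
  · have hT : v ∉ T.V := fun e => hV (h.mem_V.2 e)
    simp [fieldDist, S.field_of_notMem hV, T.field_of_notMem hT]

/-- Resampling at `v` changes only the term of `v` in the total distance over `B`, replacing it by
the mean distance minus the gap distance. A coupling within `η` of the infimum cannot gain more than
`η`. Near-optimality suffices, so no compactness of the set of couplings is needed. -/
theorem exists_nearly_optimal_coupling {B : Finset TGVertex} (hB : ∀ v ∈ B, AgreeAt S T v)
    {η : ℝ} (hη : 0 < η) : ∃ P : Measure ((S.V → ℝ) × (T.V → ℝ)),
      IsCouplingOf P S.condLaw T.condLaw ∧ ∀ v ∈ B, TGpos v ∈ S.D →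
        fieldDist P v + gapDist P v ≤ meanDist P v + η := by
  set Φ : Measure ((S.V → ℝ) × (T.V → ℝ)) → ℝ := fun P => ∑ v ∈ B, fieldDist P v with hΦ
  set A : Set ℝ := Φ '' {P | IsCouplingOf P S.condLaw T.condLaw} with hA
  have hne : A.Nonempty := ⟨_, _, IsCouplingOf.prod, rfl⟩
  have hbd : BddBelow A := ⟨0, by
    rintro _ ⟨P, -, rfl⟩
    exact Finset.sum_nonneg fun v _ => fieldDist_nonneg P v⟩
  obtain ⟨_, ⟨P, hP, rfl⟩, hlt⟩ := Real.lt_sInf_add_pos hne hη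
  refine ⟨P, hP, fun v hv hvS => ?_⟩
  have hvT := (hB v hv).mem_D.1 hvS
  have hP' := isCouplingOf_map_coupledResample hP hvS hvT
  have hle : Φ P ≤ Φ ((P.prod unifLaw).map (coupledResample v)) + η := by
    have := csInf_le hbd ⟨_, hP', rfl⟩
    linarith
  simp only [hΦ] at hle
  rw [← Finset.add_sum_erase _ _ hv, ← Finset.add_sum_erase _ _ hv,
    fieldDist_map_coupledResample_self hP hvS hvT (hB v hv).range,
    Finset.sum_congr rfl fun w hw =>
      fieldDist_map_coupledResample_of_ne hP hvS hvT (Finset.ne_of_mem_erase hw)] at hle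
  linarith

theorem fieldDist_le {P : Measure ((S.V → ℝ) × (T.V → ℝ))}
    (hP : IsCouplingOf P S.condLaw T.condLaw) {v : TGVertex} {s K : ℝ} (hs : 0 < s)
    (hK : K ≤ s ^ 2) (hS : ∫ h, S.field v h ^ 2 ∂S.condLaw ≤ K)
    (hT : ∫ h, T.field v h ^ 2 ∂T.condLaw ≤ K) : fieldDist P v ≤ 2 * s := by
  have := hP.isProbabilityMeasure
  have i1 := hP.integrable_fst (S.integrable_field_sq v)
  have i2 := hP.integrable_snd (T.integrable_field_sq v)
  have hi : Integrable (fun p : (S.V → ℝ) × (T.V → ℝ) =>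
      s + (S.field v p.1 ^ 2 + T.field v p.2 ^ 2) / (2 * s)) P :=
    (integrable_const s).add ((i1.add i2).div_const _)
  have i3 : Integrable (fun p : (S.V → ℝ) × (T.V → ℝ) =>
      (S.field v p.1 ^ 2 + T.field v p.2 ^ 2) / (2 * s)) P := (i1.add i2).div_const _
  -- The arithmetic-geometric mean inequality, with the scale `s` of the typical field size; it
  -- turns second moments into a bound for the distance.
  have key : ∀ x : ℝ, |x| ≤ s / 2 + x ^ 2 / (2 * s) := fun x => by
    have e : s / 2 + x ^ 2 / (2 * s) - |x| = (s - |x|) ^ 2 / (2 * s) := by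
      rw [← sq_abs x]; field_simp; ring
    have : 0 ≤ (s - |x|) ^ 2 / (2 * s) := by positivity
    linarith
  calc fieldDist P v ≤ ∫ p, (s + (S.field v p.1 ^ 2 + T.field v p.2 ^ 2) / (2 * s)) ∂P := by
        refine integral_mono (integrable_fieldDist hP v) hi fun p => ?_
        have h1 := key (S.field v p.1)
        have h2 := key (T.field v p.2)
        have h3 := abs_sub (S.field v p.1) (T.field v p.2)
        simp only
        rw [add_div]
        linarith
    _ = s + (∫ h, S.field v h ^ 2 ∂S.condLaw + ∫ h, T.field v h ^ 2 ∂T.condLaw) / (2 * s) := by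
        rw [integral_add (integrable_const s) i3, integral_div,
          integral_add i1 i2, hP.integral_fst (S.integrable_field_sq v),
          hP.integral_snd (T.integrable_field_sq v)]
        simp
    _ ≤ s + (s ^ 2 + s ^ 2) / (2 * s) := by gcongr <;> linarith
    _ = 2 * s := by field_simp; ring

theorem integral_nbrMean_sq_le {L : ℝ} (hL0 : 0 ≤ L) (hL : S.BoundaryBoundedBy L)
    {v : TGVertex} (hv : v ∈ S.U) :
    ∫ h, S.nbrMean v h ^ 2 ∂S.condLaw ≤ 4 + 2 * pinnedSqBound L := by
  calc ∫ h, S.nbrMean v h ^ 2 ∂S.condLaw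
      ≤ ∫ h, (∑ d ∈ TGdirs, S.field (v + d) h ^ 2) / 6 ∂S.condLaw := by
        refine integral_mono (S.memLp_nbrMean v).integrable_sq
          ((integrable_finsetSum _ fun d _ => S.integrable_field_sq _).div_const 6) fun h => ?_
        have h1 := sq_sum_le_card_mul_sum_sq (s := TGdirs) (f := fun d => S.field (v + d) h)
        rw [TGdirs_card] at h1
        push_cast at h1
        simp only [nbrMean]
        rw [div_pow]
        linarith
    _ = (∑ d ∈ TGdirs, ∫ h, S.field (v + d) h ^ 2 ∂S.condLaw) / 6 := by
        rw [integral_div, integral_finsetSum _ fun d _ => S.integrable_field_sq _]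
    _ ≤ (∑ _d ∈ TGdirs, (4 + 2 * pinnedSqBound L)) / 6 := by
        gcongr with d hd
        exact S.integral_field_sq_le_of_neighbor hL0 hL hv hd
    _ = _ := by
        rw [Finset.sum_const, TGdirs_card, nsmul_eq_mul]
        push_cast
        ring

end SignedSystem

/-! ## Comparison of the two systems -/

theorem mem_closure_of_inter_eq {D E B : Set ℂ} (h : D ∩ B = E ∩ B) {x : ℂ} (hB : B ∈ nhds x)
    (hx : x ∈ closure D) : x ∈ closure E := by
  rw [mem_closure_iff_nhds] at hx ⊢
  intro t ht
  obtain ⟨y, ⟨hyt, hyB⟩, hyD⟩ := hx _ (Filter.inter_mem ht hB)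
  have : y ∈ E ∩ B := h ▸ ⟨hyD, hyB⟩
  exact ⟨y, hyt, this.1⟩

theorem TGnormSq_abs_le {v : TGVertex} {r : ℝ} (hr : 0 ≤ r) (h : (TGnormSq v : ℝ) ≤ r ^ 2) :
    |(v.1 : ℝ)| ≤ 2 * r ∧ |(v.2 : ℝ)| ≤ 2 * r := by
  simp only [TGnormSq] at h
  push_cast at h
  constructor
  · refine abs_le_of_sq_le_sq ?_ (by positivity)
    nlinarith [sq_nonneg ((v.1 : ℝ) + 2 * v.2)]
  · refine abs_le_of_sq_le_sq ?_ (by positivity)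
    nlinarith [sq_nonneg ((v.2 : ℝ) + 2 * v.1)]

theorem TGnormSq_le_sq {v : TGVertex} {k : ℕ} (h : v.1.natAbs + v.2.natAbs ≤ k) :
    (TGnormSq v : ℝ) ≤ (k : ℝ) ^ 2 := by
  have h1 : (TGnormSq v : ℤ) ≤ (k : ℤ) ^ 2 := by
    have h2 : |v.1| + |v.2| ≤ k := by
      rw [Int.abs_eq_natAbs, Int.abs_eq_natAbs]; omega
    have h3 := abs_nonneg v.1
    have h4 := abs_nonneg v.2
    have h5 : v.1 * v.2 ≤ |v.1| * |v.2| := by rw [← abs_mul]; exact le_abs_self _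
    have h6 := sq_abs v.1
    have h7 := sq_abs v.2
    simp only [TGnormSq]
    nlinarith [mul_nonneg h3 h4]
  exact_mod_cast h1

/-- The clipping argument: away from large values, the gap controls the mean. -/
theorem abs_sub_le_of_siteGap {I : Set ℝ} (hI : IsSiteRange I) {A c : ℝ} (hA : 0 < A) (hc : 0 < c)
    (h : ∀ x ∈ Set.Icc (-A) A, ∀ y ∈ Set.Icc (-A) A,
      c * |x - y| ≤ |siteGap I x - siteGap I y|) (m m' : ℝ) :
    |m - m'| ≤ |siteGap I m - siteGap I m'| / c + (m ^ 2 / A + m' ^ 2 / A) := by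
  wlog hm : m ≤ m' generalizing m m'
  · have := this m' m (le_of_not_ge hm)
    rw [abs_sub_comm m, abs_sub_comm (siteGap I m)]
    linarith
  set clip : ℝ → ℝ := fun x => max (-A) (min A x)
  have hmem : ∀ x, clip x ∈ Set.Icc (-A) A := fun x =>
    ⟨le_max_left _ _, max_le (by linarith) (min_le_left _ _)⟩
  -- The clipping error vanishes on `[-A, A]` and is at most `|x| ≤ x² / A` outside.
  have hdist : ∀ x, |x - clip x| ≤ x ^ 2 / A := by
    intro x
    rw [le_div_iff₀ hA]
    rcases le_total x (-A) with h1 | h1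
    · have e : clip x = -A := by
        simp only [clip]; rw [min_eq_right (by linarith), max_eq_left h1]
      rw [e, abs_of_nonpos (by linarith)]
      nlinarith
    · rcases le_total A x with h2 | h2
      · have e : clip x = A := by
          simp only [clip]; rw [min_eq_left h2, max_eq_right (by linarith)]
        rw [e, abs_of_nonneg (by linarith)]
        nlinarith
      · have e : clip x = x := by
          simp only [clip]; rw [min_eq_right h2, max_eq_right h1]
        rw [e, sub_self, abs_zero, zero_mul]
        exact sq_nonneg x
  -- If the clipped values differ, the interval between them lies in the one between `m` and `m'`,
  -- so monotonicity of the gap applies.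
  have hgap : |siteGap I (clip m) - siteGap I (clip m')| ≤ |siteGap I m - siteGap I m'| := by
    have hmono := siteGap_mono hI
    have hcl : clip m ≤ clip m' := max_le_max_left _ (min_le_min_left _ hm)
    rcases hcl.eq_or_lt with heq | hlt
    · rw [heq, sub_self, abs_zero]; exact abs_nonneg _
    · have h1 : m ≤ clip m := by
        by_contra! hcon
        have : A ≤ m := by
          by_contra! hAm
          have : min A m = m := min_eq_right hAm.le
          simp only [clip, this] at hcon
          exact absurd (le_max_right (-A) m) (not_le.2 hcon)
        have e : clip m = A := by
          simp only [clip]; rw [min_eq_left this, max_eq_right (by linarith)]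
        exact absurd (hmem m').2 (not_le.2 (e ▸ hlt))
      have h2 : clip m' ≤ m' := by
        by_contra! hcon
        have : m' ≤ -A := by
          by_contra! hAm
          have e : clip m' = min A m' := max_eq_right (le_min (by linarith) hAm.le)
          rw [e] at hcon
          exact absurd (min_le_right A m') (not_le.2 hcon)
        have e : clip m' = -A := by
          simp only [clip]; rw [min_eq_right (by linarith), max_eq_left this]
        exact absurd (hmem m).1 (not_le.2 (e ▸ hlt))
      rw [abs_sub_comm, abs_of_nonneg (sub_nonneg.2 (hmono hcl)), abs_sub_comm,
        abs_of_nonneg (sub_nonneg.2 (hmono hm))]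
      linarith [hmono h1, hmono h2]
  have h1 := h _ (hmem m) _ (hmem m')
  have h2 : |clip m - clip m'| ≤ |siteGap I m - siteGap I m'| / c := by
    rw [le_div_iff₀ hc]; linarith
  have h3 : |m - m'| ≤ |m - clip m| + |clip m - clip m'| + |clip m' - m'| := by
    have e : m - m' = (m - clip m) + (clip m - clip m') + (clip m' - m') := by ring
    rw [e]; exact abs_add_three _ _ _
  have h4 := hdist m
  have h5 := hdist m'
  rw [abs_sub_comm] at h5
  linarith

namespace SignedSystem

variable {S T : SignedSystem}

theorem AgreeOn.agreeAt {R : ℝ} (h : S.AgreeOn T (hexBall R)) {v : TGVertex}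
    (hv : ‖TGpos v‖ < R) : AgreeAt S T v := by
  have hB := mem_hexBall_nhds hv
  have hvB := mem_of_mem_nhds hB
  have hD : ∀ {D E : Set ℂ}, D ∩ hexBall R = E ∩ hexBall R → TGpos v ∈ D → TGpos v ∈ E := by
    intro D E h hD
    have : TGpos v ∈ E ∩ hexBall R := h ▸ ⟨hD, hvB⟩
    exact this.1
  refine ⟨⟨hD h.domain, hD h.domain.symm⟩, ⟨mem_closure_of_inter_eq h.domain hB,
    mem_closure_of_inter_eq h.domain.symm hB⟩, ?_, fun hS hT => h.bval v hS hT hvB⟩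
  by_cases hp : v ∈ S.Vplus
  · rw [S.range_of_mem_Vplus hp, T.range_of_mem_Vplus ((h.plus v hvB).1 hp)]
  by_cases hm : v ∈ S.Vminus
  · rw [S.range_of_mem_Vminus hm, T.range_of_mem_Vminus ((h.minus v hvB).1 hm)]
  · rw [S.range_of_notMem hp hm, T.range_of_notMem (fun e => hp ((h.plus v hvB).2 e))
      fun e => hm ((h.minus v hvB).2 e)]

theorem AgreeOn.mem_U {R : ℝ} (h : S.AgreeOn T (hexBall R)) {v : TGVertex}
    (hv : ‖TGpos v‖ < R) (hS : v ∈ S.U) : v ∈ T.U := by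
  have hvB := mem_of_mem_nhds (mem_hexBall_nhds hv)
  have ha := h.agreeAt hv
  rcases hS with (hb | hp) | hm
  · refine Or.inl (Or.inl ?_)
    have hb' : TGpos v ∈ frontier S.D := hb
    change TGpos v ∈ frontier T.D
    rw [S.isTGRegion.isOpen.frontier_eq] at hb'
    rw [T.isTGRegion.isOpen.frontier_eq]
    exact ⟨ha.mem_V.1 hb'.1, fun e => hb'.2 (ha.mem_D.2 e)⟩
  · exact Or.inl (Or.inr ((h.plus v hvB).1 hp))
  · exact Or.inr ((h.minus v hvB).1 hm)

/-- If the expected distances are nearly harmonic at a vertex of `U`, they are small there. -/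
theorem exists_fieldDist_le_of_mem_U {L ε : ℝ} (hL : 0 ≤ L) (hε : 0 < ε) :
    ∃ δ : ℝ, 0 < δ ∧ ∀ (S T : SignedSystem) (v : TGVertex), S.BoundaryBoundedBy L →
      T.BoundaryBoundedBy L → AgreeAt S T v → v ∈ S.U → v ∈ T.U →
      ∀ P : Measure ((S.V → ℝ) × (T.V → ℝ)), IsCouplingOf P S.condLaw T.condLaw →
      TGlap (fieldDist P) v ≤ δ →
      (TGpos v ∈ S.D → fieldDist P v + gapDist P v ≤ meanDist P v + δ) → fieldDist P v ≤ ε := by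
  -- `K` bounds the second moment of the neighbor mean at a vertex of `U`. The choice of `A` makes
  -- the two clipping errors add up to `ε / 2`, and `δ` leaves `ε / 4` for the gap term and `ε / 4`
  -- for the error of near-optimality.
  set K := 4 + 2 * pinnedSqBound L
  have hK : 0 < K := by have := pinnedSqBound_nonneg L; positivity
  set A := 4 * K / ε
  have hA : 0 < A := by positivity
  obtain ⟨c, hc, hcI⟩ := exists_siteGap_lower A
  set δ := min (ε / 4) (c * ε / 8) with hδ
  have hδ0 : 0 < δ := by positivity
  refine ⟨δ, hδ0, fun S T v hSL hTL hag hSU hTU P hP hlap hopt => ?_⟩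
  by_cases hvD : TGpos v ∈ S.D
  swap
  · rw [hag.fieldDist_eq_zero hP hvD]; exact hε.le
  have hI : S.range v = Set.Ioi 0 ∨ S.range v = Set.Iio 0 := by
    rcases hSU with (hb | hp) | hm
    · have hb' : TGpos v ∈ frontier S.D := hb
      rw [S.isTGRegion.isOpen.frontier_eq] at hb'
      exact absurd hvD hb'.2
    · exact Or.inl (S.range_of_mem_Vplus hp)
    · exact Or.inr (S.range_of_mem_Vminus hm)
  have ho := hopt hvD
  have hm := meanDist_le hP v
  rw [TGlap_eq] at hlap
  -- The mean distance is at most the field distance plus `δ / 6`, so near-optimality leaves at most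
  -- `δ + δ / 6` for the gap.
  have hgap : gapDist P v ≤ 2 * δ := by linarith
  have i1 := hP.integrable_fst (S.memLp_nbrMean v).integrable_sq
  have i2 := hP.integrable_snd (T.memLp_nbrMean v).integrable_sq
  have i3 : Integrable (fun p : (S.V → ℝ) × (T.V → ℝ) =>
      S.nbrMean v p.1 ^ 2 / A + T.nbrMean v p.2 ^ 2 / A) P :=
    (i1.div_const A).add (i2.div_const A)
  have hmd : meanDist P v ≤ gapDist P v / c + (K / A + K / A) := by
    calc meanDist P v ≤ ∫ p, (|siteGap (S.range v) (S.nbrMean v p.1) -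
          siteGap (S.range v) (T.nbrMean v p.2)| / c +
          (S.nbrMean v p.1 ^ 2 / A + T.nbrMean v p.2 ^ 2 / A)) ∂P :=
        integral_mono (integrable_meanDist hP v) (((integrable_gapDist hP v).div_const c).add i3)
          fun p => abs_sub_le_of_siteGap (S.isSiteRange_range v) hA hc (hcI _ hI) _ _
      _ = gapDist P v / c + ((∫ h, S.nbrMean v h ^ 2 ∂S.condLaw) / A +
          (∫ h, T.nbrMean v h ^ 2 ∂T.condLaw) / A) := by
        rw [integral_add ((integrable_gapDist hP v).div_const c) i3,
          integral_add (i1.div_const A) (i2.div_const A), integral_div, integral_div, integral_div,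
          hP.integral_fst (S.memLp_nbrMean v).integrable_sq,
          hP.integral_snd (T.memLp_nbrMean v).integrable_sq]
        rfl
      _ ≤ _ := by
        gcongr
        · exact integral_nbrMean_sq_le hL hSL hSU
        · exact integral_nbrMean_sq_le hL hTL hTU
  have e1 : K / A = ε / 4 := by simp only [A]; field_simp
  have e2 : gapDist P v / c ≤ ε / 4 := by
    rw [div_le_iff₀ hc]
    have := min_le_right (ε / 4) (c * ε / 8)
    linarith
  have e3 := min_le_left (ε / 4) (c * ε / 8)
  have e4 := gapDist_nonneg P v
  rw [e1] at hmd
  linarith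

/-- The field has size `s` of order `√(log N)`, while the negative part of the Laplacian of the
cutoff has mass of order `1 / log N`. Their product tends to zero. -/
theorem exists_scale (L : ℝ) {δ : ℝ} (hδ : 0 < δ) (r : ℕ) : ∃ N : ℕ, r ≤ N ∧ 1 ≤ N ∧
    ∃ s : ℝ, 0 < s ∧ 256 * (1 + Real.log ((2 * (N + 1) : ℕ) : ℝ)) + 2 * pinnedSqBound L ≤ s ^ 2 ∧
      2 * s * (14 / Real.log (1 + (N : ℝ) ^ 2)) * (∑' x, 1 / TGbracket x ^ 2) ≤ δ := by
  set Z := ∑' x, 1 / TGbracket x ^ 2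
  have hZ : 0 ≤ Z := tsum_nonneg fun x => by positivity
  -- With `l = log (1 + N²) ≥ 1`, the logarithm in the moment bound is at most `1 + l`, and `256 (2
  -- + l) ≤ 768 l`.
  set C := 768 + 2 * pinnedSqBound L
  have hC : 0 < C := by have := pinnedSqBound_nonneg L; positivity
  set Q := 28 * √C * Z / δ
  have hQ : 0 ≤ Q := by positivity
  have htend : Filter.Tendsto (fun N : ℕ => Real.log (1 + (N : ℝ) ^ 2)) Filter.atTop
      Filter.atTop := by
    refine Real.tendsto_log_atTop.comp (Filter.tendsto_atTop_add_const_left _ _ ?_)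
    exact (Filter.tendsto_pow_atTop two_ne_zero).comp tendsto_natCast_atTop_atTop
  obtain ⟨N, ⟨h1, h2⟩, h3⟩ := (((htend.eventually_ge_atTop (max 1 (Q ^ 2))).and
    (Filter.eventually_ge_atTop r)).and (Filter.eventually_ge_atTop 1)).exists
  set l := Real.log (1 + (N : ℝ) ^ 2) with hl
  have hl1 : 1 ≤ l := (le_max_left _ _).trans h1
  have hl0 : 0 < l := by linarith
  have hQl : Q ≤ √l := Real.le_sqrt_of_sq_le ((le_max_right _ _).trans h1)
  refine ⟨N, h2, h3, √C * √l, by positivity, ?_, ?_⟩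
  · rw [mul_pow, Real.sq_sqrt hC.le, Real.sq_sqrt hl0.le]
    have hN : (1 : ℝ) ≤ N := by exact_mod_cast h3
    have hlog : Real.log ((2 * (N + 1) : ℕ) : ℝ) ≤ 1 + l := by
      have e : ((2 * (N + 1) : ℕ) : ℝ) ≤ 2 * (1 + (N : ℝ) ^ 2) := by
        push_cast; nlinarith
      have := Real.log_le_log (by positivity) e
      rw [Real.log_mul (by norm_num) (by positivity)] at this
      have := Real.log_two_lt_d9
      linarith
    have hp := pinnedSqBound_nonneg L
    simp only [C]
    nlinarith
  · have hs : √l * √l = l := Real.mul_self_sqrt hl0.le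
    have hsl : 0 < √l := Real.sqrt_pos.2 hl0
    have e : 2 * (√C * √l) * (14 / l) * Z = Q * δ / √l := by
      have e1 : 14 / l = 14 / (√l * √l) := by rw [hs]
      rw [e1]
      simp only [Q]
      field_simp
      ring
    rw [e, div_le_iff₀ hsl]
    nlinarith

/-- Some coupling has expected distances with small Laplacian near the origin. -/
theorem exists_coupling_TGlap_le {L δ : ℝ} (hL : 0 ≤ L) (hδ : 0 < δ) (r : ℕ) :
    ∃ N : ℕ, r ≤ N ∧ 1 ≤ N ∧ ∀ S T : SignedSystem, S.BoundaryBoundedBy L →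
      T.BoundaryBoundedBy L → (∀ v, (TGnormSq v : ℝ) < (N : ℝ) ^ 2 → AgreeAt S T v) →
      (0 : TGVertex) ∈ S.U → (0 : TGVertex) ∈ T.U →
      ∃ P : Measure ((S.V → ℝ) × (T.V → ℝ)), IsCouplingOf P S.condLaw T.condLaw ∧
        ∀ v, (TGnormSq v : ℝ) ≤ r → TGlap (fieldDist P) v ≤ δ ∧
          (TGpos v ∈ S.D → fieldDist P v + gapDist P v ≤ meanDist P v + δ) := by
  -- The scale `r + 1` ensures `TGbracket v ≤ N` when `|v|² ≤ r`, so the cutoff is at least `1/2` at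
  -- every such `v`.
  obtain ⟨N, hrN, hN, s, hs, hsK, hsum⟩ := exists_scale L (by positivity : 0 < δ / 4) (r + 1)
  refine ⟨N, by omega, hN, fun S T hSL hTL hag hS0 hT0 => ?_⟩
  set W := ∑' x, logCutoff N x
  have hW : 0 ≤ W := tsum_nonneg fun x => logCutoff_nonneg N x
  -- The optimality error is chosen after `N`, because the total mass `W` of the cutoff depends on
  -- `N`. It contributes `6 η W ≤ δ / 4`; with the `δ / 4` of the scale and the cutoff at least
  -- `1/2`, the Laplacian is at most `δ`.
  set η := min δ (δ / (24 * (W + 1)))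
  have hη : 0 < η := by positivity
  obtain ⟨P, hP, hopt⟩ := exists_nearly_optimal_coupling
    (B := (finite_TGnormSq_lt ((N : ℝ) ^ 2)).toFinset)
    (fun v hv => hag v (by simpa using hv)) hη
  have hopt' : ∀ v, (TGnormSq v : ℝ) < (N : ℝ) ^ 2 → TGpos v ∈ S.D →
      fieldDist P v + gapDist P v ≤ meanDist P v + η := fun v hv => hopt v (by simpa using hv)
  have hlap : ∀ x, (TGnormSq x : ℝ) < (N : ℝ) ^ 2 → -(6 * η) ≤ TGlap (fieldDist P) x := by
    intro x hx
    rw [TGlap_eq]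
    by_cases hxD : TGpos x ∈ S.D
    · have h1 := hopt' x hx hxD
      have h2 := meanDist_le hP x
      have h3 := gapDist_nonneg P x
      linarith
    · rw [(hag x hx).fieldDist_eq_zero hP hxD]
      have := Finset.sum_nonneg fun d (_ : d ∈ TGdirs) => fieldDist_nonneg P (x + d)
      linarith
  have hbd : ∀ x, (TGnormSq x : ℝ) < ((N : ℝ) + 1) ^ 2 → fieldDist P x ≤ 2 * s := by
    intro x hx
    obtain ⟨h1, h2⟩ := TGnormSq_abs_le (by positivity : (0 : ℝ) ≤ (N : ℝ) + 1) hx.le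
    have hab : ∀ a : ℤ, |(a : ℝ)| ≤ 2 * ((N : ℝ) + 1) → a.natAbs ≤ 2 * (N + 1) := by
      intro a ha
      have h : ((a.natAbs : ℕ) : ℝ) ≤ ((2 * (N + 1) : ℕ) : ℝ) := by
        rw [Nat.cast_natAbs]; push_cast; exact ha
      exact_mod_cast h
    exact fieldDist_le hP hs hsK
      (S.integral_field_sq_le_log hL hSL hS0 (hab _ h1) (hab _ h2))
      (T.integral_field_sq_le_log hL hTL hT0 (hab _ h1) (hab _ h2))
  refine ⟨P, hP, fun v hv => ?_⟩
  have hr1 : (r : ℝ) + 1 ≤ N := by exact_mod_cast hrN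
  have hr0 : (0 : ℝ) ≤ r := Nat.cast_nonneg r
  have hvN : (TGnormSq v : ℝ) < (N : ℝ) ^ 2 := by nlinarith
  refine ⟨?_, fun hvD => (hopt' v hvN hvD).trans
    (by linarith [min_le_left δ (δ / (24 * (W + 1)))])⟩
  have hflux := logCutoff_mul_TGlap_le hN (by positivity : 0 ≤ 6 * η)
    (by positivity : 0 ≤ 2 * s) (fieldDist_nonneg P) hbd hlap v
  have hhalf : 1 / 2 ≤ logCutoff N v := by
    refine half_le_logCutoff hN ?_
    have h1 : TGbracket v ≤ N := by unfold TGbracket; linarith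
    have h2 := one_le_TGbracket v
    nlinarith
  have hηW : 6 * η * W ≤ δ / 4 := by
    have h1 : η * (W + 1) ≤ δ / 24 := by
      have h2 := min_le_right δ (δ / (24 * (W + 1)))
      have h3 : η ≤ δ / 24 / (W + 1) := by rwa [div_div]
      rwa [le_div_iff₀ (by positivity)] at h3
    nlinarith
  by_contra! hcon
  have : δ / 2 < logCutoff N v * TGlap (fieldDist P) v := by nlinarith
  linarith

end SignedSystem

/-- A Harnack chain for nonnegative functions with small Laplacian. -/
theorem le_pow_mul_of_TGlap_le {f : TGVertex → ℝ} {δ : ℝ} (hf : ∀ v, 0 ≤ f v) (hδ : 0 ≤ δ)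
    {n : ℕ} (hlap : ∀ v : TGVertex, v.1.natAbs + v.2.natAbs ≤ n → TGlap f v ≤ δ) (k : ℕ)
    (hk : k ≤ n + 1) (v : TGVertex) (hv : v.1.natAbs + v.2.natAbs = k) :
    f v + δ ≤ 7 ^ k * (f 0 + δ) := by
  induction k generalizing v with
  | zero =>
    have : v = 0 := by
      ext
      · simp; omega
      · simp; omega
    rw [this]; simp
  | succ k ih =>
    obtain ⟨w, hw, hd⟩ : ∃ w : TGVertex, w.1.natAbs + w.2.natAbs = k ∧ v - w ∈ TGdirs := by
      obtain ⟨a, b⟩ := v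
      simp only at hv
      rcases lt_trichotomy a 0 with ha | ha | ha
      · refine ⟨(a + 1, b), by simp only; omega, ?_⟩
        rw [mem_TGdirs_iff]; simp [TGnormSq]
      · rcases lt_or_ge b 0 with hb | hb
        · refine ⟨(a, b + 1), by simp only; omega, ?_⟩
          rw [mem_TGdirs_iff]; simp [TGnormSq]
        · refine ⟨(a, b - 1), by simp only; omega, ?_⟩
          rw [mem_TGdirs_iff]; simp [TGnormSq]
      · refine ⟨(a - 1, b), by simp only; omega, ?_⟩
        rw [mem_TGdirs_iff]; simp [TGnormSq]
    have h1 := ih (by omega) w hw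
    have h2 := hlap w (by omega)
    rw [TGlap_eq] at h2
    -- One neighbor is at most the sum over all six, so `f v ≤ 6 f w + δ` and `f v + δ ≤ 7 (f w +
    -- δ)`.
    have h3 := Finset.single_le_sum (f := fun d => f (w + d)) (fun d _ => hf _) hd
    simp only [add_sub_cancel] at h3
    have h4 := hf w
    rw [pow_succ]
    nlinarith

/-! ### From the origin to the window -/

theorem propositionp (L : ℝ) (hL : 0 < L) (ε : ℝ) (hε : 0 < ε) :
    ∃ R : ℝ, 1 / ε < R ∧
      ∀ S T : SignedSystem,
        S.BoundaryBoundedBy L → T.BoundaryBoundedBy L →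
        S.AgreeOn T (hexBall R) →
        ((0, 0) : TGVertex) ∈ S.U →
        ∃ P : Measure ((S.V → ℝ) × (T.V → ℝ)),
          IsCouplingOf P S.condLaw T.condLaw ∧
          ∀ (v : TGVertex) (hS : v ∈ S.V) (hT : v ∈ T.V), TGpos v ∈ hexBall (1 / ε) →
            Integrable (fun p => |p.1 ⟨v, hS⟩ - p.2 ⟨v, hT⟩|) P ∧
            ∫ p, |p.1 ⟨v, hS⟩ - p.2 ⟨v, hT⟩| ∂P < ε := by
  -- A vertex in the window has norm below `2 / ε`, hence coordinates of size at most `4 / ε`, so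
  -- `n` bounds the length of the Harnack chain. The choice of `ε₁` compensates its factor `7 ^ n`.
  set n : ℕ := 2 * ⌈4 / ε⌉₊ with hn
  set ε₁ : ℝ := ε / (3 * 7 ^ n) with hε₁
  have hε₁0 : 0 < ε₁ := by positivity
  obtain ⟨δ₀, hδ₀, hsmall⟩ := SignedSystem.exists_fieldDist_le_of_mem_U hL.le hε₁0
  -- The bound by `ε₁` keeps the additive error of the Harnack chain comparable with the distance at
  -- the origin.
  set δ := min δ₀ ε₁ with hδ
  have hδ0 : 0 < δ := lt_min hδ₀ hε₁0
  -- The squared radius `n ^ 2` covers all vertices with `|a| + |b| ≤ n`, where the chain needs the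
  -- Laplacian bound.
  obtain ⟨N, hnN, hN, hmain⟩ := SignedSystem.exists_coupling_TGlap_le hL.le hδ0 (n ^ 2)
  have hNε : 0 ≤ 1 / ε := by positivity
  refine ⟨N + 1 + 1 / ε, by linarith [(Nat.cast_nonneg N : (0 : ℝ) ≤ N)],
    fun S T hSL hTL hag h0 => ?_⟩
  have hpos : ∀ v, (TGnormSq v : ℝ) < (N : ℝ) ^ 2 → ‖TGpos v‖ < N + 1 + 1 / ε := by
    intro v hv
    rw [← norm_TGpos_sq] at hv
    have := lt_of_pow_lt_pow_left₀ 2 (Nat.cast_nonneg N) hv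
    linarith
  have hN0 : (0 : ℝ) < N := by exact_mod_cast hN
  have h00 : (TGnormSq (0 : TGVertex) : ℝ) = 0 := by simp [TGnormSq]
  have hpos0 := hpos 0 (by rw [h00]; positivity)
  have hT0 : (0 : TGVertex) ∈ T.U := hag.mem_U hpos0 h0
  obtain ⟨P, hP, hPv⟩ := hmain S T hSL hTL (fun v hv => hag.agreeAt (hpos v hv)) h0 hT0
  refine ⟨P, hP, fun v hS hT hv => ?_⟩
  have hfun : (fun p : (S.V → ℝ) × (T.V → ℝ) => |p.1 ⟨v, hS⟩ - p.2 ⟨v, hT⟩|) =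
      fun p => |S.field v p.1 - T.field v p.2| := by
    funext p
    rw [S.field_of_mem hS, T.field_of_mem hT]
  rw [hfun]
  refine ⟨SignedSystem.integrable_fieldDist hP v, ?_⟩
  change SignedSystem.fieldDist P v < ε
  have hd0 : SignedSystem.fieldDist P 0 ≤ ε₁ := by
    have h1 := hPv 0 (by rw [h00]; positivity)
    exact hsmall S T 0 hSL hTL (hag.agreeAt hpos0) h0 hT0 P hP (h1.1.trans (min_le_left _ _))
      fun h => (h1.2 h).trans (by linarith [min_le_left δ₀ ε₁])
  have hvn : v.1.natAbs + v.2.natAbs ≤ n := by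
    have h1 := norm_TGpos_lt_of_mem_hexBall hv
    have h2 : (TGnormSq v : ℝ) ≤ (2 * (1 / ε)) ^ 2 := by
      rw [← norm_TGpos_sq]
      exact pow_le_pow_left₀ (norm_nonneg _) h1.le 2
    obtain ⟨h3, h4⟩ := TGnormSq_abs_le (by positivity) h2
    have hab : ∀ a : ℤ, |(a : ℝ)| ≤ 2 * (2 * (1 / ε)) → a.natAbs ≤ ⌈4 / ε⌉₊ := by
      intro a ha
      have h : ((a.natAbs : ℕ) : ℝ) ≤ (⌈4 / ε⌉₊ : ℝ) := by
        rw [Nat.cast_natAbs]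
        push_cast
        refine ha.trans (le_trans (le_of_eq ?_) (Nat.le_ceil _))
        ring
      exact_mod_cast h
    have h5 := hab _ h3
    have h6 := hab _ h4
    omega
  have hch := le_pow_mul_of_TGlap_le (SignedSystem.fieldDist_nonneg P) hδ0.le
    (fun w hw => (hPv w (by push_cast; exact TGnormSq_le_sq hw)).1) _ (by omega) v rfl
  have h7 : (7 : ℝ) ^ (v.1.natAbs + v.2.natAbs) ≤ 7 ^ n := pow_le_pow_right₀ (by norm_num) hvn
  have h8 : SignedSystem.fieldDist P 0 + δ ≤ 2 * ε₁ := by linarith [min_le_right δ₀ ε₁]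
  have h9 := SignedSystem.fieldDist_nonneg P 0
  calc SignedSystem.fieldDist P v ≤ 7 ^ (v.1.natAbs + v.2.natAbs) *
        (SignedSystem.fieldDist P 0 + δ) := by linarith
    _ ≤ 7 ^ n * (2 * ε₁) := by gcongr
    _ = 2 / 3 * ε := by rw [hε₁]; field_simp
    _ < ε := by linarith
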